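/- For $n\ge 2$ let $C_n=[-\tfrac12,\tfrac12]^n\subset\mathbb{R}^n$ be the unit cube. For a unit vector $u=(x_1,\dots,x_n)$ let $P_u$ be the orthogonal projection of $C_n$ onto the hyperplane $u^\perp\cong\mathbb{R}^{n-1}$, and let $ar(u)$ be the surface area of $P_u$, i.e. the $(n-2)$-dimensional measure of the boundary of $P_u$ in $u^\perp$. Let $\mathbb{E}$ denote expectation when $u$ is uniformly distributed on the unit sphere of $\mathbb{R}^n$. Write $$K(\xi)=\int_0^{\pi/2}\frac{d\theta}{\sqrt{1-\xi^2\sin^2\theta}},\qquad E(\xi)=\int_0^{\pi/2}\sqrt{1-\xi^2\sin^2\theta}\,d\theta$$ for the complete elliptic integrals, let $$\zeta_4=256\cdot\frac{4}{3\pi^2}\int_0^\infty\frac{(8t^4+8t^2-1)E(it)^2-2(4t^4+3t^2-1)E(it)K(it)+(2t^4+t^2-1)K(it)^2}{(2t^2+1)^5}\,t\,dt ,$$ where the integral converges absolutely, and for $n\ge 3$, $n\neq 4$, let $$\zeta_n=4n\,\mathbb{E}\Big(\sqrt{x_1^2+x_2^2}\,\sqrt{x_1^2+x_3^2}\Big).$$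 1. For every $n\ge2$ and every unit vector $u=(x_1,\dots,x_n)$, $$ar(u)=2\sum_{1\le i<j\le n}\sqrt{x_i^2+x_j^2}.$$ 2. For $n=4$: $\mathbb{E}(ar)=8$ and $\mathbb{E}(ar^2)=12+6\zeta_4+3\pi$; moreover $\max(ar)=6\sqrt2$ and $\min(ar)=6$ over all unit vectors. 3. The following triple integrals have the stated values: $$\int_0^{\pi/2}\!\!\int_0^{\pi/2}\!\!\int_0^{\pi/2}\sin\varphi\sin\psi\sqrt{\cos^2\varphi\sin^2\psi+\cos^2\psi}\;\frac{1}{2\pi^2}\sin\varphi\sin^2\psi\,d\psi\,d\varphi\,d\theta=\frac{\pi}{128},$$ $$\int_0^{\pi/2}\!\!\int_0^{\pi/2}\!\!\int_0^{\pi/2}\sin\varphi\sin\psi\sqrt{\sin^2\theta\sin^2\varphi\sin^2\psi+\cos^2\psi}\;\frac{1}{2\pi^2}\sin\varphi\sin^2\psi\,d\psi\,d\varphi\,d\theta=\frac{\zeta_4}{256}.$$ 4. For every $n\ge2$, $$\mathbb{E}(ar)=\frac{\sqrt{\pi}\,(n-1)n}{2}\,\frac{\Gamma(n/2)}{\Gamma((n+1)/2)},$$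 and for every $n\ge3$, $$\mathbb{E}(ar^2)=4(n-1)+(n-2)(n-1)\zeta_n+\frac{(n-3)(n-2)(n-1)}{2}\pi .$$ The formula defining $\zeta_n$ for $n\ne4$ is also valid for $n=4$: $\zeta_4=16\,\mathbb{E}\big(\sqrt{x_1^2+x_2^2}\sqrt{x_1^2+x_3^2}\big)$. -/

import Mathlib

open MeasureTheory

noncomputable section

namespace CubeShadow

/-- The cube with edges of unit length centred at the origin of `ℝⁿ`. -/
def cube (n : ℕ) : Set (EuclideanSpace ℝ (Fin n)) :=
  {x | ∀ i, |x i| ≤ 1 / 2}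

/-- The hyperplane of all vectors orthogonal to `u`. -/
abbrev hyperplane {n : ℕ} (u : EuclideanSpace ℝ (Fin n)) :
    Submodule ℝ (EuclideanSpace ℝ (Fin n)) :=
  (Submodule.span ℝ {u})ᗮ

/-- The orthogonal projection of the cube onto the hyperplane `uᗮ`, as a subset of that
hyperplane. -/
def shadow {n : ℕ} (u : EuclideanSpace ℝ (Fin n)) : Set (hyperplane u) :=
  (hyperplane u).orthogonalProjectionOnto '' cube n

/-- The surface area of the projected polyhedron: the `(n - 2)`-dimensional Euclidean Hausdorff
measure (normalized to agree with Lebesgue measure on `ℝⁿ⁻²`) of its boundary relative to the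
`(n - 1)`-dimensional hyperplane `uᗮ`. Used for `2 ≤ n` and `u` of unit length. -/
def surfaceArea {n : ℕ} (u : EuclideanSpace ℝ (Fin n)) : ENNReal :=
  Measure.euclideanHausdorffMeasure (n - 2) (frontier (shadow u))

/-- The surface area as a real number. -/
def ar {n : ℕ} (u : EuclideanSpace ℝ (Fin n)) : ℝ :=
  (surfaceArea u).toReal

/-- The uniform probability distribution on the unit sphere of `ℝⁿ`, `1 ≤ n`. -/
def uniformSphere (n : ℕ) : Measure (Metric.sphere (0 : EuclideanSpace ℝ (Fin n)) 1) :=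
  ((volume : Measure (EuclideanSpace ℝ (Fin n))).toSphere Set.univ)⁻¹ •
    (volume : Measure (EuclideanSpace ℝ (Fin n))).toSphere

/-- The expectation `𝔼 f(U)` for `U` uniform on the unit sphere of `ℝⁿ`. -/
def sphereMean (n : ℕ) (f : EuclideanSpace ℝ (Fin n) → ℝ) : ℝ :=
  ∫ u, f (u : EuclideanSpace ℝ (Fin n)) ∂(uniformSphere n)

/-- The complete elliptic integral of the first kind as a function of the parameter `m = ξ²`,
`ξ` being the modulus; so `K(i t)` is `ellipticK (-t ^ 2)`. -/
def ellipticK (m : ℝ) : ℝ :=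
  ∫ θ in (0 : ℝ)..Real.pi / 2, 1 / √(1 - m * Real.sin θ ^ 2)

/-- The complete elliptic integral of the second kind as a function of the parameter `m = ξ²`,
`ξ` being the modulus; so `E(i t)` is `ellipticE (-t ^ 2)`. -/
def ellipticE (m : ℝ) : ℝ :=
  ∫ θ in (0 : ℝ)..Real.pi / 2, √(1 - m * Real.sin θ ^ 2)

/-- The integrand of the expression for `ζ₄ / 256` in terms of `E(i t)` and `K(i t)`. -/
def zetaFourIntegrand (t : ℝ) : ℝ :=
  ((8 * t ^ 4 + 8 * t ^ 2 - 1) * ellipticE (-t ^ 2) ^ 2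
      - 2 * (4 * t ^ 4 + 3 * t ^ 2 - 1) * ellipticE (-t ^ 2) * ellipticK (-t ^ 2)
      + (2 * t ^ 4 + t ^ 2 - 1) * ellipticK (-t ^ 2) ^ 2) / (2 * t ^ 2 + 1) ^ 5 * t

/-- The explicit constant `ζ₄ = 7.1185587167...`. -/
def zetaFour : ℝ :=
  256 * (4 / (3 * Real.pi ^ 2) * ∫ t in Set.Ioi (0 : ℝ), zetaFourIntegrand t)

/-- The constant `ζₙ = 4 n 𝔼(√(x₁² + x₂²) √(x₁² + x₃²))` for `n ≥ 3`. -/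
def zeta (n : ℕ) (hn : 3 ≤ n) : ℝ :=
  4 * n * sphereMean n fun x =>
    √(x ⟨0, by omega⟩ ^ 2 + x ⟨1, by omega⟩ ^ 2) * √(x ⟨0, by omega⟩ ^ 2 + x ⟨2, by omega⟩ ^ 2)

end CubeShadow

end

open MeasureTheory

noncomputable section

/-! ### Geometry: the boundary of the projected cube is a union of projected codimension-two faces.
-/

namespace CubeShadow

open Filter Topology

/-! Geometry. A boundary point of the shadow comes from a line in direction `u` that only grazes the
cube: the line meets a face of codimension two on which one coordinate `i` is already at its exit
value and another coordinate `j` is still at its entry value. Hence the boundary is the union of the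
projections of `face u i j` over ordered pairs `i ≠ j` (`frontier_shadow`). Overlaps are null
(`aedisjoint_proj_face`), and a Gram determinant of the form `det (1 - v vᵀ)` shows that projection
scales the measure of such a unit face by `√(u i ^ 2 + u j ^ 2)`. Summing gives the formula for the
surface area.

Moments. The surface area and its square are homogeneous functions restricted to the sphere, so
their spherical means are Gaussian means up to a ratio of Gamma values (`sphereMean_homogeneous`).
Under the Gaussian measure the coordinates are independent. A product of two summands therefore
depends only on how many indices are shared: two indices give `1`, none gives `π / 4`, and one gives
the constant `gaussTriple`. This constant does not depend on `n`, which is why `zeta n` is the same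
number for all `n ≥ 3`. Spherical coordinates in three dimensions turn it into `angleIntegral`;
spherical coordinates in four dimensions turn the two stated triple integrals into the same Gaussian
moments.

The constant for `n = 4`. It remains to identify `angleIntegral` with the integral of the quadratic
form in `E(it)` and `K(it)`, and both are reduced to the integrals `R_j` of `(1 - sin² ξ) ^ j / √(1
- sin² ξ cos² θ)` for `j = 1, 2`. On one side, integration by parts in either angle gives
`angleIntegral = 5 R₁ - 6 R₂` (`angleIntegral_eq`). On the other side, differentiating
`zetaFourPrimitive` removes all terms in `E`, leaving integrals of `K(it)² t / (2t² + 1) ^ k` for `k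
= 3, 5`. These are evaluated by writing `K²` as an integral of `K` (`ellipticK_sq`), a product
formula for Legendre functions of degree `-1/2` obtained from a Landen-type identity; after Tonelli
one angular integral is elementary and `R₁`, `R₂` remain.

Extrema for `n = 4`. The squares of the twelve summands add up to `6`, and each lies in `[0, 1]`.
The lower bound is `s ≤ √s` on `[0, 1]`; the upper bound is Cauchy-Schwarz. -/

/-- Half the sign of the `i`-th coordinate of `u`, with the sign of `0` taken to be `1`. -/
def side {n : ℕ} (u : EuclideanSpace ℝ (Fin n)) (i : Fin n) : ℝ :=
  if 0 ≤ u i then 1 / 2 else -(1 / 2)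

/-- The face of codimension two of the cube on which the `i`-th coordinate has the sign of `u i`
and the `j`-th coordinate has the opposite of the sign of `u j`. -/
def face {n : ℕ} (u : EuclideanSpace ℝ (Fin n)) (i j : Fin n) : Set (EuclideanSpace ℝ (Fin n)) :=
  {c | c ∈ cube n ∧ c i = side u i ∧ c j = -side u j}

/-- The orthogonal projection onto the hyperplane `uᗮ`. -/
abbrev proj {n : ℕ} (u : EuclideanSpace ℝ (Fin n)) :
    EuclideanSpace ℝ (Fin n) →L[ℝ] hyperplane u :=
  (hyperplane u).orthogonalProjectionOnto

variable {n : ℕ} {u : EuclideanSpace ℝ (Fin n)}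

lemma abs_side (u : EuclideanSpace ℝ (Fin n)) (i : Fin n) : |side u i| = 1 / 2 := by
  unfold side; split_ifs <;> norm_num [abs_of_pos]

lemma side_of_nonneg {i : Fin n} (h : 0 ≤ u i) : side u i = 1 / 2 := by simp [side, h]

lemma side_of_neg {i : Fin n} (h : u i < 0) : side u i = -(1 / 2) := by
  simp [side, not_le.2 h]

lemma two_mul_side_mul (u : EuclideanSpace ℝ (Fin n)) (i : Fin n) :
    2 * side u i * u i = |u i| := by
  rcases le_or_gt 0 (u i) with h | h
  · rw [side_of_nonneg h, abs_of_nonneg h]; ring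
  · rw [side_of_neg h, abs_of_neg h]; ring

lemma side_mul_self (u : EuclideanSpace ℝ (Fin n)) (i : Fin n) : side u i * side u i = 1 / 4 := by
  unfold side; split_ifs <;> norm_num

lemma side_ne_neg (u : EuclideanSpace ℝ (Fin n)) (i : Fin n) : side u i ≠ -side u i := by
  unfold side; split_ifs <;> norm_num

lemma proj_eq_iff (a b : EuclideanSpace ℝ (Fin n)) :
    proj u a = proj u b ↔ ∃ t : ℝ, b = a + t • u := by
  rw [eq_comm, ← sub_eq_zero, ← map_sub, Submodule.orthogonalProjectionOnto_eq_zero_iff,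
    Submodule.orthogonal_orthogonal, Submodule.mem_span_singleton]
  constructor
  · rintro ⟨t, ht⟩; exact ⟨t, by rw [ht]; abel⟩
  · rintro ⟨t, rfl⟩; exact ⟨t, by abel⟩

lemma isCompact_cube (n : ℕ) : IsCompact (cube n) := by
  have : cube n = (PiLp.continuousLinearEquiv 2 ℝ (fun _ : Fin n => ℝ)).symm ''
      (Set.univ.pi fun _ => Set.Icc (-(1 / 2)) (1 / 2)) := by
    ext x
    constructor
    · intro hx
      refine ⟨fun i => x i, fun i _ => ?_, by ext; simp⟩
      exact abs_le.1 (hx i)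
    · rintro ⟨y, hy, rfl⟩ i
      exact abs_le.2 (hy i trivial)
  rw [this]
  exact (isCompact_univ_pi fun _ => isCompact_Icc).image (ContinuousLinearEquiv.continuous _)

lemma continuous_coord (i : Fin n) : Continuous fun c : EuclideanSpace ℝ (Fin n) => c i := by
  fun_prop

lemma isCompact_face (u : EuclideanSpace ℝ (Fin n)) (i j : Fin n) : IsCompact (face u i j) := by
  have : face u i j = cube n ∩ ({c | c i = side u i} ∩ {c | c j = -side u j}) := by
    ext c; simp only [face, Set.mem_inter_iff]; rfl
  rw [this]
  refine (isCompact_cube n).inter_right (IsClosed.inter ?_ ?_)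
  · exact isClosed_eq (continuous_coord i) continuous_const
  · exact isClosed_eq (continuous_coord j) continuous_const

lemma isClosed_shadow (u : EuclideanSpace ℝ (Fin n)) : IsClosed (shadow u) :=
  ((isCompact_cube n).image (proj u).continuous).isClosed

lemma proj_surjective (u : EuclideanSpace ℝ (Fin n)) : Function.Surjective (proj u) := fun v =>
  ⟨v, Submodule.orthogonalProjectionOnto_mem_subspace_eq_self v⟩

lemma mem_interior_shadow {c : EuclideanSpace ℝ (Fin n)} (hc : ∀ i, |c i| < 1 / 2) :
    proj u c ∈ interior (shadow u) := by
  have ho : IsOpen {c : EuclideanSpace ℝ (Fin n) | ∀ i, |c i| < 1 / 2} := by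
    simp only [Set.ofPred_forall]
    exact isOpen_iInter_of_finite fun i =>
      isOpen_lt ((continuous_coord i).abs) continuous_const
  refine interior_maximal ?_ ((proj u).isOpenMap (proj_surjective u) _ ho) ⟨c, hc, rfl⟩
  exact Set.image_mono fun x hx i => (hx i).le

/-- The one-coordinate form of moving inward: a coordinate at a wall must have a velocity pointing
strictly away from that wall, while one in the open interval may have any velocity. -/
lemma eventually_abs_add_mul_lt {c v : ℝ} (hc : |c| ≤ 1 / 2) (h1 : 0 < v → c ≠ 1 / 2)
    (h2 : v < 0 → c ≠ -(1 / 2)) (h3 : v = 0 → |c| ≠ 1 / 2) :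
    ∀ᶠ ε in 𝓝[>] (0 : ℝ), |c + ε * v| < 1 / 2 := by
  have ht : Tendsto (fun ε : ℝ => c + ε * v) (𝓝[>] 0) (𝓝 c) := by
    have : Continuous fun ε : ℝ => c + ε * v := by fun_prop
    simpa using (this.tendsto 0).mono_left nhdsWithin_le_nhds
  have hc' := abs_le.1 hc
  have A : ∀ᶠ ε in 𝓝[>] (0 : ℝ), c + ε * v < 1 / 2 := by
    rcases hc'.2.lt_or_eq with h | h
    · exact ht.eventually_lt_const h
    · have hv : v < 0 := by
        rcases lt_trichotomy v 0 with h' | h' | h'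
        · exact h'
        · exact absurd (by rw [h]; norm_num) (h3 h')
        · exact absurd h (h1 h')
      filter_upwards [self_mem_nhdsWithin] with ε hε
      have := mul_neg_of_pos_of_neg (Set.mem_Ioi.1 hε) hv
      linarith
  have B : ∀ᶠ ε in 𝓝[>] (0 : ℝ), -(1 / 2) < c + ε * v := by
    rcases hc'.1.lt_or_eq with h | h
    · exact ht.eventually_const_lt h
    · have hv : 0 < v := by
        rcases lt_trichotomy v 0 with h' | h' | h'
        · exact absurd h.symm (h2 h')
        · exact absurd (by rw [← h, abs_neg]; norm_num) (h3 h')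
        · exact h'
      filter_upwards [self_mem_nhdsWithin] with ε hε
      have := mul_pos (Set.mem_Ioi.1 hε) hv
      linarith
  filter_upwards [A, B] with ε h h'
  exact abs_lt.2 ⟨h', h⟩

/-- Following the line in direction `u` through a point of the cube, one leaves the cube through
a facet on which some coordinate has the sign of the corresponding coordinate of `u`. -/
lemma exists_exit (hu : u ≠ 0) {c : EuclideanSpace ℝ (Fin n)} (hc : c ∈ cube n) :
    ∃ t : ℝ, c + t • u ∈ cube n ∧ ∃ j, u j ≠ 0 ∧ (c + t • u) j = side u j := by
  have hcl : IsClosed {t : ℝ | c + t • u ∈ cube n} :=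
    (isCompact_cube n).isClosed.preimage (by fun_prop)
  have hcpt : IsCompact {t : ℝ | c + t • u ∈ cube n} := by
    obtain ⟨k, hk⟩ : ∃ k, u k ≠ 0 := by
      by_contra! h
      exact hu (by ext k; simpa using h k)
    refine (isCompact_Icc (a := -(|u k|⁻¹)) (b := |u k|⁻¹)).of_isClosed_subset hcl ?_
    intro t ht
    have h1 := ht k
    have h2 := hc k
    simp only [PiLp.add_apply, PiLp.smul_apply, smul_eq_mul] at h1
    have h3 : |t * u k| ≤ 1 := by
      have : t * u k = (c k + t * u k) - c k := by ring
      rw [this]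
      exact (abs_sub _ _).trans (by linarith)
    rw [abs_mul] at h3
    rw [Set.mem_Icc, ← abs_le, ← one_div, le_div_iff₀ (abs_pos.2 hk)]
    exact h3
  -- Take the last parameter for which the line is in the cube. If no moving coordinate were at its
  -- exit wall, a small further step would stay in the cube.
  obtain ⟨t, ht, hmax⟩ := hcpt.exists_isMaxOn ⟨0, by simpa using hc⟩ continuousOn_id
  refine ⟨t, ht, ?_⟩
  by_contra! hno
  have hev : ∀ᶠ ε in 𝓝[>] (0 : ℝ), ∀ k, |(c + t • u) k + ε * u k| ≤ 1 / 2 := by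
    refine eventually_all.2 fun k => ?_
    by_cases hk : u k = 0
    · filter_upwards with ε
      rw [hk, mul_zero, add_zero]
      exact ht k
    · have hne := hno k hk
      refine (eventually_abs_add_mul_lt (ht k) (fun h => ?_) (fun h => ?_) (fun h => ?_)).mono
        fun _ h => h.le
      · rwa [side_of_nonneg h.le] at hne
      · rwa [side_of_neg h] at hne
      · exact absurd h hk
  obtain ⟨ε, hε, hpos⟩ := (hev.and self_mem_nhdsWithin).exists
  have hmem : t + ε ∈ {t : ℝ | c + t • u ∈ cube n} := fun k => by
    have := hε k
    simp only [PiLp.add_apply, PiLp.smul_apply, smul_eq_mul] at this ⊢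
    rwa [add_mul, ← add_assoc]
  have h1 : t + ε ≤ t := hmax hmem
  have h2 : 0 < ε := hpos
  linarith

/-- Entering along `u` is leaving along `-u`. Since `u j ≠ 0`, reversing `u` really flips `side`; at
a zero coordinate the convention would break this. -/
lemma exists_entry (hu : u ≠ 0) {c : EuclideanSpace ℝ (Fin n)} (hc : c ∈ cube n) :
    ∃ t : ℝ, c + t • u ∈ cube n ∧ ∃ j, u j ≠ 0 ∧ (c + t • u) j = -side u j := by
  obtain ⟨t, ht, j, hj, h⟩ := exists_exit (neg_ne_zero.2 hu) hc
  have hj' : u j ≠ 0 := by simpa using hj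
  rw [smul_neg, ← neg_smul] at ht h
  refine ⟨-t, ht, j, hj', h.trans ?_⟩
  rcases lt_or_gt_of_ne hj' with h0 | h0
  · rw [side_of_neg h0, side_of_nonneg (by simpa using h0.le)]; norm_num
  · rw [side_of_nonneg h0.le, side_of_neg (by simpa using h0)]

/-- If the fibre through `c₀` misses all the faces, then at its entry point no coordinate is at its
exit wall, so a small step along `u` makes every coordinate strictly interior. The fibre thus meets
the open cube, and the projection is an open map. -/
lemma frontier_shadow_subset (hu : u ≠ 0) {p : hyperplane u} (hp : p ∈ frontier (shadow u)) :
    ∃ i j, i ≠ j ∧ p ∈ proj u '' face u i j := by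
  obtain ⟨c₀, hc₀, rfl⟩ : p ∈ shadow u := (isClosed_shadow u).frontier_subset hp
  by_contra! hno
  refine hp.2 ?_
  have hface : ∀ {i j : Fin n} {t : ℝ}, i ≠ j → c₀ + t • u ∈ cube n →
      (c₀ + t • u) i = side u i → (c₀ + t • u) j = -side u j → False := by
    intro i j t hij hc hi hj
    exact hno i j hij ⟨c₀ + t • u, ⟨hc, hi, hj⟩, ((proj_eq_iff _ _).2 ⟨t, rfl⟩).symm⟩
  obtain ⟨t, ht, j, hj0, hj⟩ := exists_entry hu hc₀
  obtain ⟨t', ht', j', hj0', hj'⟩ := exists_exit hu hc₀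
  have hside : ∀ k, (c₀ + t • u) k ≠ side u k := by
    intro k hk
    refine hface (i := k) (j := j) ?_ ht hk hj
    rintro rfl
    exact side_ne_neg u k (hk.symm.trans hj)
  have hev : ∀ᶠ ε in 𝓝[>] (0 : ℝ), ∀ k, |(c₀ + t • u) k + ε * u k| < 1 / 2 := by
    refine eventually_all.2 fun k => eventually_abs_add_mul_lt (ht k) ?_ ?_ ?_
    · intro h; rw [← side_of_nonneg h.le]; exact hside k
    · intro h; rw [← side_of_neg h]; exact hside k
    · intro h hk
      rcases eq_or_eq_neg_of_abs_eq hk with h1 | h1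
      · exact hside k (h1.trans (side_of_nonneg h.ge).symm)
      -- The coordinate `k` is at the wall `-1/2` and does not move, so it still has this value at
      -- the exit point, where `j'` is at its exit wall; the exit point then lies on a face.
      · refine hface (i := j') (j := k) ?_ ht' hj' ?_
        · rintro rfl; exact hj0' h
        · rw [side_of_nonneg h.ge, ← h1]
          simp [h]
  obtain ⟨ε, hε⟩ := hev.exists
  have : proj u c₀ = proj u (c₀ + (t + ε) • u) := (proj_eq_iff _ _).2 ⟨_, rfl⟩
  change proj u c₀ ∈ _
  rw [this]
  refine mem_interior_shadow fun k => ?_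
  have := hε k
  simp only [PiLp.add_apply, PiLp.smul_apply, smul_eq_mul] at this ⊢
  rwa [add_mul, ← add_assoc]

/-- A functional given by `w ⊥ u` is constant on the fibres of the projection, so its maximum over
the cube bounds the shadow, and a small step in direction `w` leaves the shadow. -/
lemma notMem_interior_shadow {w c : EuclideanSpace ℝ (Fin n)} (hw : w ∈ hyperplane u) (hw0 : w ≠ 0)
    (h : ∀ x ∈ cube n, inner ℝ w x ≤ inner ℝ w c) : proj u c ∉ interior (shadow u) := by
  intro hmem
  have hcont : Tendsto (fun ε : ℝ => proj u c + ε • (⟨w, hw⟩ : hyperplane u)) (𝓝[>] 0)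
      (𝓝 (proj u c)) := by
    have : Continuous fun ε : ℝ => proj u c + ε • (⟨w, hw⟩ : hyperplane u) := by fun_prop
    simpa using (this.tendsto 0).mono_left nhdsWithin_le_nhds
  obtain ⟨ε, hmem, hε⟩ :=
    ((hcont.eventually (mem_interior_iff_mem_nhds.1 hmem)).and self_mem_nhdsWithin).exists
  obtain ⟨x, hx, hxe⟩ := hmem
  have h1 := h x hx
  have h2 := congrArg (fun y : hyperplane u => inner ℝ (⟨w, hw⟩ : hyperplane u) y) hxe
  simp only [inner_add_right, inner_smul_right, proj] at h2
  rw [Submodule.inner_orthogonalProjectionOnto_eq_of_mem_left,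
    Submodule.inner_orthogonalProjectionOnto_eq_of_mem_left] at h2
  have h3 : 0 < inner ℝ (⟨w, hw⟩ : hyperplane u) (⟨w, hw⟩ : hyperplane u) := by
    rw [real_inner_self_eq_norm_sq]
    have : (0:ℝ) < ‖(⟨w, hw⟩ : hyperplane u)‖ := norm_pos_iff.2 (by simpa using hw0)
    positivity
  have h4 := mul_pos (Set.mem_Ioi.1 hε) h3
  simp only at h2
  linarith

lemma mem_hyperplane_iff {w : EuclideanSpace ℝ (Fin n)} :
    w ∈ hyperplane u ↔ inner ℝ u w = 0 := Submodule.mem_orthogonal_singleton_iff_inner_right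

lemma proj_face_subset {i j : Fin n} (hij : i ≠ j) :
    proj u '' face u i j ⊆ frontier (shadow u) := by
  rintro _ ⟨c, ⟨hc, hi, hj⟩, rfl⟩
  refine ⟨subset_closure ⟨c, hc, rfl⟩, ?_⟩
  by_cases h0 : u i = 0 ∧ u j = 0
  -- When both coordinates of `u` vanish, the general supporting vector below would be zero, but the
  -- facet normal itself is orthogonal to `u`.
  · refine notMem_interior_shadow (w := EuclideanSpace.single i (1 : ℝ)) ?_ ?_ fun x hx => ?_
    · rw [mem_hyperplane_iff, EuclideanSpace.inner_single_right, h0.1]; simp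
    · exact fun h => one_ne_zero ((PiLp.single_eq_zero_iff 2 i).1 h)
    · simp only [EuclideanSpace.inner_single_left, map_one, one_mul]
      rw [hi, side_of_nonneg h0.1.ge]
      exact (abs_le.1 (hx i)).2
  -- With signs `s` of the coordinates, this is `|u j| s_i e_i - |u i| s_j e_j`. It is orthogonal to
  -- `u`, and it is a nonnegative combination of the outer normals of the two facets that meet in
  -- the face.
  · refine notMem_interior_shadow (w := EuclideanSpace.single i (2 * |u j| * side u i) -
      EuclideanSpace.single j (2 * |u i| * side u j)) ?_ ?_ fun x hx => ?_
    · rw [mem_hyperplane_iff]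
      simp only [inner_sub_right, EuclideanSpace.inner_single_right, conj_trivial]
      rw [← two_mul_side_mul u i, ← two_mul_side_mul u j]
      ring
    · intro h
      apply h0
      have h1 := congrArg (fun v : EuclideanSpace ℝ (Fin n) => v i) h
      have h2 := congrArg (fun v : EuclideanSpace ℝ (Fin n) => v j) h
      simp [hij, hij.symm] at h1 h2
      have hs : ∀ k, side u k ≠ 0 := fun k hk => by
        have := abs_side u k
        rw [hk] at this; norm_num at this
      simpa [hs, and_comm] using And.intro h1 h2
    · simp only [inner_sub_left, EuclideanSpace.inner_single_left, conj_trivial]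
      rw [hi, hj]
      have key : ∀ k, 2 * (side u k * x k) ≤ 1 / 2 ∧ -(1 / 2) ≤ 2 * (side u k * x k) := fun k => by
        have h1 : |2 * (side u k * x k)| ≤ 1 / 2 := by
          rw [abs_mul, abs_mul, abs_side]
          have := hx k
          norm_num
          linarith
        exact ⟨(abs_le.1 h1).2, (abs_le.1 h1).1⟩
      have h1 := mul_le_mul_of_nonneg_left (key i).1 (abs_nonneg (u j))
      have h2 := mul_le_mul_of_nonneg_left (key j).2 (abs_nonneg (u i))
      have h3 := side_mul_self u i
      have h4 := side_mul_self u j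
      calc _ = |u j| * (2 * (side u i * x i)) - |u i| * (2 * (side u j * x j)) := by ring
        _ ≤ |u j| * (1 / 2) - |u i| * (-(1 / 2)) := by linarith
        _ = 2 * |u j| * (side u i * side u i) + 2 * |u i| * (side u j * side u j) := by
          rw [h3, h4]; ring
        _ = _ := by ring

lemma frontier_shadow (hu : u ≠ 0) : frontier (shadow u) =
    ⋃ p ∈ (Finset.univ : Finset (Fin n)).offDiag, proj u '' face u p.1 p.2 := by
  ext x
  simp only [Set.mem_iUnion, Finset.mem_offDiag, Finset.mem_univ, true_and]
  constructor
  · intro h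
    obtain ⟨i, j, hij, hx⟩ := frontier_shadow_subset hu h
    exact ⟨(i, j), hij, hx⟩
  · rintro ⟨⟨i, j⟩, hij, hx⟩
    exact proj_face_subset hij hx

lemma abs_side_add_mul {i : Fin n} (hi : u i ≠ 0) {t : ℝ} (ht : 0 < t) :
    1 / 2 < |side u i + t * u i| := by
  rcases lt_or_gt_of_ne hi with h | h
  · rw [side_of_neg h, lt_abs]; right; nlinarith
  · rw [side_of_nonneg h.le, lt_abs]; left; nlinarith

/-- Two points with the same projection differ by `t • u`. If `t ≠ 0`, one wall coordinate of `c'`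
would have left the cube when followed back to `c` unless `u` vanishes there; it is then a wall
coordinate of `c` too, and the other of `i`, `j`, where `u` does not vanish, carries `c'` out of the
cube. So `t = 0`, and the wall coordinates with their signs determine the pair. -/
lemma eq_of_proj_face {i j k l : Fin n} (hkl : k ≠ l)
    (h0 : ¬(u i = 0 ∧ u j = 0)) {c c' : EuclideanSpace ℝ (Fin n)} (hc : c ∈ face u i j)
    (hrel : ∀ m, m ≠ i → m ≠ j → |c m| < 1 / 2) (hc' : c' ∈ face u k l)
    (h : proj u c = proj u c') : (i, j) = (k, l) := by
  obtain ⟨t, rfl⟩ := (proj_eq_iff _ _).1 h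
  obtain ⟨hcube, hi, hj⟩ := hc
  obtain ⟨hcube', hk, hl⟩ := hc'
  have hmem : ∀ m, |c m| = 1 / 2 → m = i ∨ m = j := fun m hm => by
    by_contra! hne
    exact (hrel m hne.1 hne.2).ne hm
  have happ : ∀ m, (c + t • u) m = c m + t * u m := fun m => by simp
  rw [happ] at hk hl
  rcases lt_trichotomy t 0 with ht | ht | ht
  · have huk : u k = 0 := by
      by_contra huk
      have h1 := abs_side_add_mul huk (neg_pos.2 ht)
      have : side u k + -t * u k = c k := by linarith
      rw [this] at h1
      exact absurd (hcube k) (not_le.2 h1)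
    rw [huk, mul_zero, add_zero] at hk
    rcases hmem k (by rw [hk, abs_side]) with rfl | rfl
    · have huj : u j ≠ 0 := fun h => h0 ⟨huk, h⟩
      have h1 := abs_side_add_mul huj (neg_pos.2 ht)
      have h2 := hcube' j
      rw [happ, hj, ← abs_neg] at h2
      have : -(-side u j + t * u j) = side u j + -t * u j := by ring
      rw [this] at h2
      exact absurd h2 (not_le.2 h1)
    · exact absurd (hk.symm.trans hj) (side_ne_neg u k)
  · rw [ht, zero_mul, add_zero] at hk hl
    rcases hmem k (by rw [hk, abs_side]) with rfl | rfl
    · rcases hmem l (by rw [hl, abs_neg, abs_side]) with rfl | rfl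
      · exact absurd rfl hkl
      · rfl
    · exact absurd (hk.symm.trans hj) (side_ne_neg u k)
  · have hul : u l = 0 := by
      by_contra hul
      have h1 := abs_side_add_mul hul ht
      have : side u l + t * u l = -c l := by linarith
      rw [this, abs_neg] at h1
      exact absurd (hcube l) (not_le.2 h1)
    rw [hul, mul_zero, add_zero] at hl
    rcases hmem l (by rw [hl, abs_neg, abs_side]) with rfl | rfl
    · exact absurd (hi.symm.trans hl) (side_ne_neg u l)
    · have hui : u i ≠ 0 := fun h => h0 ⟨h, hul⟩
      have h1 := abs_side_add_mul hui ht
      have h2 := hcube' i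
      rw [happ, hi] at h2
      exact absurd h2 (not_le.2 h1)

end CubeShadow

/-! ### Measure of the projected faces and the surface area formula. -/

namespace CubeShadow

variable {n : ℕ} {u : EuclideanSpace ℝ (Fin n)}

/-- The indices other than `i` and `j`. -/
abbrev Others {n : ℕ} (i j : Fin n) : Type := {k : Fin n // k ≠ i ∧ k ≠ j}

/-- The linear embedding of the coordinate subspace on which coordinates `i` and `j` vanish. -/
def extendByZero (i j : Fin n) :
    EuclideanSpace ℝ (Others i j) →ₗ[ℝ] EuclideanSpace ℝ (Fin n) where
  toFun y := WithLp.toLp 2 fun k => if h : k ≠ i ∧ k ≠ j then y ⟨k, h⟩ else 0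
  map_add' x y := by ext k; by_cases h : k ≠ i ∧ k ≠ j <;> simp [h]
  map_smul' a y := by ext k; by_cases h : k ≠ i ∧ k ≠ j <;> simp [h]

lemma extendByZero_apply (i j : Fin n) (y : EuclideanSpace ℝ (Others i j)) (k : Fin n) :
    extendByZero i j y k = if h : k ≠ i ∧ k ≠ j then y ⟨k, h⟩ else 0 := rfl

lemma extendByZero_single (i j : Fin n) (k : Others i j) :
    extendByZero i j (EuclideanSpace.single k 1) = EuclideanSpace.single (k : Fin n) 1 := by
  ext m
  rw [extendByZero_apply]
  by_cases h : m ≠ i ∧ m ≠ j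
  · rw [dif_pos h]
    by_cases hm : m = k
    · subst hm; simp
    · have : (⟨m, h⟩ : Others i j) ≠ k := fun h' => hm (congrArg Subtype.val h')
      simp [hm, this]
  · rw [dif_neg h]
    have : m ≠ k := by rintro rfl; exact h k.2
    simp [this]

lemma card_others {i j : Fin n} (hij : i ≠ j) : Fintype.card (Others i j) = n - 2 := by
  rw [Fintype.card_subtype]
  have : Finset.univ.filter (fun k : Fin n => k ≠ i ∧ k ≠ j) = (Finset.univ.erase i).erase j := by
    ext k; simp [and_comm]
  rw [this, Finset.card_erase_of_mem (by simp [hij.symm]), Finset.card_erase_of_mem (by simp)]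
  simp; omega

lemma sum_others {i j : Fin n} (hij : i ≠ j) (f : Fin n → ℝ) :
    ∑ k : Others i j, f k = ∑ k, f k - f i - f j := by
  have h1 : ∑ k : Others i j, f k = ∑ k ∈ (Finset.univ.erase i).erase j, f k := by
    rw [← Finset.sum_subtype]
    intro k; simp [and_comm]
  rw [h1, ← Finset.add_sum_erase Finset.univ f (Finset.mem_univ i),
    ← Finset.add_sum_erase (Finset.univ.erase i) f (a := j) (by simp [hij.symm])]
  ring

lemma inner_proj_proj (hu : ‖u‖ = 1) (a b : EuclideanSpace ℝ (Fin n)) :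
    inner ℝ (proj u a) (proj u b) = inner ℝ a b - inner ℝ u a * inner ℝ u b := by
  have h : ∀ x, ((proj u x : hyperplane u) : EuclideanSpace ℝ (Fin n)) =
      x - (inner ℝ u x) • u := fun x => by
    rw [← Submodule.starProjection_unit_singleton ℝ hu x,
      ← Submodule.starProjection_orthogonal_val, Submodule.starProjection_apply]
  rw [Submodule.coe_inner, h, h]
  simp only [inner_sub_left, inner_sub_right, inner_smul_left, inner_smul_right,
    real_inner_self_eq_norm_sq, hu, conj_trivial, real_inner_comm a u]
  ring

lemma sum_sq_eq_one (hu : ‖u‖ = 1) : ∑ k, u k ^ 2 = 1 := by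
  have := EuclideanSpace.real_norm_sq_eq u
  rw [hu] at this
  simpa using this.symm

/-- The Gram matrix of the projected basis vectors is `1 - v vᵀ`, where `v` collects the coordinates
of `u` other than `i` and `j`. By the matrix determinant lemma its determinant is `1 - ‖v‖²`, which
is `u i ^ 2 + u j ^ 2` because `u` is a unit vector. -/
lemma normDet_proj_comp (hu : ‖u‖ = 1) {i j : Fin n} (hij : i ≠ j) :
    ((proj u).toLinearMap ∘ₗ extendByZero i j).normDet = √(u i ^ 2 + u j ^ 2) := by
  set f := (proj u).toLinearMap ∘ₗ extendByZero i j with hf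
  have h := f.normDet_sq_eq_det_gram (EuclideanSpace.basisFun (Others i j) ℝ)
  have hg : Matrix.gram ℝ (fun k => f (EuclideanSpace.basisFun (Others i j) ℝ k)) =
      1 + Matrix.replicateCol Unit (fun k : Others i j => -u k) *
        Matrix.replicateRow Unit (fun k : Others i j => u k) := by
    ext k l
    rw [Matrix.gram_apply, hf]
    simp only [LinearMap.comp_apply, EuclideanSpace.basisFun_apply, extendByZero_single]
    change inner ℝ (proj u _) (proj u _) = _
    rw [inner_proj_proj hu, EuclideanSpace.inner_single_right, EuclideanSpace.inner_single_right,
      EuclideanSpace.inner_single_right]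
    simp [Matrix.mul_apply, Matrix.one_apply, Subtype.ext_iff,
      eq_comm, sub_eq_add_neg]
  rw [hg, Matrix.det_one_add_replicateCol_mul_replicateRow] at h
  have h2 : (fun k : Others i j => u k) ⬝ᵥ (fun k : Others i j => -u k) =
      - ∑ k : Others i j, u k ^ 2 := by
    simp [dotProduct, pow_two]
  rw [h2, sum_others hij fun k => u k ^ 2, sum_sq_eq_one hu] at h
  rw [← Real.sqrt_sq f.normDet_nonneg]
  congr 1
  simp only [RCLike.ofReal_real_eq_id, id] at h
  rw [h]; ring

/-- The closed unit cube with an arbitrary index type. -/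
def closedBox (ι : Type*) [Fintype ι] : Set (EuclideanSpace ℝ ι) := {y | ∀ k, |y k| ≤ 1 / 2}

/-- The open unit cube with an arbitrary index type. -/
def openBox (ι : Type*) [Fintype ι] : Set (EuclideanSpace ℝ ι) := {y | ∀ k, |y k| < 1 / 2}

lemma volume_closedBox (ι : Type*) [Fintype ι] : volume (closedBox ι) = 1 := by
  have h : closedBox ι = (MeasurableEquiv.toLp 2 (ι → ℝ)).symm ⁻¹'
      Set.Icc (fun _ => -(1 / 2)) (fun _ => 1 / 2) := by
    ext y
    simp only [Set.mem_preimage, Set.mem_Icc, Pi.le_def]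
    exact ⟨fun h => ⟨fun k => (abs_le.1 (h k)).1, fun k => (abs_le.1 (h k)).2⟩,
      fun h k => abs_le.2 ⟨h.1 k, h.2 k⟩⟩
  rw [h, (EuclideanSpace.volume_preserving_symm_measurableEquiv_toLp ι).measure_preimage_equiv,
    Real.volume_Icc_pi]
  norm_num

lemma volume_openBox (ι : Type*) [Fintype ι] : volume (openBox ι) = 1 := by
  have h : openBox ι = (MeasurableEquiv.toLp 2 (ι → ℝ)).symm ⁻¹'
      Set.univ.pi fun _ => Set.Ioo (-(1 / 2)) (1 / 2) := by
    ext y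
    simp only [Set.mem_preimage, Set.mem_univ_pi, Set.mem_Ioo]
    exact ⟨fun h k => abs_lt.1 (h k), fun h k => abs_lt.2 (h k)⟩
  rw [h, (EuclideanSpace.volume_preserving_symm_measurableEquiv_toLp ι).measure_preimage_equiv,
    Real.volume_pi_Ioo]
  norm_num

lemma isOpen_openBox (ι : Type*) [Fintype ι] : IsOpen (openBox ι) := by
  simp only [openBox, Set.ofPred_forall]
  exact isOpen_iInter_of_finite fun i => isOpen_lt (by fun_prop) continuous_const

lemma volume_closedBox_diff_openBox (ι : Type*) [Fintype ι] :
    volume (closedBox ι \ openBox ι) = 0 := by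
  rw [measure_sdiff (show openBox ι ⊆ closedBox ι from fun y hy k => (hy k).le) (isOpen_openBox ι).measurableSet.nullMeasurableSet
    (by rw [volume_openBox]; simp), volume_closedBox, volume_openBox, tsub_self]

/-- The centre of the face `face u i j`. -/
def faceCenter (u : EuclideanSpace ℝ (Fin n)) (i j : Fin n) : EuclideanSpace ℝ (Fin n) :=
  EuclideanSpace.single i (side u i) - EuclideanSpace.single j (side u j)

lemma faceCenter_add_apply {i j : Fin n} (hij : i ≠ j) (y : EuclideanSpace ℝ (Others i j))
    (k : Fin n) : (faceCenter u i j + extendByZero i j y) k =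
      if h : k ≠ i ∧ k ≠ j then y ⟨k, h⟩ else if k = i then side u i else -side u j := by
  rw [PiLp.add_apply, extendByZero_apply, faceCenter, PiLp.sub_apply]
  by_cases h : k ≠ i ∧ k ≠ j
  · simp [h.1, h.2]
  · rw [dif_neg h, dif_neg h]
    by_cases hk : k = i
    · subst hk; simp [hij]
    · have : k = j := by tauto
      subst this; simp [hk]

lemma face_eq_image {i j : Fin n} (hij : i ≠ j) : face u i j =
    (fun y => faceCenter u i j + extendByZero i j y) '' closedBox (Others i j) := by
  ext c
  constructor
  · rintro ⟨hc, hi, hj⟩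
    refine ⟨WithLp.toLp 2 fun k => c k, fun k => hc k, ?_⟩
    ext k
    simp only [faceCenter_add_apply hij]
    by_cases h : k ≠ i ∧ k ≠ j
    · rw [dif_pos h]
    · rw [dif_neg h]
      by_cases hk : k = i
      · subst hk; simp [hi]
      · have : k = j := by tauto
        subst this; simp [hk, hj]
  · rintro ⟨y, hy, rfl⟩
    refine ⟨fun k => ?_, ?_, ?_⟩
    · simp only [faceCenter_add_apply hij]
      split_ifs with h h'
      · exact hy _
      · rw [abs_side]
      · rw [abs_neg, abs_side]
    · simp only [faceCenter_add_apply hij]; simp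
    · simp only [faceCenter_add_apply hij]; simp [hij.symm]

lemma measure_proj_image (hu : ‖u‖ = 1) {i j : Fin n} (hij : i ≠ j)
    (s : Set (EuclideanSpace ℝ (Others i j))) :
    Measure.euclideanHausdorffMeasure (n - 2)
      (proj u '' ((fun y => faceCenter u i j + extendByZero i j y) '' s)) =
      ENNReal.ofReal √(u i ^ 2 + u j ^ 2) * volume s := by
  have h : proj u '' ((fun y => faceCenter u i j + extendByZero i j y) '' s) =
      (fun x => proj u (faceCenter u i j) + x) ''
        (((proj u).toLinearMap ∘ₗ extendByZero i j) '' s) := by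
    simp only [Set.image_image, map_add]
    rfl
  rw [h, (isometry_add_left _).euclideanHausdorffMeasure_image]
  have hr : n - 2 = Module.finrank ℝ (EuclideanSpace ℝ (Others i j)) := by
    rw [finrank_euclideanSpace, card_others hij]
  rw [hr, LinearMap.euclideanHausdorffMeasure_image_eq_normDet_mul_volume,
    normDet_proj_comp hu hij]

/-- If `u i = u j = 0`, the first face is flattened to a null set. Otherwise any overlap comes from
the relative boundary of the first face, which is null. -/
lemma aedisjoint_proj_face (hu : ‖u‖ = 1) {i j k l : Fin n} (hij : i ≠ j) (hkl : k ≠ l)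
    (hne : (i, j) ≠ (k, l)) :
    AEDisjoint (Measure.euclideanHausdorffMeasure (n - 2))
      (proj u '' face u i j) (proj u '' face u k l) := by
  by_cases h0 : u i = 0 ∧ u j = 0
  · refine measure_mono_null Set.inter_subset_left ?_
    rw [face_eq_image hij, measure_proj_image hu hij, h0.1, h0.2]
    simp
  · refine measure_mono_null (t := proj u '' ((fun y => faceCenter u i j + extendByZero i j y) ''
      (closedBox (Others i j) \ openBox (Others i j)))) ?_ ?_
    · rintro _ ⟨⟨c, hc, rfl⟩, ⟨c', hc', he⟩⟩
      obtain ⟨y, hy, rfl⟩ := (face_eq_image hij ▸ hc :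
        c ∈ (fun y => faceCenter u i j + extendByZero i j y) '' closedBox (Others i j))
      refine ⟨_, ⟨y, ⟨hy, fun hyo => hne ?_⟩, rfl⟩, rfl⟩
      refine eq_of_proj_face hkl h0 hc (fun m hmi hmj => ?_) hc' he.symm
      simp only [faceCenter_add_apply hij]
      rw [dif_pos ⟨hmi, hmj⟩]
      exact hyo _
    · rw [measure_proj_image hu hij, volume_closedBox_diff_openBox, mul_zero]

lemma sum_offDiag_eq (f : Fin n → Fin n → ℝ) (hf : ∀ i j, f i j = f j i) :
    ∑ p ∈ (Finset.univ : Finset (Fin n)).offDiag, f p.1 p.2 =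
      2 * ∑ i : Fin n, ∑ j ∈ Finset.Ioi i, f i j := by
  have h1 : ∑ i : Fin n, ∑ j ∈ Finset.Ioi i, f i j =
      ∑ i : Fin n, ∑ j ∈ Finset.Iio i, f i j := by
    rw [Finset.sum_comm' (t' := Finset.univ) (s' := fun j => Finset.Iio j) (by simp)]
    exact Finset.sum_congr rfl fun i _ => Finset.sum_congr rfl fun j _ => hf _ _
  have h2 : ∑ p ∈ (Finset.univ : Finset (Fin n)).offDiag, f p.1 p.2 =
      ∑ i : Fin n, (∑ j ∈ Finset.Ioi i, f i j + ∑ j ∈ Finset.Iio i, f i j) := by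
    rw [Finset.sum_finset_product _ Finset.univ (fun i => Finset.univ.erase i)
      (by simp [Finset.mem_offDiag, eq_comm])]
    refine Finset.sum_congr rfl fun i _ => ?_
    rw [← Finset.sum_union (by
      rw [Finset.disjoint_left]; intro a ha hb; simp at ha hb; exact lt_asymm ha hb)]
    refine Finset.sum_congr ?_ fun _ _ => rfl
    ext j
    simp only [Finset.mem_erase, Finset.mem_union, Finset.mem_Ioi, Finset.mem_Iio, Finset.mem_univ,
      and_true]
    rw [ne_iff_lt_or_gt, or_comm]
  rw [h2, Finset.sum_add_distrib, ← h1]; ring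

/-- The pairs `(i, j)` and `(j, i)` index opposite faces of the cube, both of which count; this is
the factor `2` in the sum over `i < j`. -/
theorem surfaceArea_eq_offDiag (hu : ‖u‖ = 1) : surfaceArea u =
    ENNReal.ofReal (∑ p ∈ (Finset.univ : Finset (Fin n)).offDiag, √(u p.1 ^ 2 + u p.2 ^ 2)) := by
  have hu0 : u ≠ 0 := by rintro rfl; simp at hu
  rw [surfaceArea, frontier_shadow hu0, measure_biUnion_finset₀,
    ENNReal.ofReal_sum_of_nonneg fun _ _ => Real.sqrt_nonneg _]
  · refine Finset.sum_congr rfl fun p hp => ?_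
    have hij := (Finset.mem_offDiag.1 hp).2.2
    rw [face_eq_image hij, measure_proj_image hu hij, volume_closedBox, mul_one]
  · intro p hp q hq hne
    exact aedisjoint_proj_face hu (Finset.mem_offDiag.1 hp).2.2 (Finset.mem_offDiag.1 hq).2.2 hne
  · intro p _
    exact ((isCompact_face u _ _).image (proj u).continuous).isClosed.measurableSet.nullMeasurableSet

theorem surfaceArea_eq (hu : ‖u‖ = 1) : surfaceArea u =
    ENNReal.ofReal (2 * ∑ i : Fin n, ∑ j ∈ Finset.Ioi i, √(u i ^ 2 + u j ^ 2)) := by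
  rw [surfaceArea_eq_offDiag hu, sum_offDiag_eq (fun i j => √(u i ^ 2 + u j ^ 2))]
  intro i j; rw [add_comm]

theorem ar_eq (hu : ‖u‖ = 1) : ar u =
    ∑ p ∈ (Finset.univ : Finset (Fin n)).offDiag, √(u p.1 ^ 2 + u p.2 ^ 2) := by
  rw [ar, surfaceArea_eq_offDiag hu,
    ENNReal.toReal_ofReal (Finset.sum_nonneg fun _ _ => Real.sqrt_nonneg _)]

end CubeShadow

/-! ### Spherical means as Gaussian means, and the first two moments. -/

namespace CubeShadow

open ProbabilityTheory

/-- The centred Gaussian measure on the line with density `x ↦ π ^ (-1/2) * exp (-x ^ 2)`. -/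
def gauss : Measure ℝ := gaussianReal 0 (1 / 2)

/-- The product of `n` copies of `gauss`. -/
def gaussPi (n : ℕ) : Measure (Fin n → ℝ) := Measure.pi fun _ => gauss

instance : IsProbabilityMeasure gauss := by unfold gauss; infer_instance

instance (n : ℕ) : IsProbabilityMeasure (gaussPi n) := by unfold gaussPi; infer_instance

lemma pi_withDensity_ofReal {ι : Type*} [Fintype ι] {g : ℝ → ℝ} (hg : Integrable g)
    (h0 : ∀ x, 0 ≤ g x) :
    (volume : Measure (ι → ℝ)).withDensity (fun x => ENNReal.ofReal (∏ i, g (x i))) =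
      Measure.pi fun _ => (volume : Measure ℝ).withDensity fun x => ENNReal.ofReal (g x) := by
  have hfin : IsFiniteMeasure ((volume : Measure ℝ).withDensity fun x => ENNReal.ofReal (g x)) :=
    isFiniteMeasure_withDensity_ofReal hg.2
  refine (Measure.pi_eq fun s hs => ?_).symm
  rw [withDensity_apply _ (MeasurableSet.univ_pi hs), volume_pi, Measure.restrict_pi_pi,
    ← ofReal_integral_eq_lintegral_ofReal, integral_fintype_prod_eq_prod (f := fun _ => g),
    ENNReal.ofReal_prod_of_nonneg fun i _ => integral_nonneg fun x => h0 x]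
  · refine Finset.prod_congr rfl fun i _ => ?_
    rw [withDensity_apply _ (hs i), ← ofReal_integral_eq_lintegral_ofReal hg.restrict]
    exact Filter.Eventually.of_forall fun x => h0 x
  · exact Integrable.fintype_prod_dep fun i => hg.restrict
  · exact Filter.Eventually.of_forall fun x => Finset.prod_nonneg fun i _ => h0 _

lemma gauss_eq : gauss =
    (volume : Measure ℝ).withDensity fun x => ENNReal.ofReal ((√Real.pi)⁻¹ * Real.exp (-x ^ 2)) := by
  rw [gauss, gaussianReal_of_var_ne_zero _ (by norm_num)]
  congr 1
  ext x
  rw [gaussianPDF, gaussianPDFReal]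
  have h : √(2 * Real.pi * ((1 / 2 : NNReal) : ℝ)) = √Real.pi := by
    congr 1; push_cast; ring
  rw [h]
  congr 3
  push_cast; ring

lemma integrable_gauss_density : Integrable fun x : ℝ => (√Real.pi)⁻¹ * Real.exp (-x ^ 2) := by
  simpa using (integrable_exp_neg_mul_sq (b := 1) one_pos).const_mul (√Real.pi)⁻¹

lemma gaussPi_eq (n : ℕ) : gaussPi n = (volume : Measure (Fin n → ℝ)).withDensity
    fun x => ENNReal.ofReal ((√Real.pi)⁻¹ ^ n * Real.exp (-∑ i, x i ^ 2)) := by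
  rw [gaussPi, gauss_eq, ← pi_withDensity_ofReal integrable_gauss_density fun x => by positivity]
  congr 1
  ext x
  rw [Finset.prod_mul_distrib, ← Real.exp_sum]
  simp

lemma integral_gaussPi (n : ℕ) (f : (Fin n → ℝ) → ℝ) : ∫ x, f x ∂gaussPi n =
    (√Real.pi)⁻¹ ^ n * ∫ x, f x * Real.exp (-∑ i, x i ^ 2) := by
  rw [gaussPi_eq, integral_withDensity_eq_integral_toReal_smul (by fun_prop)
    (Filter.Eventually.of_forall fun _ => ENNReal.ofReal_lt_top), ← integral_const_mul]
  congr 1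
  ext x
  rw [ENNReal.toReal_ofReal (by positivity), smul_eq_mul]
  ring

lemma integral_euclidean_mul_exp (n : ℕ) (f : EuclideanSpace ℝ (Fin n) → ℝ) :
    ∫ x, f x * Real.exp (-‖x‖ ^ 2) =
      √Real.pi ^ n * ∫ x, f (WithLp.toLp 2 x) ∂gaussPi n := by
  rw [integral_gaussPi, ← mul_assoc, ← mul_pow, mul_inv_cancel₀ (by positivity), one_pow, one_mul,
    ← (EuclideanSpace.volume_preserving_symm_measurableEquiv_toLp (Fin n)).integral_comp'
      (g := fun x => f (WithLp.toLp 2 x) * Real.exp (-∑ i, x i ^ 2))]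
  congr 1
  ext x
  rw [EuclideanSpace.real_norm_sq_eq]
  rfl

lemma integral_pow_mul_exp_neg_sq (k : ℕ) :
    ∫ r in Set.Ioi (0 : ℝ), r ^ k * Real.exp (-r ^ 2) = Real.Gamma (((k : ℝ) + 1) / 2) / 2 := by
  have h := integral_rpow_mul_exp_neg_rpow (p := 2) (q := k) (by norm_num)
    (by have : (0 : ℝ) ≤ k := k.cast_nonneg
        linarith)
  simp only [Real.rpow_natCast, Real.rpow_ofNat] at h
  rw [h]; ring

/-- In polar coordinates the integrand separates into `f` on the sphere and the radial factor `r ^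
(n - 1 + d) * exp (-r ^ 2)`, whose integral is half a Gamma value. -/
lemma integral_homogeneous (n : ℕ) [NeZero n] (d : ℕ) (f : EuclideanSpace ℝ (Fin n) → ℝ)
    (hf : ∀ r : ℝ, 0 < r → ∀ x, f (r • x) = r ^ d * f x) :
    ∫ x, f x * Real.exp (-‖x‖ ^ 2) =
      (∫ x : Metric.sphere (0 : EuclideanSpace ℝ (Fin n)) 1, f x
        ∂(volume : Measure (EuclideanSpace ℝ (Fin n))).toSphere) *
      (Real.Gamma (((n : ℝ) + d) / 2) / 2) := by
  set μ : Measure (EuclideanSpace ℝ (Fin n)) := volume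
  have hdim : Module.finrank ℝ (EuclideanSpace ℝ (Fin n)) = n := by simp
  have hn : 1 ≤ n := NeZero.one_le
  calc ∫ x, f x * Real.exp (-‖x‖ ^ 2) ∂μ
      = ∫ x : ({0}ᶜ : Set (EuclideanSpace ℝ (Fin n))), f x.1 * Real.exp (-‖x.1‖ ^ 2)
          ∂(μ.comap (↑)) := by
        rw [integral_subtype_comap (measurableSet_singleton _).compl
          fun x => f x * Real.exp (-‖x‖ ^ 2), restrict_compl_singleton]
    _ = ∫ p : Metric.sphere (0 : EuclideanSpace ℝ (Fin n)) 1 × Set.Ioi (0 : ℝ),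
          f p.1 * (p.2.1 ^ d * Real.exp (-p.2.1 ^ 2))
          ∂(μ.toSphere.prod (.volumeIoiPow (n - 1))) := by
        have := μ.measurePreserving_homeomorphUnitSphereProd.integral_comp
          (Homeomorph.measurableEmbedding _)
          (fun p : Metric.sphere (0 : EuclideanSpace ℝ (Fin n)) 1 × Set.Ioi (0 : ℝ) =>
            f p.1 * (p.2.1 ^ d * Real.exp (-p.2.1 ^ 2)))
        rw [hdim] at this
        rw [← this]
        congr 1
        ext x
        have hx : 0 < ‖x.1‖ := norm_pos_iff.2 x.2
        simp only [homeomorphUnitSphereProd_apply_fst_coe, homeomorphUnitSphereProd_apply_snd_coe]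
        rw [hf _ (inv_pos.2 hx), inv_pow]
        field_simp
    _ = (∫ x : Metric.sphere (0 : EuclideanSpace ℝ (Fin n)) 1, f x ∂μ.toSphere) *
          ∫ r : Set.Ioi (0 : ℝ), r.1 ^ d * Real.exp (-r.1 ^ 2) ∂.volumeIoiPow (n - 1) :=
        integral_prod_mul (fun x : Metric.sphere (0 : EuclideanSpace ℝ (Fin n)) 1 => f x)
          (fun r : Set.Ioi (0 : ℝ) => r.1 ^ d * Real.exp (-r.1 ^ 2))
    _ = _ := by
        congr 1
        simp only [Measure.volumeIoiPow, ENNReal.ofReal]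
        rw [integral_withDensity_eq_integral_smul,
          integral_subtype_comap measurableSet_Ioi
            fun a => Real.toNNReal (a ^ (n - 1)) • (a ^ d * Real.exp (-a ^ 2)),
          setIntegral_congr_fun (g := fun r => r ^ (n - 1 + d) * Real.exp (-r ^ 2))
            measurableSet_Ioi fun x hx => ?_, integral_pow_mul_exp_neg_sq]
        · congr 3
          push_cast [Nat.cast_sub hn]
          ring
        · simp only [NNReal.smul_def, Real.coe_toNNReal _ (pow_nonneg hx.out.le _), smul_eq_mul]
          ring
        · exact (measurable_subtype_coe.pow_const _).real_toNNReal

lemma sphereMean_eq (n : ℕ) (f : EuclideanSpace ℝ (Fin n) → ℝ) :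
    sphereMean n f = ((volume : Measure (EuclideanSpace ℝ (Fin n))).toSphere.real Set.univ)⁻¹ *
      ∫ x : Metric.sphere (0 : EuclideanSpace ℝ (Fin n)) 1, f x
        ∂(volume : Measure (EuclideanSpace ℝ (Fin n))).toSphere := by
  rw [sphereMean, uniformSphere, integral_smul_measure, ENNReal.toReal_inv, smul_eq_mul,
    measureReal_def]

lemma toSphere_real_univ (n : ℕ) [NeZero n] :
    (volume : Measure (EuclideanSpace ℝ (Fin n))).toSphere.real Set.univ *
      (Real.Gamma ((n : ℝ) / 2) / 2) = √Real.pi ^ n := by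
  have h := integral_homogeneous n 0 (fun _ => 1) (by simp)
  rw [integral_euclidean_mul_exp] at h
  simpa using h.symm

lemma Gamma_half_pos (n : ℕ) [NeZero n] (d : ℕ) : 0 < Real.Gamma (((n : ℝ) + d) / 2) := by
  have : (0 : ℝ) < n := by exact_mod_cast NeZero.pos n
  exact Real.Gamma_pos_of_pos (by positivity)

/-- The mean over the sphere of a homogeneous function in terms of its Gaussian mean. -/
theorem sphereMean_homogeneous (n : ℕ) [NeZero n] (d : ℕ) (f : EuclideanSpace ℝ (Fin n) → ℝ)
    (hf : ∀ r : ℝ, 0 < r → ∀ x, f (r • x) = r ^ d * f x) :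
    sphereMean n f = (∫ x, f (WithLp.toLp 2 x) ∂gaussPi n) *
      (Real.Gamma ((n : ℝ) / 2) / Real.Gamma (((n : ℝ) + d) / 2)) := by
  have h1 := integral_homogeneous n d f hf
  have h2 := toSphere_real_univ n
  have h3 := Gamma_half_pos n d
  have h4 := Gamma_half_pos n 0
  rw [Nat.cast_zero, add_zero] at h4
  have hpi : 0 < √Real.pi ^ n := by positivity
  rw [integral_euclidean_mul_exp] at h1
  rw [sphereMean_eq]
  have h5 : (volume : Measure (EuclideanSpace ℝ (Fin n))).toSphere.real Set.univ ≠ 0 := by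
    intro h; rw [h, zero_mul] at h2; exact hpi.ne h2
  rw [← h2] at h1
  field_simp at h1 ⊢
  linarith

lemma map_comp_gaussPi {m n : ℕ} {e : Fin m → Fin n} (he : Function.Injective e) :
    (gaussPi n).map (fun x i => x (e i)) = gaussPi m := by
  have h : iIndepFun (fun (i : Fin n) (x : Fin n → ℝ) => x i) (gaussPi n) :=
    iIndepFun_pi (X := fun _ => id) fun _ => aemeasurable_id
  rw [(iIndepFun_iff_map_fun_eq_pi_map fun i =>
    (measurable_pi_apply _).aemeasurable).1 (h.precomp he), gaussPi]
  congr 1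
  ext1 i
  exact (measurePreserving_eval (fun _ : Fin n => gauss) (e i)).map_eq

lemma integral_comp_gaussPi {m n : ℕ} {e : Fin m → Fin n} (he : Function.Injective e)
    {f : (Fin m → ℝ) → ℝ} (hf : Continuous f) :
    ∫ x, f (fun i => x (e i)) ∂gaussPi n = ∫ x, f x ∂gaussPi m := by
  rw [← map_comp_gaussPi he, integral_map
    (measurable_pi_lambda _ fun i => measurable_pi_apply _).aemeasurable hf.aestronglyMeasurable]

lemma integral_gaussPi_pair {n : ℕ} {i j : Fin n} (hij : i ≠ j)
    {f : ℝ → ℝ → ℝ} (hf : Continuous fun p : ℝ × ℝ => f p.1 p.2) :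
    ∫ x, f (x i) (x j) ∂gaussPi n = ∫ x, f (x 0) (x 1) ∂gaussPi 2 := by
  have he : Function.Injective ![i, j] := by
    intro a b; fin_cases a <;> fin_cases b <;> simp [hij, hij.symm]
  exact integral_comp_gaussPi he (f := fun x => f (x 0) (x 1))
    (hf.comp (g := fun p : ℝ × ℝ => f p.1 p.2) (by fun_prop : Continuous fun x : Fin 2 → ℝ => (x 0, x 1)))

lemma norm_sq_fin_two (x : EuclideanSpace ℝ (Fin 2)) : x 0 ^ 2 + x 1 ^ 2 = ‖x‖ ^ 2 := by
  rw [EuclideanSpace.real_norm_sq_eq, Fin.sum_univ_two]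

lemma sphereMean_one (n : ℕ) [NeZero n] : sphereMean n (fun _ => 1) = 1 := by
  rw [sphereMean_homogeneous n 0 _ (by simp)]
  have h4 := Gamma_half_pos n 0
  simp only [Nat.cast_zero, add_zero] at h4 ⊢
  simp [h4.ne']

lemma sphereMean_congr {n : ℕ} {f g : EuclideanSpace ℝ (Fin n) → ℝ}
    (h : ∀ x, ‖x‖ = 1 → f x = g x) : sphereMean n f = sphereMean n g := by
  unfold sphereMean
  congr 1
  ext x
  exact h x (by simp)

/-- The comparison of spherical and Gaussian means is read backwards: the norm is `1` on the circle,
so its spherical mean is known and the Gaussian mean follows. -/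
lemma integral_norm_gaussPi_two : ∫ x, √(x 0 ^ 2 + x 1 ^ 2) ∂gaussPi 2 = √Real.pi / 2 := by
  have h := sphereMean_homogeneous 2 1 (fun x => √(x 0 ^ 2 + x 1 ^ 2)) (fun r hr x => by
    simp only [norm_sq_fin_two, Real.sqrt_sq, norm_nonneg]
    rw [norm_smul, Real.norm_eq_abs, abs_of_pos hr, pow_one])
  rw [sphereMean_congr (g := fun _ => 1) (fun x hx => by simp [norm_sq_fin_two, hx]),
    sphereMean_one] at h
  have h3 : Real.Gamma ((((2 : ℕ) : ℝ) + (1 : ℕ)) / 2) = √Real.pi / 2 := by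
    have := Real.Gamma_add_one (s := 1 / 2) (by norm_num)
    rw [Real.Gamma_one_half_eq] at this
    rw [show (((2 : ℕ) : ℝ) + (1 : ℕ)) / 2 = 1 / 2 + 1 by norm_num, this]
    ring
  rw [h3] at h
  have hpi : 0 < √Real.pi := by positivity
  norm_num at h
  field_simp at h ⊢
  linarith

lemma integral_norm_sq_gaussPi_two : ∫ x, (x 0 ^ 2 + x 1 ^ 2) ∂gaussPi 2 = 1 := by
  have h := sphereMean_homogeneous 2 2 (fun x => x 0 ^ 2 + x 1 ^ 2) (fun r hr x => by
    simp only [PiLp.smul_apply, smul_eq_mul]; ring)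
  rw [sphereMean_congr (g := fun _ => 1) (fun x hx => by simp [norm_sq_fin_two, hx]),
    sphereMean_one] at h
  norm_num at h
  exact h.symm

/-- The Gaussian mean of `√(x ^ 2 + y ^ 2) * √(x ^ 2 + z ^ 2)`. -/
def gaussTriple : ℝ := ∫ x, √(x 0 ^ 2 + x 1 ^ 2) * √(x 0 ^ 2 + x 2 ^ 2) ∂gaussPi 3

lemma integral_gaussPi_triple {n : ℕ} {i j k : Fin n} (hij : i ≠ j) (hik : i ≠ k) (hjk : j ≠ k) :
    ∫ x, √(x i ^ 2 + x j ^ 2) * √(x i ^ 2 + x k ^ 2) ∂gaussPi n = gaussTriple := by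
  have he : Function.Injective ![i, j, k] := by
    intro a b
    fin_cases a <;> fin_cases b <;> simp [hij, hij.symm, hik, hik.symm, hjk, hjk.symm]
  exact integral_comp_gaussPi he (f := fun x => √(x 0 ^ 2 + x 1 ^ 2) * √(x 0 ^ 2 + x 2 ^ 2))
    (by fun_prop)

lemma integral_norm_gaussPi {n : ℕ} {i j : Fin n} (hij : i ≠ j) :
    ∫ x, √(x i ^ 2 + x j ^ 2) ∂gaussPi n = √Real.pi / 2 := by
  rw [integral_gaussPi_pair hij (f := fun a b => √(a ^ 2 + b ^ 2)) (by fun_prop)]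
  exact integral_norm_gaussPi_two

lemma integral_gaussPi_quadruple {n : ℕ} {i j k l : Fin n} (hij : i ≠ j) (hik : i ≠ k)
    (hil : i ≠ l) (hjk : j ≠ k) (hjl : j ≠ l) (hkl : k ≠ l) :
    ∫ x, √(x i ^ 2 + x j ^ 2) * √(x k ^ 2 + x l ^ 2) ∂gaussPi n = Real.pi / 4 := by
  have h : iIndepFun (fun (i : Fin n) (x : Fin n → ℝ) => x i) (gaussPi n) :=
    iIndepFun_pi (X := fun _ => id) fun _ => aemeasurable_id
  have h2 := (h.indepFun_prodMk_prodMk (fun i => measurable_pi_apply i) i j k l hik hil hjk hjl).comp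
    (φ := fun p : ℝ × ℝ => √(p.1 ^ 2 + p.2 ^ 2)) (ψ := fun p : ℝ × ℝ => √(p.1 ^ 2 + p.2 ^ 2))
    (by fun_prop) (by fun_prop)
  have h3 := h2.integral_fun_mul_eq_mul_integral
    ((by fun_prop : Continuous fun x : Fin n → ℝ => √(x i ^ 2 + x j ^ 2)).aestronglyMeasurable)
    ((by fun_prop : Continuous fun x : Fin n → ℝ => √(x k ^ 2 + x l ^ 2)).aestronglyMeasurable)
  simp only [Function.comp_def] at h3
  rw [h3, integral_norm_gaussPi hij, integral_norm_gaussPi hkl]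
  have := Real.mul_self_sqrt Real.pi_pos.le
  linarith

lemma sqrt_sq_add_sq_smul {r : ℝ} (hr : 0 < r) (a b : ℝ) :
    √((r * a) ^ 2 + (r * b) ^ 2) = r * √(a ^ 2 + b ^ 2) := by
  rw [mul_pow, mul_pow, ← mul_add, Real.sqrt_mul (by positivity), Real.sqrt_sq hr.le]

lemma sphereMean_pair {n : ℕ} [NeZero n] {i j : Fin n} (hij : i ≠ j) :
    sphereMean n (fun x => √(x i ^ 2 + x j ^ 2)) =
      √Real.pi / 2 * (Real.Gamma ((n : ℝ) / 2) / Real.Gamma (((n : ℝ) + 1) / 2)) := by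
  rw [sphereMean_homogeneous n 1 _ (fun r hr x => by
    simp only [PiLp.smul_apply, smul_eq_mul, sqrt_sq_add_sq_smul hr, pow_one])]
  rw [integral_norm_gaussPi hij, Nat.cast_one]

lemma sphereMean_mul {n : ℕ} [NeZero n] (i j k l : Fin n) :
    sphereMean n (fun x => √(x i ^ 2 + x j ^ 2) * √(x k ^ 2 + x l ^ 2)) =
      (∫ x, √(x i ^ 2 + x j ^ 2) * √(x k ^ 2 + x l ^ 2) ∂gaussPi n) * (2 / n) := by
  rw [sphereMean_homogeneous n 2 _ (fun r hr x => by
    simp only [PiLp.smul_apply, smul_eq_mul, sqrt_sq_add_sq_smul hr]; ring)]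
  congr 1
  have hn : (0 : ℝ) < n := by exact_mod_cast NeZero.pos n
  have h0 := Real.Gamma_pos_of_pos (s := (n : ℝ) / 2) (by positivity)
  rw [show ((n : ℝ) + (2 : ℕ)) / 2 = n / 2 + 1 by push_cast; ring,
    Real.Gamma_add_one (by positivity)]
  field_simp

/-- For degree two the ratio of Gamma values is `2 / n`, which cancels the factor `n` in the
definition of `zeta`. The marginal on three coordinates does not depend on `n`. -/
theorem zeta_eq (n : ℕ) (hn : 3 ≤ n) : zeta n hn = 8 * gaussTriple := by
  have : NeZero n := ⟨by omega⟩
  have hn' : (0 : ℝ) < n := by exact_mod_cast NeZero.pos n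
  rw [zeta, sphereMean_mul, integral_gaussPi_triple (by simp) (by simp) (by simp)]
  field_simp
  ring

lemma integrable_toSphere {n : ℕ} {f : EuclideanSpace ℝ (Fin n) → ℝ} (hf : Continuous f) :
    Integrable (fun x : Metric.sphere (0 : EuclideanSpace ℝ (Fin n)) 1 => f x)
      (volume : Measure (EuclideanSpace ℝ (Fin n))).toSphere :=
  (hf.comp continuous_subtype_val).integrable_of_hasCompactSupport
    (HasCompactSupport.of_compactSpace _)

lemma sphereMean_sum {n : ℕ} {ι : Type*} (s : Finset ι) {f : ι → EuclideanSpace ℝ (Fin n) → ℝ}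
    (hf : ∀ i ∈ s, Continuous (f i)) :
    sphereMean n (fun x => ∑ i ∈ s, f i x) = ∑ i ∈ s, sphereMean n (f i) := by
  simp only [sphereMean_eq]
  rw [integral_finsetSum _ fun i hi => integrable_toSphere (hf i hi), Finset.mul_sum]

theorem sphereMean_ar (n : ℕ) (hn : 2 ≤ n) : sphereMean n ar =
    √Real.pi * ((n : ℝ) - 1) * n / 2 *
      (Real.Gamma ((n : ℝ) / 2) / Real.Gamma (((n : ℝ) + 1) / 2)) := by
  have : NeZero n := ⟨by omega⟩
  rw [sphereMean_congr fun x hx => ar_eq hx, sphereMean_sum _ fun p _ => by fun_prop,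
    Finset.sum_congr rfl fun p hp => sphereMean_pair (Finset.mem_offDiag.1 hp).2.2,
    Finset.sum_const, Finset.offDiag_card, nsmul_eq_mul, Finset.card_univ, Fintype.card_fin,
    Nat.cast_sub (Nat.le_mul_self n)]
  push_cast
  ring

/-- The Gaussian mean of the product of two of the summands of the surface area. -/
def pairMean {n : ℕ} (i j k l : Fin n) : ℝ :=
  ∫ x, √(x i ^ 2 + x j ^ 2) * √(x k ^ 2 + x l ^ 2) ∂gaussPi n

lemma pairMean_swap {n : ℕ} (i j k l : Fin n) : pairMean i j k l = pairMean i j l k := by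
  unfold pairMean
  congr 1; ext x; rw [add_comm (x k ^ 2)]

lemma pairMean_self {n : ℕ} {i j : Fin n} (hij : i ≠ j) : pairMean i j i j = 1 := by
  unfold pairMean
  rw [← integral_norm_sq_gaussPi_two,
    ← integral_gaussPi_pair hij (f := fun a b => a ^ 2 + b ^ 2) (by fun_prop)]
  congr 1; ext x
  exact Real.mul_self_sqrt (by positivity)

lemma pairMean_left {n : ℕ} {i j l : Fin n} (hij : i ≠ j) (hli : l ≠ i) (hlj : l ≠ j) :
    pairMean i j i l = gaussTriple := integral_gaussPi_triple hij hli.symm hlj.symm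

lemma pairMean_right {n : ℕ} {i j l : Fin n} (hij : i ≠ j) (hli : l ≠ i) (hlj : l ≠ j) :
    pairMean i j j l = gaussTriple := by
  rw [← integral_gaussPi_triple hij.symm hlj.symm hli.symm]
  unfold pairMean
  congr 1; ext x; rw [add_comm (x i ^ 2)]

lemma pairMean_disjoint {n : ℕ} {i j k l : Fin n} (hij : i ≠ j) (hki : k ≠ i) (hkj : k ≠ j)
    (hli : l ≠ i) (hlj : l ≠ j) (hkl : k ≠ l) : pairMean i j k l = Real.pi / 4 :=
  integral_gaussPi_quadruple hij hki.symm hli.symm hkj.symm hlj.symm hkl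

lemma sum_erase_pair {n : ℕ} {a b : Fin n} (hab : a ≠ b) (f : Fin n → ℝ) {c : ℝ}
    (s : Finset (Fin n)) (ha : a ∈ s) (hb : b ∈ s) (hc : ∀ l ∈ s, l ≠ a → l ≠ b → f l = c) :
    ∑ l ∈ s, f l = f a + f b + ((s.card : ℝ) - 2) * c := by
  rw [← Finset.add_sum_erase s f ha,
    ← Finset.add_sum_erase (s.erase a) f (a := b) (by simp [hab.symm, hb]),
    Finset.sum_congr rfl (g := fun _ => c) (fun l hl => by
      simp only [Finset.mem_erase] at hl
      exact hc l hl.2.2 hl.2.1 hl.1),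
    Finset.sum_const, Finset.card_erase_of_mem (by simp [hab.symm, hb]),
    Finset.card_erase_of_mem ha, nsmul_eq_mul]
  have h2 : 2 ≤ s.card := by
    rw [← Finset.card_pair hab]
    exact Finset.card_le_card (by intro x; simp; rintro (rfl | rfl) <;> assumption)
  rw [show s.card - 1 - 1 = s.card - 2 by omega, Nat.cast_sub h2]
  push_cast; ring

lemma sum_erase_single {n : ℕ} {a : Fin n} (f : Fin n → ℝ) {c : ℝ}
    (s : Finset (Fin n)) (ha : a ∈ s) (hc : ∀ l ∈ s, l ≠ a → f l = c) :
    ∑ l ∈ s, f l = f a + ((s.card : ℝ) - 1) * c := by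
  rw [← Finset.add_sum_erase s f ha, Finset.sum_congr rfl (g := fun _ => c) (fun l hl => by
      simp only [Finset.mem_erase] at hl
      exact hc l hl.2 hl.1),
    Finset.sum_const, Finset.card_erase_of_mem ha, nsmul_eq_mul,
    Nat.cast_sub (Finset.card_pos.2 ⟨a, ha⟩)]
  push_cast; ring

/-- Of the ordered pairs `q`, two have the same index set as `(i, j)`, `4 (n - 2)` share exactly one
index with it, and `(n - 2) (n - 3)` share none. -/
lemma sum_pairMean {n : ℕ} {i j : Fin n} (hij : i ≠ j) :
    ∑ q ∈ (Finset.univ : Finset (Fin n)).offDiag, pairMean i j q.1 q.2 =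
      2 + 4 * ((n : ℝ) - 2) * gaussTriple + ((n : ℝ) - 2) * ((n : ℝ) - 3) * (Real.pi / 4) := by
  have hcard : ∀ k : Fin n, (((Finset.univ.erase k).card : ℕ) : ℝ) = (n : ℝ) - 1 := fun k => by
    rw [Finset.card_erase_of_mem (Finset.mem_univ k), Finset.card_univ, Fintype.card_fin,
      Nat.cast_sub (by have := k.2; omega)]
    simp
  rw [Finset.sum_finset_product _ Finset.univ (fun i => Finset.univ.erase i)
      (by simp [Finset.mem_offDiag, eq_comm])]
  have hi : ∑ l ∈ Finset.univ.erase i, pairMean i j i l = 1 + ((n : ℝ) - 2) * gaussTriple := by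
    rw [sum_erase_single (a := j) _ _ (by simp [hij.symm]) (c := gaussTriple)
      (fun l hl hlj => pairMean_left hij (Finset.ne_of_mem_erase hl) hlj), pairMean_self hij, hcard]
    ring
  have hj : ∑ l ∈ Finset.univ.erase j, pairMean i j j l = 1 + ((n : ℝ) - 2) * gaussTriple := by
    rw [sum_erase_single (a := i) _ _ (by simp [hij]) (c := gaussTriple)
      (fun l hl hli => pairMean_right hij hli (Finset.ne_of_mem_erase hl)), pairMean_swap,
      pairMean_self hij, hcard]
    ring
  rw [sum_erase_pair hij (fun k => ∑ l ∈ Finset.univ.erase k, pairMean i j k l) Finset.univ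
    (by simp) (by simp) (c := 2 * gaussTriple + ((n : ℝ) - 3) * (Real.pi / 4)) ?_, hi, hj]
  · simp only [Finset.card_univ, Fintype.card_fin]; ring
  · intro k _ hki hkj
    rw [sum_erase_pair hij _ _ (by simp [hki.symm]) (by simp [hkj.symm]) (c := Real.pi / 4)
      (fun l hl hli hlj => pairMean_disjoint hij hki hkj hli hlj (Finset.ne_of_mem_erase hl).symm),
      pairMean_swap i j k i, pairMean_swap i j k j, pairMean_left hij hki hkj,
      pairMean_right hij hki hkj, hcard]
    ring

theorem sphereMean_ar_sq (n : ℕ) (hn : 3 ≤ n) : sphereMean n (fun u => ar u ^ 2) =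
    4 * ((n : ℝ) - 1) + ((n : ℝ) - 2) * ((n : ℝ) - 1) * zeta n hn
      + ((n : ℝ) - 3) * ((n : ℝ) - 2) * ((n : ℝ) - 1) / 2 * Real.pi := by
  have : NeZero n := ⟨by omega⟩
  have hn' : (0 : ℝ) < n := by exact_mod_cast NeZero.pos n
  have h1 : ∀ x : EuclideanSpace ℝ (Fin n), ‖x‖ = 1 → ar x ^ 2 =
      ∑ p ∈ (Finset.univ : Finset (Fin n)).offDiag, ∑ q ∈ (Finset.univ : Finset (Fin n)).offDiag,
        √(x p.1 ^ 2 + x p.2 ^ 2) * √(x q.1 ^ 2 + x q.2 ^ 2) := fun x hx => by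
    rw [ar_eq hx, sq, Finset.sum_mul_sum]
  rw [sphereMean_congr h1, sphereMean_sum _ fun p _ => by fun_prop]
  have h2 : ∀ p ∈ (Finset.univ : Finset (Fin n)).offDiag,
      sphereMean n (fun x => ∑ q ∈ (Finset.univ : Finset (Fin n)).offDiag,
        √(x p.1 ^ 2 + x p.2 ^ 2) * √(x q.1 ^ 2 + x q.2 ^ 2)) =
      (2 + 4 * ((n : ℝ) - 2) * gaussTriple + ((n : ℝ) - 2) * ((n : ℝ) - 3) * (Real.pi / 4)) *
        (2 / n) := fun p hp => by
    rw [sphereMean_sum _ fun q _ => by fun_prop, ← sum_pairMean (Finset.mem_offDiag.1 hp).2.2,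
      Finset.sum_mul]
    exact Finset.sum_congr rfl fun q _ => sphereMean_mul _ _ _ _
  -- All `n (n - 1)` ordered pairs contribute equally.
  rw [Finset.sum_congr rfl h2, Finset.sum_const, Finset.offDiag_card, nsmul_eq_mul,
    Finset.card_univ, Fintype.card_fin, Nat.cast_sub (Nat.le_mul_self n), zeta_eq]
  push_cast
  field_simp
  ring

end CubeShadow

/-! ### Spherical coordinates, the shared-index moment and the triple integrals. -/

namespace CubeShadow

open Set

/-- The range of an angle in the first quadrant. -/
abbrev quarter : Set ℝ := Ioo 0 (Real.pi / 2)

lemma cos_pos_quarter {θ : ℝ} (h : θ ∈ quarter) : 0 < Real.cos θ :=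
  Real.cos_pos_of_mem_Ioo ⟨by linarith [h.1, Real.pi_pos], h.2⟩

lemma sin_pos_quarter {θ : ℝ} (h : θ ∈ quarter) : 0 < Real.sin θ :=
  Real.sin_pos_of_mem_Ioo ⟨h.1, by linarith [h.2, Real.pi_pos]⟩

/-- Integrals are taken with values in `ENNReal` here and below, so that Tonelli and changes of
variables need no integrability; finite values are converted to real ones only at the end. -/
lemma lintegral_quadrant {f : ℝ → ℝ → ENNReal} (hf : Measurable fun p : ℝ × ℝ => f p.1 p.2) :
    ∫⁻ x in Ioi (0 : ℝ), ∫⁻ y in Ioi (0 : ℝ), f x y =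
      ∫⁻ r in Ioi (0 : ℝ), ∫⁻ θ in quarter,
        ENNReal.ofReal r * f (r * Real.cos θ) (r * Real.sin θ) := by
  set F : ℝ × ℝ → ENNReal := (Ioi (0 : ℝ) ×ˢ Ioi (0 : ℝ)).indicator fun p => f p.1 p.2 with hF
  have hmeas : MeasurableSet (Ioi (0 : ℝ) ×ˢ Ioi (0 : ℝ)) := measurableSet_Ioi.prod measurableSet_Ioi
  have h1 := lintegral_comp_polarCoord_symm F
  have hL : ∫⁻ p, F p = ∫⁻ x in Ioi (0 : ℝ), ∫⁻ y in Ioi (0 : ℝ), f x y := by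
    rw [hF, lintegral_indicator hmeas, Measure.volume_eq_prod, ← Measure.prod_restrict,
      lintegral_prod _ hf.aemeasurable]
  rw [← hL, ← h1]
  have hm2 : Measurable fun p : ℝ × ℝ =>
      ENNReal.ofReal p.1 * f (p.1 * Real.cos p.2) (p.1 * Real.sin p.2) := by
    refine Measurable.mul (by fun_prop) ?_
    exact hf.comp (by fun_prop : Measurable fun p : ℝ × ℝ =>
      (p.1 * Real.cos p.2, p.1 * Real.sin p.2))
  have hR : ∫⁻ r in Ioi (0 : ℝ), ∫⁻ θ in quarter,
        ENNReal.ofReal r * f (r * Real.cos θ) (r * Real.sin θ) =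
      ∫⁻ p in Ioi (0 : ℝ) ×ˢ quarter,
        ENNReal.ofReal p.1 * f (p.1 * Real.cos p.2) (p.1 * Real.sin p.2) := by
    rw [Measure.volume_eq_prod, ← Measure.prod_restrict, lintegral_prod _ hm2.aemeasurable]
  rw [hR, ← lintegral_indicator (measurableSet_Ioi.prod measurableSet_Ioo),
    ← lintegral_indicator polarCoord.open_target.measurableSet]
  congr 1
  ext ⟨r, θ⟩
  by_cases ht : (r, θ) ∈ polarCoord.target
  · rw [indicator_of_mem ht]
    simp only [polarCoord_target, mem_prod, mem_Ioi, mem_Ioo] at ht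
    by_cases hq : (r, θ) ∈ Ioi (0 : ℝ) ×ˢ quarter
    · rw [indicator_of_mem hq, hF, indicator_of_mem, smul_eq_mul]
      · rfl
      · exact ⟨mul_pos ht.1 (cos_pos_quarter hq.2), mul_pos ht.1 (sin_pos_quarter hq.2)⟩
    · rw [indicator_of_notMem hq, hF, indicator_of_notMem, smul_zero]
      rintro ⟨hc, hs⟩
      simp only [polarCoord_symm_apply, mem_Ioi] at hc hs
      have hc' : 0 < Real.cos θ := pos_of_mul_pos_right hc ht.1.le
      have hs' : 0 < Real.sin θ := pos_of_mul_pos_right hs ht.1.le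
      refine hq ⟨ht.1, ?_, ?_⟩
      · by_contra! h
        exact absurd (Real.sin_nonpos_of_nonpos_of_neg_pi_le h ht.2.1.le) (not_le.2 hs')
      · by_contra! h
        exact absurd (Real.cos_nonpos_of_pi_div_two_le_of_le h (by linarith [ht.2.2, Real.pi_pos]))
          (not_le.2 hc')
  · rw [indicator_of_notMem ht, indicator_of_notMem]
    rintro ⟨hr, hθ⟩
    exact ht ⟨hr, by linarith [hθ.1, Real.pi_pos], by linarith [hθ.2, Real.pi_pos]⟩

lemma lintegral_even {g : ℝ → ENNReal} (hg : ∀ x, g (-x) = g x) :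
    ∫⁻ x, g x = 2 * ∫⁻ x in Ioi (0 : ℝ), g x := by
  have h1 : ∫⁻ x in Iio (0 : ℝ), g x = ∫⁻ x in Ioi (0 : ℝ), g x := by
    have := (Measure.measurePreserving_neg (volume : Measure ℝ)).setLIntegral_comp_preimage_emb
      (MeasurableEquiv.neg ℝ).measurableEmbedding g (Ioi 0)
    rw [← this]
    simp [hg]
  rw [← lintegral_add_compl g (measurableSet_Ioi (a := (0 : ℝ))), compl_Ioi,
    setLIntegral_congr (Iio_ae_eq_Iic).symm, h1, two_mul]

lemma lintegral_gauss_even {g : ℝ → ENNReal} (hm : Measurable g) (hg : ∀ x, g (-x) = g x) :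
    ∫⁻ x, g x ∂gauss =
      ENNReal.ofReal (2 / √Real.pi) * ∫⁻ x in Ioi (0 : ℝ), ENNReal.ofReal (Real.exp (-x ^ 2)) * g x := by
  rw [gauss_eq, lintegral_withDensity_eq_lintegral_mul _ (by fun_prop) hm, lintegral_even,
    ← lintegral_const_mul', ← lintegral_const_mul']
  · congr 1; ext x
    simp only [Pi.mul_apply]
    rw [div_eq_mul_inv, ENNReal.ofReal_mul (by positivity), ENNReal.ofReal_mul (by positivity)]
    simp only [ENNReal.ofReal_ofNat]
    ring
  · exact ENNReal.ofReal_ne_top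
  · simp
  · intro x; simp [hg]

lemma lintegral_gaussPi_three {F : ℝ × ℝ × ℝ → ENNReal} (hF : Measurable F) :
    ∫⁻ x, F (x 0, x 1, x 2) ∂gaussPi 3 = ∫⁻ a, ∫⁻ b, ∫⁻ c, F (a, b, c) ∂gauss ∂gauss ∂gauss := by
  have h1 := (measurePreserving_piFinSuccAbove (fun _ : Fin 3 => gauss) 0).lintegral_comp
    (f := fun p : ℝ × (Fin 2 → ℝ) => F (p.1, p.2 0, p.2 1)) (by fun_prop)
  have h2 := fun a : ℝ => (measurePreserving_piFinTwo (fun _ : Fin 2 => gauss)).lintegral_comp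
    (f := fun p : ℝ × ℝ => F (a, p.1, p.2)) (by fun_prop)
  rw [gaussPi]
  refine (h1.trans ?_)
  rw [lintegral_prod _ (by fun_prop)]
  refine lintegral_congr fun a => ?_
  refine (h2 a).trans ?_
  rw [lintegral_prod _ (by fun_prop)]

lemma setLIntegral_swap {f : ℝ → ℝ → ENNReal} (hf : Measurable fun p : ℝ × ℝ => f p.1 p.2)
    (s t : Set ℝ) : ∫⁻ x in s, ∫⁻ y in t, f x y = ∫⁻ y in t, ∫⁻ x in s, f x y :=
  lintegral_lintegral_swap hf.aemeasurable

/-- Polar coordinates in the first quadrant, with the angle as the outer variable and the first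
coordinate the larger one at large angles. -/
lemma lintegral_quadrant_sin {f : ℝ → ℝ → ENNReal} (hf : Measurable fun p : ℝ × ℝ => f p.1 p.2) :
    ∫⁻ x in Ioi (0 : ℝ), ∫⁻ y in Ioi (0 : ℝ), f x y =
      ∫⁻ θ in quarter, ∫⁻ r in Ioi (0 : ℝ),
        ENNReal.ofReal r * f (r * Real.sin θ) (r * Real.cos θ) := by
  have hf' : Measurable fun p : ℝ × ℝ => f p.2 p.1 := hf.comp measurable_swap
  rw [setLIntegral_swap hf, lintegral_quadrant hf', setLIntegral_swap]
  refine Measurable.mul (by fun_prop) ?_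
  exact hf.comp (by fun_prop : Measurable fun p : ℝ × ℝ =>
      (p.1 * Real.sin p.2, p.1 * Real.cos p.2))

lemma lintegral_quadrant_cos {f : ℝ → ℝ → ENNReal} (hf : Measurable fun p : ℝ × ℝ => f p.1 p.2) :
    ∫⁻ x in Ioi (0 : ℝ), ∫⁻ y in Ioi (0 : ℝ), f x y =
      ∫⁻ θ in quarter, ∫⁻ r in Ioi (0 : ℝ),
        ENNReal.ofReal r * f (r * Real.cos θ) (r * Real.sin θ) := by
  rw [lintegral_quadrant hf, setLIntegral_swap]
  refine Measurable.mul (by fun_prop) ?_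
  exact hf.comp (by fun_prop : Measurable fun p : ℝ × ℝ =>
      (p.1 * Real.cos p.2, p.1 * Real.sin p.2))

lemma measurable_setLIntegral {α : Type*} [MeasurableSpace α] {f : α → ℝ → ENNReal}
    (hf : Measurable fun p : α × ℝ => f p.1 p.2) (s : Set ℝ) :
    Measurable fun a => ∫⁻ y in s, f a y :=
  hf.lintegral_prod_right'

/-- Spherical coordinates in the positive octant. -/
lemma lintegral_octant {F : ℝ × ℝ × ℝ → ENNReal} (hF : Measurable F) :
    ∫⁻ x in Ioi (0 : ℝ), ∫⁻ y in Ioi (0 : ℝ), ∫⁻ z in Ioi (0 : ℝ), F (x, y, z) =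
      ∫⁻ θ in quarter, ∫⁻ φ in quarter, ∫⁻ r in Ioi (0 : ℝ),
        ENNReal.ofReal r * (ENNReal.ofReal (r * Real.sin φ) *
          F (r * Real.sin φ * Real.cos θ, r * Real.sin φ * Real.sin θ, r * Real.cos φ)) := by
  rw [lintegral_quadrant_cos
    (f := fun x y => ∫⁻ z in Ioi (0 : ℝ), F (x, y, z)) (measurable_setLIntegral (by fun_prop) _)]
  refine lintegral_congr fun θ => ?_
  have : ∀ ρ : ℝ, ENNReal.ofReal ρ * ∫⁻ z in Ioi (0 : ℝ), F (ρ * Real.cos θ, ρ * Real.sin θ, z) =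
      ∫⁻ z in Ioi (0 : ℝ), ENNReal.ofReal ρ * F (ρ * Real.cos θ, ρ * Real.sin θ, z) := fun ρ =>
    (lintegral_const_mul' _ _ ENNReal.ofReal_ne_top).symm
  simp only [this]
  rw [lintegral_quadrant_sin (f := fun ρ z =>
    ENNReal.ofReal ρ * F (ρ * Real.cos θ, ρ * Real.sin θ, z)) (by fun_prop)]

/-- Spherical coordinates in the positive orthant of four-dimensional space. -/
lemma lintegral_orthant {F : ℝ × ℝ × ℝ × ℝ → ENNReal} (hF : Measurable F) :
    ∫⁻ x in Ioi (0 : ℝ), ∫⁻ y in Ioi (0 : ℝ), ∫⁻ z in Ioi (0 : ℝ), ∫⁻ w in Ioi (0 : ℝ),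
      F (x, y, z, w) =
      ∫⁻ θ in quarter, ∫⁻ φ in quarter, ∫⁻ ψ in quarter, ∫⁻ r in Ioi (0 : ℝ),
        ENNReal.ofReal r * (ENNReal.ofReal (r * Real.sin ψ) *
          (ENNReal.ofReal (r * Real.sin ψ * Real.sin φ) *
          F (r * Real.sin ψ * Real.sin φ * Real.cos θ, r * Real.sin ψ * Real.sin φ * Real.sin θ,
            r * Real.sin ψ * Real.cos φ, r * Real.cos ψ))) := by
  rw [lintegral_octant (F := fun p => ∫⁻ w in Ioi (0 : ℝ), F (p.1, p.2.1, p.2.2, w))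
    (measurable_setLIntegral (by fun_prop) _)]
  refine lintegral_congr fun θ => lintegral_congr fun φ => ?_
  have : ∀ r : ℝ, ENNReal.ofReal r * (ENNReal.ofReal (r * Real.sin φ) * ∫⁻ w in Ioi (0 : ℝ),
      F (r * Real.sin φ * Real.cos θ, r * Real.sin φ * Real.sin θ, r * Real.cos φ, w)) =
      ∫⁻ w in Ioi (0 : ℝ), ENNReal.ofReal r * (ENNReal.ofReal (r * Real.sin φ) *
      F (r * Real.sin φ * Real.cos θ, r * Real.sin φ * Real.sin θ, r * Real.cos φ, w)) := fun r => by
    rw [lintegral_const_mul' _ _ ENNReal.ofReal_ne_top, lintegral_const_mul' _ _ ENNReal.ofReal_ne_top]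
  simp only [this]
  rw [lintegral_quadrant_sin (f := fun r w => ENNReal.ofReal r * (ENNReal.ofReal (r * Real.sin φ) *
      F (r * Real.sin φ * Real.cos θ, r * Real.sin φ * Real.sin θ, r * Real.cos φ, w)))
    (by fun_prop)]

lemma lintegral_pow_mul_exp_neg_sq (k : ℕ) :
    ∫⁻ r in Ioi (0 : ℝ), ENNReal.ofReal (r ^ k * Real.exp (-r ^ 2)) =
      ENNReal.ofReal (Real.Gamma (((k : ℝ) + 1) / 2) / 2) := by
  have hk : (-1 : ℝ) < k := by have : (0 : ℝ) ≤ k := k.cast_nonneg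
                               linarith
  rw [← integral_pow_mul_exp_neg_sq, ofReal_integral_eq_lintegral_ofReal]
  · have := integrableOn_rpow_mul_exp_neg_rpow (p := 2) (s := k) hk (by norm_num)
    simp only [Real.rpow_natCast, Real.rpow_ofNat] at this
    exact this
  · filter_upwards [ae_restrict_mem measurableSet_Ioi] with r hr
    have : 0 < r := hr
    positivity

lemma ofReal_integral_quarter {g : ℝ → ℝ} (hg : Continuous g) (h0 : ∀ x ∈ quarter, 0 ≤ g x) :
    ENNReal.ofReal (∫ x in (0 : ℝ)..Real.pi / 2, g x) = ∫⁻ x in quarter, ENNReal.ofReal (g x) := by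
  rw [intervalIntegral.integral_of_le (by positivity), integral_Ioc_eq_integral_Ioo,
    ofReal_integral_eq_lintegral_ofReal]
  · exact (hg.integrableOn_Icc).mono_set Ioo_subset_Icc_self
  · filter_upwards [ae_restrict_mem measurableSet_Ioo] with x hx using h0 x hx

lemma continuous_integral_quarter {α : Type*} [TopologicalSpace α] {g : α → ℝ → ℝ}
    (hg : Continuous fun p : α × ℝ => g p.1 p.2) :
    Continuous fun a => ∫ x in (0 : ℝ)..Real.pi / 2, g a x :=
  intervalIntegral.continuous_parametric_intervalIntegral_of_continuous' hg _ _

lemma integral_quarter_nonneg {g : ℝ → ℝ} (h0 : ∀ x ∈ quarter, 0 ≤ g x) :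
    0 ≤ ∫ x in (0 : ℝ)..Real.pi / 2, g x := by
  rw [intervalIntegral.integral_of_le (by positivity), integral_Ioc_eq_integral_Ioo]
  exact setIntegral_nonneg measurableSet_Ioo h0

lemma ofReal_integral_quarter_two {g : ℝ → ℝ → ℝ} (hg : Continuous fun p : ℝ × ℝ => g p.1 p.2)
    (h0 : ∀ x ∈ quarter, ∀ y ∈ quarter, 0 ≤ g x y) :
    ENNReal.ofReal (∫ x in (0 : ℝ)..Real.pi / 2, ∫ y in (0 : ℝ)..Real.pi / 2, g x y) =
      ∫⁻ x in quarter, ∫⁻ y in quarter, ENNReal.ofReal (g x y) := by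
  rw [ofReal_integral_quarter (continuous_integral_quarter hg)
    fun x hx => integral_quarter_nonneg (h0 x hx)]
  refine setLIntegral_congr_fun measurableSet_Ioo fun x hx => ?_
  exact ofReal_integral_quarter (by fun_prop) (h0 x hx)

lemma ofReal_integral_quarter_three {g : ℝ → ℝ → ℝ → ℝ}
    (hg : Continuous fun p : ℝ × ℝ × ℝ => g p.1 p.2.1 p.2.2)
    (h0 : ∀ x ∈ quarter, ∀ y ∈ quarter, ∀ z ∈ quarter, 0 ≤ g x y z) :
    ENNReal.ofReal (∫ x in (0 : ℝ)..Real.pi / 2, ∫ y in (0 : ℝ)..Real.pi / 2,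
      ∫ z in (0 : ℝ)..Real.pi / 2, g x y z) =
      ∫⁻ x in quarter, ∫⁻ y in quarter, ∫⁻ z in quarter, ENNReal.ofReal (g x y z) := by
  have h1 : Continuous fun p : ℝ × ℝ => ∫ z in (0 : ℝ)..Real.pi / 2, g p.1 p.2 z :=
    continuous_integral_quarter (g := fun (p : ℝ × ℝ) z => g p.1 p.2 z)
      (hg.comp (by fun_prop : Continuous fun q : (ℝ × ℝ) × ℝ => (q.1.1, q.1.2, q.2)))
  rw [ofReal_integral_quarter_two h1 fun x hx y hy => integral_quarter_nonneg (h0 x hx y hy)]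
  refine setLIntegral_congr_fun measurableSet_Ioo fun x hx => ?_
  refine setLIntegral_congr_fun measurableSet_Ioo fun y hy => ?_
  exact ofReal_integral_quarter
    (hg.comp (by fun_prop : Continuous fun z : ℝ => (x, y, z))) (h0 x hx y hy)

/-- The double integral to which all the second moments reduce. -/
def angleIntegral : ℝ :=
  ∫ θ in (0 : ℝ)..Real.pi / 2, ∫ φ in (0 : ℝ)..Real.pi / 2,
    Real.sin φ ^ 2 * √(1 - Real.sin φ ^ 2 * Real.cos θ ^ 2)

lemma angleIntegral_nonneg : 0 ≤ angleIntegral :=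
  integral_quarter_nonneg fun _ _ => integral_quarter_nonneg fun _ _ => by positivity

/-- The integral of `√(x ^ 2 + y ^ 2) * √(y ^ 2 + z ^ 2)` against a Gaussian weight. -/
lemma lintegral_octant_gauss :
    ∫⁻ x in Ioi (0 : ℝ), ∫⁻ y in Ioi (0 : ℝ), ∫⁻ z in Ioi (0 : ℝ),
      ENNReal.ofReal (√(x ^ 2 + y ^ 2) * √(y ^ 2 + z ^ 2) * Real.exp (-(x ^ 2 + y ^ 2 + z ^ 2))) =
      ENNReal.ofReal (3 * √Real.pi / 8 * angleIntegral) := by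
  rw [lintegral_octant (F := fun p => ENNReal.ofReal (√(p.1 ^ 2 + p.2.1 ^ 2) *
    √(p.2.1 ^ 2 + p.2.2 ^ 2) * Real.exp (-(p.1 ^ 2 + p.2.1 ^ 2 + p.2.2 ^ 2)))) (by fun_prop)]
  -- The radial factor is `r ^ 4 * exp (-r ^ 2)`: two powers from the Jacobian and two from the
  -- integrand.
  have hG : Real.Gamma ((((4 : ℕ) : ℝ) + 1) / 2) / 2 = 3 * √Real.pi / 8 := by
    have h1 := Real.Gamma_add_one (s := 1 / 2) (by norm_num)
    have h2 := Real.Gamma_add_one (s := 3 / 2) (by norm_num)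
    rw [Real.Gamma_one_half_eq] at h1
    rw [show (3 / 2 : ℝ) = 1 / 2 + 1 by norm_num, h1] at h2
    rw [show (((4 : ℕ) : ℝ) + 1) / 2 = 1 / 2 + 1 + 1 by norm_num, h2]
    ring
  have hinner : ∀ θ ∈ quarter, ∀ φ ∈ quarter, ∫⁻ r in Ioi (0 : ℝ),
      ENNReal.ofReal r * (ENNReal.ofReal (r * Real.sin φ) * ENNReal.ofReal
        (√((r * Real.sin φ * Real.cos θ) ^ 2 + (r * Real.sin φ * Real.sin θ) ^ 2) *
        √((r * Real.sin φ * Real.sin θ) ^ 2 + (r * Real.cos φ) ^ 2) *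
        Real.exp (-((r * Real.sin φ * Real.cos θ) ^ 2 + (r * Real.sin φ * Real.sin θ) ^ 2 +
          (r * Real.cos φ) ^ 2)))) =
      ENNReal.ofReal (3 * √Real.pi / 8) *
        ENNReal.ofReal (Real.sin φ ^ 2 * √(1 - Real.sin φ ^ 2 * Real.cos θ ^ 2)) := by
    intro θ hθ φ hφ
    have hs := sin_pos_quarter hφ
    rw [← hG, ← lintegral_pow_mul_exp_neg_sq, ← lintegral_mul_const' _ _ ENNReal.ofReal_ne_top]
    refine setLIntegral_congr_fun measurableSet_Ioi fun r hr => ?_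
    have hr : 0 < r := hr
    have hθ2 := Real.sin_sq_add_cos_sq θ
    have hφ2 := Real.sin_sq_add_cos_sq φ
    have e1 : (r * Real.sin φ * Real.cos θ) ^ 2 + (r * Real.sin φ * Real.sin θ) ^ 2 =
        (r * Real.sin φ) ^ 2 := by
      linear_combination (r * Real.sin φ) ^ 2 * hθ2
    have e2 : (r * Real.sin φ * Real.sin θ) ^ 2 + (r * Real.cos φ) ^ 2 =
        r ^ 2 * (1 - Real.sin φ ^ 2 * Real.cos θ ^ 2) := by
      linear_combination (r * Real.sin φ) ^ 2 * hθ2 + r ^ 2 * hφ2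
    have e3 : (r * Real.sin φ) ^ 2 + (r * Real.cos φ) ^ 2 = r ^ 2 := by
      linear_combination r ^ 2 * hφ2
    rw [e1, e2, e3, Real.sqrt_sq (by positivity), Real.sqrt_mul (by positivity),
      Real.sqrt_sq hr.le, ← ENNReal.ofReal_mul (by positivity), ← ENNReal.ofReal_mul hr.le,
      ← ENNReal.ofReal_mul (by positivity)]
    congr 1
    ring
  rw [setLIntegral_congr_fun measurableSet_Ioo fun θ hθ =>
    setLIntegral_congr_fun measurableSet_Ioo fun φ hφ => hinner θ hθ φ hφ]
  simp only [lintegral_const_mul' _ _ ENNReal.ofReal_ne_top]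
  rw [ENNReal.ofReal_mul (by positivity), angleIntegral, ofReal_integral_quarter_two (by fun_prop)
    fun _ _ _ _ => by positivity]

lemma lintegral_gaussPi_three_even {F : ℝ × ℝ × ℝ → ENNReal} (hF : Measurable F)
    (h1 : ∀ a b c, F (-a, b, c) = F (a, b, c)) (h2 : ∀ a b c, F (a, -b, c) = F (a, b, c))
    (h3 : ∀ a b c, F (a, b, -c) = F (a, b, c)) :
    ∫⁻ x, F (x 0, x 1, x 2) ∂gaussPi 3 = ENNReal.ofReal (2 / √Real.pi) ^ 3 *
      ∫⁻ x in Ioi (0 : ℝ), ∫⁻ y in Ioi (0 : ℝ), ∫⁻ z in Ioi (0 : ℝ),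
        ENNReal.ofReal (Real.exp (-(x ^ 2 + y ^ 2 + z ^ 2))) * F (x, y, z) := by
  have hm : Measurable fun p : ℝ × ℝ => ∫⁻ c in Ioi (0 : ℝ),
      ENNReal.ofReal (Real.exp (-c ^ 2)) * F (p.1, p.2, c) :=
    measurable_setLIntegral (by fun_prop) _
  have hm2 : Measurable fun a : ℝ => ∫⁻ b in Ioi (0 : ℝ), ENNReal.ofReal (Real.exp (-b ^ 2)) *
      (ENNReal.ofReal (2 / √Real.pi) * ∫⁻ c in Ioi (0 : ℝ),
        ENNReal.ofReal (Real.exp (-c ^ 2)) * F (a, b, c)) :=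
    measurable_setLIntegral (by fun_prop) _
  rw [lintegral_gaussPi_three hF]
  have e1 : ∀ a b, ∫⁻ c, F (a, b, c) ∂gauss = ENNReal.ofReal (2 / √Real.pi) *
      ∫⁻ c in Ioi (0 : ℝ), ENNReal.ofReal (Real.exp (-c ^ 2)) * F (a, b, c) := fun a b =>
    lintegral_gauss_even (by fun_prop) (h3 a b)
  simp only [e1]
  have e2 : ∀ a, ∫⁻ b, ENNReal.ofReal (2 / √Real.pi) *
      (∫⁻ c in Ioi (0 : ℝ), ENNReal.ofReal (Real.exp (-c ^ 2)) * F (a, b, c)) ∂gauss =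
      ENNReal.ofReal (2 / √Real.pi) * ∫⁻ b in Ioi (0 : ℝ), ENNReal.ofReal (Real.exp (-b ^ 2)) *
      (ENNReal.ofReal (2 / √Real.pi) * ∫⁻ c in Ioi (0 : ℝ),
        ENNReal.ofReal (Real.exp (-c ^ 2)) * F (a, b, c)) := fun a =>
    lintegral_gauss_even (by fun_prop) (fun b => by simp only [h2])
  simp only [e2]
  rw [lintegral_gauss_even (by fun_prop) (fun a => by simp only [h1])]
  have hk : ∀ (c : ℝ) (f : ℝ → ENNReal), ENNReal.ofReal c * ∫⁻ x in Ioi (0 : ℝ), f x =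
      ∫⁻ x in Ioi (0 : ℝ), ENNReal.ofReal c * f x := fun c f =>
    (lintegral_const_mul' _ _ ENNReal.ofReal_ne_top).symm
  simp only [pow_three, mul_assoc, hk]
  refine lintegral_congr fun a => lintegral_congr fun b => lintegral_congr fun c => ?_
  rw [show -(a ^ 2 + b ^ 2 + c ^ 2) = -a ^ 2 + -b ^ 2 + -c ^ 2 by ring, Real.exp_add, Real.exp_add,
    ENNReal.ofReal_mul (by positivity), ENNReal.ofReal_mul (by positivity)]
  ring

/-- The shared variable is relabelled as the middle one, so that in spherical coordinates `√(x² +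
y²)` is simply `r sin φ`. The constant is `(2 / √π) ^ 3 * (3 √π / 8)`, the cube coming from
reduction to the positive octant. -/
theorem gaussTriple_eq : gaussTriple = 3 / Real.pi * angleIntegral := by
  rw [← integral_gaussPi_triple (n := 3) (i := 1) (j := 0) (k := 2) (by decide) (by decide)
    (by decide), integral_eq_lintegral_of_nonneg_ae
      (Filter.Eventually.of_forall fun _ => by positivity)
      (by fun_prop : Continuous fun x : Fin 3 → ℝ =>
        √(x 1 ^ 2 + x 0 ^ 2) * √(x 1 ^ 2 + x 2 ^ 2)).aestronglyMeasurable]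
  have h := lintegral_gaussPi_three_even (F := fun p => ENNReal.ofReal
    (√(p.1 ^ 2 + p.2.1 ^ 2) * √(p.2.1 ^ 2 + p.2.2 ^ 2))) (by fun_prop) (by simp) (by simp) (by simp)
  have h2 := lintegral_octant_gauss
  simp only [← ENNReal.ofReal_mul (Real.exp_pos _).le] at h
  simp only [mul_comm _ (Real.exp _)] at h2
  rw [h2] at h
  have e : ∀ x : Fin 3 → ℝ, √(x 1 ^ 2 + x 0 ^ 2) * √(x 1 ^ 2 + x 2 ^ 2) =
      √(x 0 ^ 2 + x 1 ^ 2) * √(x 1 ^ 2 + x 2 ^ 2) := fun x => by rw [add_comm (x 1 ^ 2) (x 0 ^ 2)]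
  simp only [e]
  rw [h, ← ENNReal.ofReal_pow (by positivity), ← ENNReal.ofReal_mul (by positivity),
    ENNReal.toReal_ofReal (mul_nonneg (by positivity)
      (mul_nonneg (by positivity) angleIntegral_nonneg))]
  have hp := Real.sq_sqrt Real.pi_pos.le
  have hp0 : 0 < √Real.pi := by positivity
  have hpi := Real.pi_pos
  field_simp
  rw [hp]
  ring

/-- Passing from an integral over the positive orthant of a function homogeneous of degree two
times a Gaussian weight to spherical coordinates. -/
lemma lintegral_orthant_gauss {f : ℝ × ℝ × ℝ × ℝ → ℝ} (hf : Continuous f)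
    (hh : ∀ r : ℝ, 0 < r → ∀ a b c d, f (r * a, r * b, r * c, r * d) = r ^ 2 * f (a, b, c, d)) :
    ∫⁻ x in Ioi (0 : ℝ), ∫⁻ y in Ioi (0 : ℝ), ∫⁻ z in Ioi (0 : ℝ), ∫⁻ w in Ioi (0 : ℝ),
      ENNReal.ofReal (f (x, y, z, w) * Real.exp (-(x ^ 2 + y ^ 2 + z ^ 2 + w ^ 2))) =
    ∫⁻ θ in quarter, ∫⁻ φ in quarter, ∫⁻ ψ in quarter, ENNReal.ofReal (Real.sin φ * Real.sin ψ ^ 2 *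
      f (Real.sin ψ * Real.sin φ * Real.cos θ, Real.sin ψ * Real.sin φ * Real.sin θ,
            Real.sin ψ * Real.cos φ, Real.cos ψ)) := by
  rw [lintegral_orthant (F := fun p => ENNReal.ofReal
    (f (p.1, p.2.1, p.2.2.1, p.2.2.2) *
      Real.exp (-(p.1 ^ 2 + p.2.1 ^ 2 + p.2.2.1 ^ 2 + p.2.2.2 ^ 2)))) (by fun_prop)]
  -- The radial factor is `r ^ 5 * exp (-r ^ 2)`, three powers from the Jacobian and two from
  -- homogeneity; its integral is exactly `1`, so no constant appears.
  have hG : Real.Gamma ((((5 : ℕ) : ℝ) + 1) / 2) / 2 = 1 := by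
    rw [show (((5 : ℕ) : ℝ) + 1) / 2 = ((2 : ℕ) : ℝ) + 1 by norm_num, Real.Gamma_nat_eq_factorial]
    norm_num [Nat.factorial]
  refine setLIntegral_congr_fun measurableSet_Ioo fun θ hθ => ?_
  refine setLIntegral_congr_fun measurableSet_Ioo fun φ hφ => ?_
  refine setLIntegral_congr_fun measurableSet_Ioo fun ψ hψ => ?_
  have hs := sin_pos_quarter hφ
  have hs' := sin_pos_quarter hψ
  have hone := lintegral_pow_mul_exp_neg_sq 5
  rw [hG, ENNReal.ofReal_one] at hone
  have hθ2 := Real.sin_sq_add_cos_sq θ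
  have hφ2 := Real.sin_sq_add_cos_sq φ
  have hψ2 := Real.sin_sq_add_cos_sq ψ
  rw [← one_mul (ENNReal.ofReal (Real.sin φ * _ * _)), ← hone,
    ← lintegral_mul_const' _ _ ENNReal.ofReal_ne_top]
  refine setLIntegral_congr_fun measurableSet_Ioi fun r hr => ?_
  have hr : 0 < r := hr
  have e1 : (r * Real.sin ψ * Real.sin φ * Real.cos θ) ^ 2 +
      (r * Real.sin ψ * Real.sin φ * Real.sin θ) ^ 2 + (r * Real.sin ψ * Real.cos φ) ^ 2 +
      (r * Real.cos ψ) ^ 2 = r ^ 2 := by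
    linear_combination (r * Real.sin ψ * Real.sin φ) ^ 2 * hθ2 + (r * Real.sin ψ) ^ 2 * hφ2 +
      r ^ 2 * hψ2
  simp only [e1]
  rw [← ENNReal.ofReal_mul (by positivity), ← ENNReal.ofReal_mul (by positivity),
    ← ENNReal.ofReal_mul (by positivity), ← ENNReal.ofReal_mul (by positivity)]
  congr 1
  have := hh r hr (Real.sin ψ * Real.sin φ * Real.cos θ) (Real.sin ψ * Real.sin φ * Real.sin θ)
    (Real.sin ψ * Real.cos φ) (Real.cos ψ)
  simp only [← mul_assoc] at this
  rw [this]
  ring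

lemma lintegral_quadrant_norm_gauss :
    ∫⁻ x in Ioi (0 : ℝ), ∫⁻ y in Ioi (0 : ℝ),
      ENNReal.ofReal (√(x ^ 2 + y ^ 2) * Real.exp (-(x ^ 2 + y ^ 2))) =
      ENNReal.ofReal (√Real.pi / 4 * (Real.pi / 2)) := by
  rw [lintegral_quadrant_cos (f := fun x y =>
    ENNReal.ofReal (√(x ^ 2 + y ^ 2) * Real.exp (-(x ^ 2 + y ^ 2)))) (by fun_prop)]
  have hG : Real.Gamma ((((2 : ℕ) : ℝ) + 1) / 2) / 2 = √Real.pi / 4 := by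
    have h1 := Real.Gamma_add_one (s := 1 / 2) (by norm_num)
    rw [Real.Gamma_one_half_eq] at h1
    rw [show (((2 : ℕ) : ℝ) + 1) / 2 = 1 / 2 + 1 by norm_num, h1]
    ring
  have h : ∀ θ : ℝ, ∫⁻ r in Ioi (0 : ℝ), ENNReal.ofReal r * ENNReal.ofReal
      (√((r * Real.cos θ) ^ 2 + (r * Real.sin θ) ^ 2) *
        Real.exp (-((r * Real.cos θ) ^ 2 + (r * Real.sin θ) ^ 2))) =
      ENNReal.ofReal (√Real.pi / 4) := fun θ => by
    rw [← hG, ← lintegral_pow_mul_exp_neg_sq]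
    refine setLIntegral_congr_fun measurableSet_Ioi fun r hr => ?_
    have hr : 0 < r := hr
    have e : (r * Real.cos θ) ^ 2 + (r * Real.sin θ) ^ 2 = r ^ 2 := by
      linear_combination r ^ 2 * Real.sin_sq_add_cos_sq θ
    rw [e, Real.sqrt_sq hr.le, ← ENNReal.ofReal_mul hr.le]
    congr 1
    ring
  simp only [h, lintegral_const, Measure.restrict_apply_univ, Real.volume_Ioo, sub_zero]
  rw [← ENNReal.ofReal_mul (by positivity)]

lemma lintegral_mul_lintegral_quadrant {g : ℝ × ℝ → ℝ} (hg : Measurable g) (h0 : ∀ p, 0 ≤ g p) :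
    ∫⁻ x in Ioi (0 : ℝ), ∫⁻ y in Ioi (0 : ℝ), ∫⁻ z in Ioi (0 : ℝ), ∫⁻ w in Ioi (0 : ℝ),
      ENNReal.ofReal (g (x, y) * g (z, w)) =
    (∫⁻ x in Ioi (0 : ℝ), ∫⁻ y in Ioi (0 : ℝ), ENNReal.ofReal (g (x, y))) *
      ∫⁻ x in Ioi (0 : ℝ), ∫⁻ y in Ioi (0 : ℝ), ENNReal.ofReal (g (x, y)) := by
  simp only [ENNReal.ofReal_mul (h0 _), lintegral_const_mul' _ _ ENNReal.ofReal_ne_top]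
  rw [← lintegral_mul_const _ (measurable_setLIntegral (by fun_prop) _)]
  refine lintegral_congr fun x => ?_
  rw [lintegral_mul_const _ (by fun_prop)]

/-- This is the Gaussian integral of `√(x² + y²) √(z² + w²)` over the positive orthant in spherical
coordinates, and that integral splits as the square of a planar one. -/
theorem tripleIntegral_disjoint :
    (∫ _θ in (0 : ℝ)..Real.pi / 2, ∫ φ in (0 : ℝ)..Real.pi / 2, ∫ ψ in (0 : ℝ)..Real.pi / 2,
      Real.sin φ * Real.sin ψ * √(Real.cos φ ^ 2 * Real.sin ψ ^ 2 + Real.cos ψ ^ 2)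
        * (1 / (2 * Real.pi ^ 2)) * Real.sin φ * Real.sin ψ ^ 2) = Real.pi / 128 := by
  have h := lintegral_orthant_gauss (f := fun p =>
    √(p.1 ^ 2 + p.2.1 ^ 2) * √(p.2.2.1 ^ 2 + p.2.2.2 ^ 2)) (by fun_prop) (fun r hr a b c d => by
      simp only [sqrt_sq_add_sq_smul hr]; ring)
  have hL : ∀ x y z w : ℝ, √(x ^ 2 + y ^ 2) * √(z ^ 2 + w ^ 2) *
      Real.exp (-(x ^ 2 + y ^ 2 + z ^ 2 + w ^ 2)) =
      (√(x ^ 2 + y ^ 2) * Real.exp (-(x ^ 2 + y ^ 2))) *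
        (√(z ^ 2 + w ^ 2) * Real.exp (-(z ^ 2 + w ^ 2))) := fun x y z w => by
    rw [show -(x ^ 2 + y ^ 2 + z ^ 2 + w ^ 2) = -(x ^ 2 + y ^ 2) + -(z ^ 2 + w ^ 2) by ring,
      Real.exp_add]
    ring
  simp only [hL] at h
  rw [lintegral_mul_lintegral_quadrant
    (g := fun p => √(p.1 ^ 2 + p.2 ^ 2) * Real.exp (-(p.1 ^ 2 + p.2 ^ 2))) (by fun_prop)
    (fun p => by positivity),
    lintegral_quadrant_norm_gauss, ← ENNReal.ofReal_mul (by positivity)] at h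
  have h3 := ofReal_integral_quarter_three (g := fun _ φ ψ =>
    Real.sin φ * Real.sin ψ * √(Real.cos φ ^ 2 * Real.sin ψ ^ 2 + Real.cos ψ ^ 2)
        * (1 / (2 * Real.pi ^ 2)) * Real.sin φ * Real.sin ψ ^ 2) (by fun_prop)
    (fun _ _ φ hφ ψ hψ => by
      have := sin_pos_quarter hφ
      have := sin_pos_quarter hψ
      positivity)
  have hk : ∀ θ ∈ quarter, ∀ φ ∈ quarter, ∀ ψ ∈ quarter, ENNReal.ofReal
      (Real.sin φ * Real.sin ψ * √(Real.cos φ ^ 2 * Real.sin ψ ^ 2 + Real.cos ψ ^ 2)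
        * (1 / (2 * Real.pi ^ 2)) * Real.sin φ * Real.sin ψ ^ 2) =
      ENNReal.ofReal (1 / (2 * Real.pi ^ 2)) * ENNReal.ofReal (Real.sin φ * Real.sin ψ ^ 2 *
        (√((Real.sin ψ * Real.sin φ * Real.cos θ) ^ 2 + (Real.sin ψ * Real.sin φ * Real.sin θ) ^ 2) *
        √((Real.sin ψ * Real.cos φ) ^ 2 + Real.cos ψ ^ 2))) := fun θ _ φ hφ ψ hψ => by
    have h1 := sin_pos_quarter hφ
    have h2 := sin_pos_quarter hψ
    have e : (Real.sin ψ * Real.sin φ * Real.cos θ) ^ 2 + (Real.sin ψ * Real.sin φ * Real.sin θ) ^ 2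
        = (Real.sin ψ * Real.sin φ) ^ 2 := by
      linear_combination (Real.sin ψ * Real.sin φ) ^ 2 * Real.sin_sq_add_cos_sq θ
    rw [← ENNReal.ofReal_mul (by positivity), e, Real.sqrt_sq (by positivity)]
    congr 1
    rw [show (Real.sin ψ * Real.cos φ) ^ 2 = Real.cos φ ^ 2 * Real.sin ψ ^ 2 by ring]
    ring
  rw [setLIntegral_congr_fun measurableSet_Ioo fun θ hθ =>
    setLIntegral_congr_fun measurableSet_Ioo fun φ hφ =>
    setLIntegral_congr_fun measurableSet_Ioo fun ψ hψ => hk θ hθ φ hφ ψ hψ] at h3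
  simp only [lintegral_const_mul' _ _ ENNReal.ofReal_ne_top] at h3
  rw [← h, ← ENNReal.ofReal_mul (by positivity), ENNReal.ofReal_eq_ofReal_iff
    (integral_quarter_nonneg fun _ _ => integral_quarter_nonneg fun φ hφ =>
      integral_quarter_nonneg fun ψ hψ => by
        have := sin_pos_quarter hφ
        have := sin_pos_quarter hψ
        positivity) (by positivity)] at h3
  rw [h3]
  have hp := Real.mul_self_sqrt Real.pi_pos.le
  have hpi := Real.pi_pos
  field_simp
  rw [Real.sq_sqrt hpi.le]
  ring

lemma lintegral_exp_neg_sq :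
    ∫⁻ x in Ioi (0 : ℝ), ENNReal.ofReal (Real.exp (-x ^ 2)) = ENNReal.ofReal (√Real.pi / 2) := by
  have h := lintegral_pow_mul_exp_neg_sq 0
  simp only [pow_zero, one_mul, Nat.cast_zero, zero_add, Real.Gamma_one_half_eq] at h
  exact h

/-- In Cartesian form the integrand `√(x² + y²) √(y² + w²)` does not involve `z`; integrating `z`
out leaves the three-dimensional integral behind `gaussTriple`. -/
theorem tripleIntegral_shared :
    (∫ θ in (0 : ℝ)..Real.pi / 2, ∫ φ in (0 : ℝ)..Real.pi / 2, ∫ ψ in (0 : ℝ)..Real.pi / 2,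
      Real.sin φ * Real.sin ψ
        * √(Real.sin θ ^ 2 * Real.sin φ ^ 2 * Real.sin ψ ^ 2 + Real.cos ψ ^ 2)
        * (1 / (2 * Real.pi ^ 2)) * Real.sin φ * Real.sin ψ ^ 2) =
      3 / (32 * Real.pi) * angleIntegral := by
  have h := lintegral_orthant_gauss (f := fun p =>
    √(p.1 ^ 2 + p.2.1 ^ 2) * √(p.2.1 ^ 2 + p.2.2.2 ^ 2)) (by fun_prop) (fun r hr a b c d => by
      simp only [sqrt_sq_add_sq_smul hr]; ring)
  have hL : ∀ x y z w : ℝ, ENNReal.ofReal (√(x ^ 2 + y ^ 2) * √(y ^ 2 + w ^ 2) *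
      Real.exp (-(x ^ 2 + y ^ 2 + z ^ 2 + w ^ 2))) =
      ENNReal.ofReal (Real.exp (-z ^ 2)) * ENNReal.ofReal (√(x ^ 2 + y ^ 2) * √(y ^ 2 + w ^ 2) *
      Real.exp (-(x ^ 2 + y ^ 2 + w ^ 2))) := fun x y z w => by
    rw [← ENNReal.ofReal_mul (by positivity),
      show -(x ^ 2 + y ^ 2 + z ^ 2 + w ^ 2) = -z ^ 2 + -(x ^ 2 + y ^ 2 + w ^ 2) by ring,
      Real.exp_add]
    congr 1
    ring
  simp only [hL, lintegral_const_mul' _ _ ENNReal.ofReal_ne_top] at h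
  have hm : ∀ x y : ℝ, ∫⁻ z in Ioi (0 : ℝ), ENNReal.ofReal (Real.exp (-z ^ 2)) *
      (∫⁻ w in Ioi (0 : ℝ), ENNReal.ofReal (√(x ^ 2 + y ^ 2) * √(y ^ 2 + w ^ 2) *
      Real.exp (-(x ^ 2 + y ^ 2 + w ^ 2)))) = ENNReal.ofReal (√Real.pi / 2) *
      ∫⁻ w in Ioi (0 : ℝ), ENNReal.ofReal (√(x ^ 2 + y ^ 2) * √(y ^ 2 + w ^ 2) *
      Real.exp (-(x ^ 2 + y ^ 2 + w ^ 2))) := fun x y => by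
    rw [lintegral_mul_const _ (by fun_prop), lintegral_exp_neg_sq]
  simp only [hm, lintegral_const_mul' _ _ ENNReal.ofReal_ne_top] at h
  rw [lintegral_octant_gauss, ← ENNReal.ofReal_mul (by positivity)] at h
  have h3 := ofReal_integral_quarter_three (g := fun θ φ ψ =>
    Real.sin φ * Real.sin ψ * √(Real.sin θ ^ 2 * Real.sin φ ^ 2 * Real.sin ψ ^ 2 + Real.cos ψ ^ 2)
        * (1 / (2 * Real.pi ^ 2)) * Real.sin φ * Real.sin ψ ^ 2) (by fun_prop)
    (fun _ _ φ hφ ψ hψ => by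
      have := sin_pos_quarter hφ
      have := sin_pos_quarter hψ
      positivity)
  have hk : ∀ θ ∈ quarter, ∀ φ ∈ quarter, ∀ ψ ∈ quarter, ENNReal.ofReal
      (Real.sin φ * Real.sin ψ *
        √(Real.sin θ ^ 2 * Real.sin φ ^ 2 * Real.sin ψ ^ 2 + Real.cos ψ ^ 2)
        * (1 / (2 * Real.pi ^ 2)) * Real.sin φ * Real.sin ψ ^ 2) =
      ENNReal.ofReal (1 / (2 * Real.pi ^ 2)) * ENNReal.ofReal (Real.sin φ * Real.sin ψ ^ 2 *
        (√((Real.sin ψ * Real.sin φ * Real.cos θ) ^ 2 + (Real.sin ψ * Real.sin φ * Real.sin θ) ^ 2) *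
        √((Real.sin ψ * Real.sin φ * Real.sin θ) ^ 2 + Real.cos ψ ^ 2))) := fun θ _ φ hφ ψ hψ => by
    have h1 := sin_pos_quarter hφ
    have h2 := sin_pos_quarter hψ
    have e : (Real.sin ψ * Real.sin φ * Real.cos θ) ^ 2 + (Real.sin ψ * Real.sin φ * Real.sin θ) ^ 2
        = (Real.sin ψ * Real.sin φ) ^ 2 := by
      linear_combination (Real.sin ψ * Real.sin φ) ^ 2 * Real.sin_sq_add_cos_sq θ
    rw [← ENNReal.ofReal_mul (by positivity), e, Real.sqrt_sq (by positivity)]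
    congr 1
    rw [show (Real.sin ψ * Real.sin φ * Real.sin θ) ^ 2 =
      Real.sin θ ^ 2 * Real.sin φ ^ 2 * Real.sin ψ ^ 2 by ring]
    ring
  rw [setLIntegral_congr_fun measurableSet_Ioo fun θ hθ =>
    setLIntegral_congr_fun measurableSet_Ioo fun φ hφ =>
    setLIntegral_congr_fun measurableSet_Ioo fun ψ hψ => hk θ hθ φ hφ ψ hψ] at h3
  simp only [lintegral_const_mul' _ _ ENNReal.ofReal_ne_top] at h3
  have hS := angleIntegral_nonneg
  rw [← h, ← ENNReal.ofReal_mul (by positivity), ENNReal.ofReal_eq_ofReal_iff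
    (integral_quarter_nonneg fun _ _ => integral_quarter_nonneg fun φ hφ =>
      integral_quarter_nonneg fun ψ hψ => by
        have := sin_pos_quarter hφ
        have := sin_pos_quarter hψ
        positivity) (by positivity)] at h3
  rw [h3]
  have hpi := Real.pi_pos
  field_simp
  rw [Real.sq_sqrt hpi.le]
  ring

/-! ### Changes of variables, a Landen-type identity and the square of `K`. -/

lemma setLIntegral_eq_of_bijOn {f f' : ℝ → ℝ} {s t : Set ℝ} (hs : MeasurableSet s)
    (hf' : ∀ x ∈ s, HasDerivAt f (f' x) x) (hbij : BijOn f s t) (g : ℝ → ENNReal) :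
    ∫⁻ y in t, g y = ∫⁻ x in s, ENNReal.ofReal |f' x| * g (f x) := by
  rw [← hbij.image_eq]
  exact lintegral_image_eq_lintegral_abs_deriv_mul hs (fun x hx => (hf' x hx).hasDerivWithinAt)
    hbij.injOn g

lemma bijOn_arctan : BijOn Real.arctan (Ioi 0) quarter := by
  refine InvOn.bijOn (f' := Real.tan) ⟨fun x _ => Real.tan_arctan x, fun x hx =>
    Real.arctan_tan (by linarith [hx.1, Real.pi_pos]) hx.2⟩
    (fun x hx => ⟨Real.arctan_pos.2 hx, Real.arctan_lt_pi_div_two x⟩)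
    (fun x hx => Real.tan_pos_of_pos_of_lt_pi_div_two hx.1 hx.2)

lemma lintegral_quarter_eq_arctan (g : ℝ → ENNReal) :
    ∫⁻ θ in quarter, g θ =
      ∫⁻ x in Ioi (0 : ℝ), ENNReal.ofReal (1 / (1 + x ^ 2)) * g (Real.arctan x) := by
  rw [setLIntegral_eq_of_bijOn measurableSet_Ioi (fun x _ => Real.hasDerivAt_arctan x) bijOn_arctan]
  refine lintegral_congr fun x => ?_
  rw [abs_of_pos (by positivity)]

lemma bijOn_mul_left {k : ℝ} (hk : 0 < k) : BijOn (fun x => k * x) (Ioi 0) (Ioi 0) := by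
  refine InvOn.bijOn (f' := fun x => k⁻¹ * x) ⟨fun x _ => ?_, fun x _ => ?_⟩
    (fun x hx => mul_pos hk hx) (fun x hx => mul_pos (inv_pos.2 hk) hx)
  · simp [hk.ne']
  · simp [hk.ne']

lemma lintegral_Ioi_scale {k : ℝ} (hk : 0 < k) (g : ℝ → ENNReal) :
    ∫⁻ x in Ioi (0 : ℝ), g x = ∫⁻ x in Ioi (0 : ℝ), ENNReal.ofReal k * g (k * x) := by
  rw [setLIntegral_eq_of_bijOn (f' := fun _ => k) measurableSet_Ioi
    (fun x _ => by simpa using (hasDerivAt_id x).const_mul k) (bijOn_mul_left hk)]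
  simp only [abs_of_pos hk]

lemma bijOn_exp : BijOn Real.exp univ (Ioi 0) :=
  InvOn.bijOn (f' := Real.log) ⟨fun x _ => Real.log_exp x, fun _ hx => Real.exp_log hx⟩
    (fun x _ => Real.exp_pos x) (fun _ _ => mem_univ _)

lemma lintegral_Ioi_eq_exp (g : ℝ → ENNReal) :
    ∫⁻ x in Ioi (0 : ℝ), g x = ∫⁻ s, ENNReal.ofReal (Real.exp s) * g (Real.exp s) := by
  rw [setLIntegral_eq_of_bijOn MeasurableSet.univ (fun x _ => Real.hasDerivAt_exp x) bijOn_exp,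
    setLIntegral_univ]
  simp only [Real.abs_exp]

lemma lintegral_eq_sinh (g : ℝ → ENNReal) :
    ∫⁻ y, g y = ∫⁻ s, ENNReal.ofReal (Real.cosh s) * g (Real.sinh s) := by
  have h : BijOn Real.sinh univ univ := bijOn_univ.2 Real.sinh_bijective
  rw [← setLIntegral_univ, setLIntegral_eq_of_bijOn MeasurableSet.univ
    (fun x _ => Real.hasDerivAt_sinh x) h, setLIntegral_univ]
  simp only [abs_of_pos (Real.cosh_pos _)]

/-- Reflection of an integral over the first quadrant of angles. -/
lemma lintegral_quarter_reflect (g : ℝ → ENNReal) :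
    ∫⁻ θ in quarter, g θ = ∫⁻ θ in quarter, g (Real.pi / 2 - θ) := by
  have h : BijOn (fun θ => Real.pi / 2 - θ) quarter quarter :=
    InvOn.bijOn (f' := fun θ => Real.pi / 2 - θ) ⟨fun x _ => by simp, fun x _ => by simp⟩
      (fun x hx => ⟨by linarith [hx.2], by linarith [hx.1]⟩)
      (fun x hx => ⟨by linarith [hx.2], by linarith [hx.1]⟩)
  rw [setLIntegral_eq_of_bijOn (f' := fun _ => -1) measurableSet_Ioo
    (fun x _ => by simpa using (hasDerivAt_id x).const_sub (Real.pi / 2)) h]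
  simp

lemma one_div_sqrt_eq_of_sq {a b c : ℝ} (ha : 0 ≤ a) (hb : 0 < b) (hc : 0 < c)
    (h : a ^ 2 * c = b) : a * (1 / √b) = 1 / √c := by
  have : √b = a * √c := by
    rw [← h, Real.sqrt_mul (by positivity), Real.sqrt_sq ha]
  have ha' : 0 < a := by
    rcases ha.lt_or_eq with h' | h'
    · exact h'
    · rw [← h'] at h; simp at h; linarith
  have := Real.sqrt_pos.2 hc
  rw [‹√b = _›]
  field_simp

/-- Both sides equal the integral over the line of `1 / √(e^{2s} + e^{-2s} + 2A)`: on the left put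
`tan θ = √(A + R) e^s`; on the right reflect, put `tan θ = y`, extend evenly and set `y = sinh s`.
-/
lemma landen_lintegral {A R : ℝ} (hA : 1 ≤ A) (hR : 0 ≤ R) (h : A ^ 2 = 1 + R ^ 2) :
    ∫⁻ θ in quarter, ENNReal.ofReal (1 / √(A + R * Real.cos (2 * θ))) =
      ∫⁻ θ in quarter, ENNReal.ofReal (1 / √(1 + (A - 1) / 2 * Real.sin θ ^ 2)) := by
  have hAR : 0 < A - R := by nlinarith
  set p := √(A + R) with hp
  have hp0 : 0 < p := Real.sqrt_pos.2 (by linarith)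
  have hp2 : p ^ 2 = A + R := Real.sq_sqrt (by linarith)
  have hL : ∫⁻ θ in quarter, ENNReal.ofReal (1 / √(A + R * Real.cos (2 * θ))) =
      ∫⁻ s, ENNReal.ofReal (1 / √(Real.exp s ^ 2 + (Real.exp s ^ 2)⁻¹ + 2 * A)) := by
    rw [lintegral_quarter_eq_arctan, lintegral_Ioi_scale hp0, lintegral_Ioi_eq_exp]
    refine lintegral_congr fun s => ?_
    set x := Real.exp s
    have hx : 0 < x := Real.exp_pos s
    rw [← ENNReal.ofReal_mul (by positivity), ← ENNReal.ofReal_mul hp0.le,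
      ← ENNReal.ofReal_mul hx.le]
    congr 1
    rw [Real.cos_two_mul, Real.cos_sq_arctan]
    -- The relation `A² - R² = 1` says `A - R = p⁻²`, which makes numerator and denominator
    -- symmetric in `p` and `x`.
    have e : A + R * (2 * (1 / (1 + (p * x) ^ 2)) - 1) = (p ^ 2 + x ^ 2) / (1 + p ^ 2 * x ^ 2) := by
      have : (A - R) * p ^ 2 = 1 := by rw [hp2]; linarith
      have h3 : 0 < 1 + (p * x) ^ 2 := by positivity
      rw [← mul_pow]
      field_simp
      linear_combination x ^ 2 * this - hp2
    rw [e, ← mul_assoc, ← mul_assoc]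
    refine one_div_sqrt_eq_of_sq (by positivity) (by positivity) (by positivity) ?_
    have e2 : 2 * A = p ^ 2 + (p ^ 2)⁻¹ := by
      rw [hp2]
      have : A + R ≠ 0 := by positivity
      field_simp; linarith
    rw [e2]
    field_simp
    ring
  have hM : ∫⁻ θ in quarter, ENNReal.ofReal (1 / √(1 + (A - 1) / 2 * Real.sin θ ^ 2)) =
      ∫⁻ s, ENNReal.ofReal (1 / √(Real.exp s ^ 2 + (Real.exp s ^ 2)⁻¹ + 2 * A)) := by
    rw [lintegral_quarter_reflect]
    simp only [Real.sin_pi_div_two_sub]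
    rw [lintegral_quarter_eq_arctan]
    have heven : ∫⁻ y : ℝ, ENNReal.ofReal (1 / (1 + y ^ 2)) *
        ENNReal.ofReal (1 / √(1 + (A - 1) / 2 * Real.cos (Real.arctan y) ^ 2)) =
        2 * ∫⁻ y in Ioi (0 : ℝ), ENNReal.ofReal (1 / (1 + y ^ 2)) *
        ENNReal.ofReal (1 / √(1 + (A - 1) / 2 * Real.cos (Real.arctan y) ^ 2)) :=
      lintegral_even fun y => by simp [Real.arctan_neg]
    have hsinh : ∫⁻ y : ℝ, ENNReal.ofReal (1 / (1 + y ^ 2)) *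
        ENNReal.ofReal (1 / √(1 + (A - 1) / 2 * Real.cos (Real.arctan y) ^ 2)) =
        2 * ∫⁻ s, ENNReal.ofReal (1 / √(Real.exp s ^ 2 + (Real.exp s ^ 2)⁻¹ + 2 * A)) := by
      rw [lintegral_eq_sinh, ← lintegral_const_mul' _ _ (by simp)]
      refine lintegral_congr fun s => ?_
      rw [← ENNReal.ofReal_mul (by positivity), ← ENNReal.ofReal_mul (Real.cosh_pos s).le,
        ← ENNReal.ofReal_ofNat, ← ENNReal.ofReal_mul (by norm_num)]
      congr 1
      have hc := Real.cosh_pos s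
      have hcs := Real.cosh_sq s
      rw [Real.cos_sq_arctan, add_comm 1 (Real.sinh s ^ 2), ← hcs, ← mul_assoc]
      have h1 : Real.cosh s * (1 / Real.cosh s ^ 2) = 2 * (1 / (2 * Real.cosh s)) := by field_simp
      rw [h1, mul_assoc]
      congr 1
      have hA1 : 0 ≤ (A - 1) / 2 := by linarith
      refine one_div_sqrt_eq_of_sq (by positivity) (by positivity) (by positivity) ?_
      have h2 : Real.exp s ^ 2 + (Real.exp s ^ 2)⁻¹ = 4 * Real.cosh s ^ 2 - 2 := by
        rw [Real.cosh_eq, Real.exp_neg]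
        have := Real.exp_pos s
        field_simp
        ring
      rw [h2]
      field_simp
      ring
    rw [heven] at hsinh
    exact (ENNReal.mul_right_inj (by simp) (by simp)).1 hsinh
  rw [hL, hM]

lemma ofReal_ellipticK {m : ℝ} (hm : 0 ≤ m) : ENNReal.ofReal (ellipticK (-m)) =
    ∫⁻ θ in quarter, ENNReal.ofReal (1 / √(1 + m * Real.sin θ ^ 2)) := by
  have h : ellipticK (-m) = ∫ θ in (0 : ℝ)..Real.pi / 2, 1 / √(1 + m * Real.sin θ ^ 2) := by
    unfold ellipticK
    simp only [neg_mul, sub_neg_eq_add]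
  rw [h, ofReal_integral_quarter _ fun _ _ => by positivity]
  exact continuous_const.div (by fun_prop) fun x => by positivity

lemma ellipticK_nonneg (m : ℝ) : 0 ≤ ellipticK m :=
  integral_quarter_nonneg fun _ _ => by positivity

lemma landen {A R : ℝ} (hA : 1 ≤ A) (hR : 0 ≤ R) (h : A ^ 2 = 1 + R ^ 2) :
    ∫ θ in (0 : ℝ)..Real.pi / 2, 1 / √(A + R * Real.cos (2 * θ)) = ellipticK (-((A - 1) / 2)) := by
  rw [← ENNReal.ofReal_eq_ofReal_iff (integral_quarter_nonneg fun _ _ => by positivity)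
    (ellipticK_nonneg _), ofReal_ellipticK (by linarith), ← landen_lintegral hA hR h,
    ofReal_integral_quarter _ fun _ _ => by positivity]
  have hAR : 0 < A - R := by nlinarith
  refine continuous_const.div (by fun_prop) fun x => (Real.sqrt_pos.2 ?_).ne'
  nlinarith [Real.neg_one_le_cos (2 * x)]

lemma integral_cos_two_pi {g : ℝ → ℝ} (hg : Continuous fun φ => g (Real.cos φ)) :
    ∫ φ in (0 : ℝ)..2 * Real.pi, g (Real.cos φ) =
      4 * ∫ θ in (0 : ℝ)..Real.pi / 2, (g (Real.cos (2 * θ))) := by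
  have h2 : ∫ θ in (0 : ℝ)..Real.pi / 2, (g (Real.cos (2 * θ))) =
      2⁻¹ * ∫ φ in (0 : ℝ)..Real.pi, g (Real.cos φ) := by
    rw [intervalIntegral.integral_comp_mul_left (fun φ => g (Real.cos φ)) (by norm_num)]
    simp only [mul_zero, smul_eq_mul]
    congr 2; ring
  have h1 : ∫ φ in Real.pi..2 * Real.pi, g (Real.cos φ) = ∫ φ in (0 : ℝ)..Real.pi, g (Real.cos φ) := by
    have := intervalIntegral.integral_comp_sub_left (a := 0) (b := Real.pi)
      (fun φ => g (Real.cos φ)) (2 * Real.pi)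
    simp only [Real.cos_two_pi_sub, sub_zero] at this
    rw [this]
    congr 1; ring
  rw [← intervalIntegral.integral_add_adjacent_intervals (b := Real.pi)
    (hg.intervalIntegrable _ _) (hg.intervalIntegrable _ _), h1, h2]
  ring

lemma exists_angle (B C : ℝ) :
    ∃ χ : ℝ, B = √(B ^ 2 + C ^ 2) * Real.cos χ ∧ C = √(B ^ 2 + C ^ 2) * Real.sin χ := by
  have h := Complex.norm_mul_cos_arg ⟨B, C⟩
  have h' := Complex.norm_mul_sin_arg ⟨B, C⟩
  have hn : ‖(⟨B, C⟩ : ℂ)‖ = √(B ^ 2 + C ^ 2) := by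
    rw [Complex.norm_def, Complex.normSq_mk]; congr 1; ring
  rw [hn] at h h'
  exact ⟨_, h.symm, h'.symm⟩

lemma lt_add_mul_cos {A R : ℝ} (hA : 1 ≤ A) (hR : 0 ≤ R) (h : A ^ 2 = 1 + R ^ 2) (x : ℝ) :
    0 < A + R * Real.cos x := by
  have hAR : 0 < A - R := by nlinarith
  nlinarith [Real.neg_one_le_cos x]

lemma integral_shift_two_pi {g : ℝ → ℝ} (hg : Function.Periodic g (2 * Real.pi)) (χ : ℝ) :
    ∫ φ in (0 : ℝ)..2 * Real.pi, g (φ + χ) = ∫ φ in (0 : ℝ)..2 * Real.pi, g φ := by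
  rw [intervalIntegral.integral_comp_add_right]
  have := hg.intervalIntegral_add_eq χ 0
  rw [zero_add] at this ⊢
  rw [← this, add_comm]

/-- Rotating `φ` makes `C` vanish, so the value depends only on `A`; up to a constant it is the
Legendre function of degree `-1/2` at `A`. -/
lemma integral_inv_sqrt_trig {A B C : ℝ} (hA : 1 ≤ A) (h : A ^ 2 = 1 + B ^ 2 + C ^ 2) :
    ∫ φ in (0 : ℝ)..2 * Real.pi, 1 / √(A + B * Real.cos φ + C * Real.sin φ) =
      4 * ellipticK (-((A - 1) / 2)) := by
  obtain ⟨χ, hB, hC⟩ := exists_angle B C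
  set R := √(B ^ 2 + C ^ 2)
  have hR : 0 ≤ R := Real.sqrt_nonneg _
  have hR2 : A ^ 2 = 1 + R ^ 2 := by rw [Real.sq_sqrt (by positivity)]; linarith
  have e : ∀ φ, A + B * Real.cos φ + C * Real.sin φ = A + R * Real.cos (φ + -χ) := fun φ => by
    rw [← sub_eq_add_neg, Real.cos_sub]; linear_combination Real.cos φ * hB + Real.sin φ * hC
  simp only [e]
  rw [integral_shift_two_pi (g := fun φ => 1 / √(A + R * Real.cos φ)) (fun φ => by simp),
    integral_cos_two_pi (g := fun c => 1 / √(A + R * c)), landen hA hR hR2]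
  exact continuous_const.div (by fun_prop)
    fun x => (Real.sqrt_pos.2 (lt_add_mul_cos hA hR hR2 x)).ne'

lemma intervalIntegral_swap {f : ℝ → ℝ → ℝ} (hf : Continuous fun p : ℝ × ℝ => f p.1 p.2)
    {a b c d : ℝ} (hab : a ≤ b) (hcd : c ≤ d) :
    ∫ x in a..b, ∫ y in c..d, f x y = ∫ y in c..d, ∫ x in a..b, f x y := by
  simp only [intervalIntegral.integral_of_le hab, intervalIntegral.integral_of_le hcd]
  refine integral_integral_swap ?_
  rw [Measure.prod_restrict, ← Measure.volume_eq_prod]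
  exact (hf.continuousOn.integrableOn_compact (isCompact_Icc.prod isCompact_Icc)).mono_set
    (prod_mono Ioc_subset_Icc_self Ioc_subset_Icc_self)

/-- The square of the complete elliptic integral as an integral of complete elliptic integrals. -/
theorem ellipticK_sq {m : ℝ} (hm : 0 ≤ m) : ellipticK (-m) ^ 2 =
    ∫ α in (0 : ℝ)..Real.pi / 2, ellipticK (-(4 * m * (1 + m) * Real.cos α ^ 2)) := by
  -- The point `(z, w)` on the hyperbola `z² - w² = 1` is chosen so that `(z - 1) / 2 = m`.
  set z := 1 + 2 * m with hz
  set w := √(4 * m * (1 + m)) with hw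
  have hw0 : 0 ≤ w := Real.sqrt_nonneg _
  have hw2 : w ^ 2 = 4 * m * (1 + m) := Real.sq_sqrt (by positivity)
  have hz1 : 1 ≤ z := by linarith
  have hzw : z ^ 2 = 1 + w ^ 2 := by rw [hw2, hz]; ring
  have hpos : ∀ x, 0 < z + w * Real.cos x := lt_add_mul_cos hz1 hw0 hzw
  have hK : ∫ φ in (0 : ℝ)..2 * Real.pi, 1 / √(z + w * Real.cos φ) = 4 * ellipticK (-m) := by
    have := integral_inv_sqrt_trig (B := w) (C := 0) hz1 (by linarith)
    simp only [zero_mul, add_zero] at this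
    rw [this]
    congr 3
    rw [hz]; ring
  have hA : ∀ α, 1 ≤ z ^ 2 + w ^ 2 * Real.cos α := fun α => by
    nlinarith [Real.neg_one_le_cos α, sq_nonneg w]
  have hABC : ∀ α, (z ^ 2 + w ^ 2 * Real.cos α) ^ 2 =
      1 + (z * w * (1 + Real.cos α)) ^ 2 + (-(w * Real.sin α)) ^ 2 := fun α => by
    have hs := Real.sin_sq_add_cos_sq α
    linear_combination (z ^ 2 - w ^ 2 * Real.cos α ^ 2 + 1) * hzw - w ^ 2 * hs
  -- The expression, a trigonometric polynomial in both angles, factors after a shift of `α` by an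
  -- angle `χ` depending on `φ`: the image of `φ` under the hyperbolic boost `(z, w)` acting on the
  -- circle.
  have hfac : ∀ φ, ∃ χ, ∀ α, z ^ 2 + w ^ 2 * Real.cos α + z * w * (1 + Real.cos α) * Real.cos φ +
      -(w * Real.sin α) * Real.sin φ = (z + w * Real.cos φ) * (z + w * Real.cos (α + χ)) := by
    intro φ
    obtain ⟨χ, h1, h2⟩ := exists_angle (w + z * Real.cos φ) (Real.sin φ)
    have hs := Real.sin_sq_add_cos_sq φ
    have hr : √((w + z * Real.cos φ) ^ 2 + Real.sin φ ^ 2) = z + w * Real.cos φ := by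
      rw [← Real.sqrt_sq (hpos φ).le]
      congr 1
      linear_combination (Real.cos φ ^ 2 - 1) * hzw + hs
    rw [hr] at h1 h2
    refine ⟨χ, fun α => ?_⟩
    rw [Real.cos_add]
    linear_combination w * Real.cos α * h1 - w * Real.sin α * h2
  have hposABC : ∀ φ α, 0 < z ^ 2 + w ^ 2 * Real.cos α + z * w * (1 + Real.cos α) * Real.cos φ +
      -(w * Real.sin α) * Real.sin φ := fun φ α => by
    obtain ⟨χ, h⟩ := hfac φ
    rw [h]
    exact mul_pos (hpos _) (hpos _)
  -- Integrating over `α` first absorbs the shift by periodicity, and the double integral becomes a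
  -- product of two equal single integrals.
  have hprod : (4 * ellipticK (-m)) ^ 2 = ∫ φ in (0 : ℝ)..2 * Real.pi, ∫ α in (0 : ℝ)..2 * Real.pi,
      1 / √(z ^ 2 + w ^ 2 * Real.cos α + z * w * (1 + Real.cos α) * Real.cos φ +
        -(w * Real.sin α) * Real.sin φ) := by
    have : ∀ φ, ∫ α in (0 : ℝ)..2 * Real.pi,
      1 / √(z ^ 2 + w ^ 2 * Real.cos α + z * w * (1 + Real.cos α) * Real.cos φ +
        -(w * Real.sin α) * Real.sin φ) = 1 / √(z + w * Real.cos φ) * (4 * ellipticK (-m)) := by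
      intro φ
      obtain ⟨χ, h⟩ := hfac φ
      simp only [h, Real.sqrt_mul (hpos φ).le]
      rw [← hK, ← integral_shift_two_pi (g := fun φ => 1 / √(z + w * Real.cos φ))
        (fun φ => by simp) χ, ← intervalIntegral.integral_const_mul]
      congr 1; ext α
      rw [one_div_mul_one_div]
    simp only [this]
    rw [intervalIntegral.integral_mul_const, hK, sq]
  -- Integrating over `φ` first instead gives, for each `α`, a single `K` by
  -- `integral_inv_sqrt_trig`.
  rw [intervalIntegral_swap _ (by positivity) (by positivity)] at hprod
  · have hin : ∀ α, ∫ φ in (0 : ℝ)..2 * Real.pi,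
      1 / √(z ^ 2 + w ^ 2 * Real.cos α + z * w * (1 + Real.cos α) * Real.cos φ +
        -(w * Real.sin α) * Real.sin φ) =
        4 * ellipticK (-(w ^ 2 * ((1 + Real.cos α) / 2))) := fun α => by
      rw [integral_inv_sqrt_trig (hA α) (hABC α)]
      congr 3
      linear_combination hzw / 2
    simp only [hin] at hprod
    have hcont : Continuous fun α => ellipticK (-(w ^ 2 * ((1 + Real.cos α) / 2))) := by
      unfold ellipticK
      refine continuous_integral_quarter (g := fun α θ =>
        1 / √(1 - -(w ^ 2 * ((1 + Real.cos α) / 2)) * Real.sin θ ^ 2)) ?_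
      refine continuous_const.div (by fun_prop) fun p => (Real.sqrt_pos.2 ?_).ne'
      have : 0 ≤ w ^ 2 * ((1 + Real.cos p.1) / 2) * Real.sin p.2 ^ 2 := by
        have := Real.neg_one_le_cos p.1
        have : 0 ≤ (1 + Real.cos p.1) / 2 := by linarith
        positivity
      linarith
    rw [intervalIntegral.integral_const_mul,
      integral_cos_two_pi (g := fun c => ellipticK (-(w ^ 2 * ((1 + c) / 2)))) hcont] at hprod
    have e : ∀ θ, w ^ 2 * ((1 + Real.cos (2 * θ)) / 2) = 4 * m * (1 + m) * Real.cos θ ^ 2 := by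
      intro θ
      rw [Real.cos_two_mul, hw2]; ring
    simp only [e] at hprod
    linarith
  · refine continuous_const.div (by fun_prop) fun p => (Real.sqrt_pos.2 (hposABC _ _)).ne'

/-! ### Double integrals over the two angles and their reduction by integration by parts. -/

/-- The elliptic radicand `1 - sin² ξ cos² θ`. -/
def radicand (ξ θ : ℝ) : ℝ := 1 - Real.sin ξ ^ 2 * Real.cos θ ^ 2

lemma one_sub_sin_sq_le_radicand (ξ θ : ℝ) : 1 - Real.sin ξ ^ 2 ≤ radicand ξ θ := by
  unfold radicand
  nlinarith [sq_nonneg (Real.sin ξ), sq_nonneg (Real.sin θ), Real.sin_sq_add_cos_sq θ]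

lemma one_sub_cos_sq_le_radicand (ξ θ : ℝ) : 1 - Real.cos θ ^ 2 ≤ radicand ξ θ := by
  unfold radicand
  nlinarith [sq_nonneg (Real.cos ξ), sq_nonneg (Real.cos θ), Real.sin_sq_add_cos_sq ξ]

lemma radicand_nonneg (ξ θ : ℝ) : 0 ≤ radicand ξ θ :=
  (sub_nonneg.2 (Real.sin_sq_le_one ξ)).trans (one_sub_sin_sq_le_radicand ξ θ)

lemma radicand_pos_left {ξ : ℝ} (hξ : ξ ∈ quarter) (θ : ℝ) : 0 < radicand ξ θ := by
  have := one_sub_sin_sq_le_radicand ξ θ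
  have := cos_pos_quarter hξ
  nlinarith [Real.sin_sq_add_cos_sq ξ]

lemma radicand_pos_right {θ : ℝ} (hθ : θ ∈ quarter) (ξ : ℝ) : 0 < radicand ξ θ := by
  have := one_sub_cos_sq_le_radicand ξ θ
  have := sin_pos_quarter hθ
  nlinarith [Real.sin_sq_add_cos_sq θ]

/-- At a zero of `g` the quotient is `0` by the convention for division, and the bound `|f / √g| ≤ C
√g` makes this the limit. -/
lemma continuous_div_sqrt {α : Type*} [TopologicalSpace α] {f g : α → ℝ} (hf : Continuous f)
    (hg : Continuous g) {C : ℝ} (h : ∀ x, |f x| ≤ C * g x) (hg0 : ∀ x, 0 ≤ g x) :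
    Continuous fun x => f x / √(g x) := by
  refine continuous_iff_continuousAt.2 fun x => ?_
  rcases eq_or_ne (g x) 0 with h0 | h0
  · have hfx : |f x / √(g x)| ≤ C * √(g x) ∧ f x / √(g x) = 0 := by simp [h0]
    rw [ContinuousAt, hfx.2]
    refine squeeze_zero_norm (a := fun y => C * √(g y)) (fun y => ?_) ?_
    · rw [Real.norm_eq_abs, abs_div, abs_of_nonneg (Real.sqrt_nonneg _)]
      rcases (Real.sqrt_nonneg (g y)).eq_or_lt with h' | h'
      · simp [← h']
      · rw [div_le_iff₀ h', mul_assoc, Real.mul_self_sqrt (hg0 y)]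
        exact h y
    · have : Continuous fun y => C * √(g y) := by fun_prop
      simpa [h0] using this.tendsto x
  · exact hf.continuousAt.div hg.sqrt.continuousAt (Real.sqrt_ne_zero'.2 ((hg0 x).lt_of_ne' h0))

/-- With `a = sin² ξ` and `b = cos² θ` the radicand is `1 - a b`, which on the angle square vanishes
only at the corner `a = b = 1`. It dominates both `1 - a` and `1 - b`, so any combination of these
two with bounded coefficients is admissible. -/
lemma continuous_div_sqrt_radicand {P Q : ℝ → ℝ → ℝ}
    (hP : Continuous fun p : ℝ × ℝ => P p.1 p.2) (hQ : Continuous fun p : ℝ × ℝ => Q p.1 p.2)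
    {C : ℝ} (hPC : ∀ a ∈ Icc (0 : ℝ) 1, ∀ b ∈ Icc (0 : ℝ) 1, |P a b| ≤ C)
    (hQC : ∀ a ∈ Icc (0 : ℝ) 1, ∀ b ∈ Icc (0 : ℝ) 1, |Q a b| ≤ C) :
    Continuous fun p : ℝ × ℝ =>
      ((1 - Real.sin p.2 ^ 2) * P (Real.sin p.2 ^ 2) (Real.cos p.1 ^ 2) +
        (1 - Real.cos p.1 ^ 2) * Q (Real.sin p.2 ^ 2) (Real.cos p.1 ^ 2)) /
        √(radicand p.2 p.1) := by
  have hc : Continuous fun p : ℝ × ℝ => (Real.sin p.2 ^ 2, Real.cos p.1 ^ 2) := by fun_prop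
  have hP' := hP.comp hc
  have hQ' := hQ.comp hc
  simp only [Function.comp_def] at hP' hQ'
  refine continuous_div_sqrt (C := 2 * C) (by fun_prop) (by unfold radicand; fun_prop)
    (fun p => ?_) fun p => radicand_nonneg _ _
  have ha : Real.sin p.2 ^ 2 ∈ Icc (0 : ℝ) 1 := ⟨sq_nonneg _, Real.sin_sq_le_one _⟩
  have hb : Real.cos p.1 ^ 2 ∈ Icc (0 : ℝ) 1 := ⟨sq_nonneg _, Real.cos_sq_le_one _⟩
  have h1 := one_sub_sin_sq_le_radicand p.2 p.1
  have h2 := one_sub_cos_sq_le_radicand p.2 p.1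
  have hP1 := hPC _ ha _ hb
  have hQ1 := hQC _ ha _ hb
  refine (abs_add_le _ _).trans ?_
  rw [abs_mul, abs_mul, abs_of_nonneg (sub_nonneg.2 ha.2), abs_of_nonneg (sub_nonneg.2 hb.2)]
  have h3 := mul_le_mul h1 hP1 (abs_nonneg _) (radicand_nonneg _ _)
  have h4 := mul_le_mul h2 hQ1 (abs_nonneg _) (radicand_nonneg _ _)
  linarith

/-- Double integrals over the square of angles, weighted by the inverse root of the radicand. -/
def radicandIntegral (N : ℝ → ℝ → ℝ) : ℝ :=
  ∫ θ in (0 : ℝ)..Real.pi / 2, ∫ ξ in (0 : ℝ)..Real.pi / 2,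
    N (Real.sin ξ ^ 2) (Real.cos θ ^ 2) / √(radicand ξ θ)

/-- Continuity of the integrand of `radicandIntegral`. -/
def Admissible (N : ℝ → ℝ → ℝ) : Prop :=
  Continuous fun p : ℝ × ℝ => N (Real.sin p.2 ^ 2) (Real.cos p.1 ^ 2) / √(radicand p.2 p.1)

lemma Admissible.continuous_left {N : ℝ → ℝ → ℝ} (hN : Admissible N) (θ : ℝ) :
    Continuous fun ξ => N (Real.sin ξ ^ 2) (Real.cos θ ^ 2) / √(radicand ξ θ) := by
  have hN' : Continuous fun p : ℝ × ℝ =>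
    N (Real.sin p.2 ^ 2) (Real.cos p.1 ^ 2) / √(radicand p.2 p.1) := hN
  exact Continuous.comp (f := fun ξ : ℝ => (θ, ξ)) hN' (by fun_prop)

lemma Admissible.continuous_right {N : ℝ → ℝ → ℝ} (hN : Admissible N) (ξ : ℝ) :
    Continuous fun θ => N (Real.sin ξ ^ 2) (Real.cos θ ^ 2) / √(radicand ξ θ) := by
  have hN' : Continuous fun p : ℝ × ℝ =>
    N (Real.sin p.2 ^ 2) (Real.cos p.1 ^ 2) / √(radicand p.2 p.1) := hN
  exact Continuous.comp (f := fun θ : ℝ => (θ, ξ)) hN' (by fun_prop)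

lemma Admissible.continuous_integral {N : ℝ → ℝ → ℝ} (hN : Admissible N) :
    Continuous fun θ => ∫ ξ in (0 : ℝ)..Real.pi / 2,
      N (Real.sin ξ ^ 2) (Real.cos θ ^ 2) / √(radicand ξ θ) :=
  continuous_integral_quarter
    (g := fun θ ξ => N (Real.sin ξ ^ 2) (Real.cos θ ^ 2) / √(radicand ξ θ)) hN

lemma Admissible.mul {N M : ℝ → ℝ → ℝ} (hN : Admissible N)
    (hM : Continuous fun p : ℝ × ℝ => M p.1 p.2) : Admissible fun a b => M a b * N a b := by
  have hc : Continuous fun p : ℝ × ℝ => (Real.sin p.2 ^ 2, Real.cos p.1 ^ 2) := by fun_prop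
  have hM' := hM.comp hc
  simp only [Function.comp_def] at hM'
  unfold Admissible at *
  simp only [mul_div_assoc]
  exact hM'.mul hN

lemma Admissible.add {N M : ℝ → ℝ → ℝ} (hN : Admissible N) (hM : Admissible M) :
    Admissible fun a b => N a b + M a b := by
  unfold Admissible at *
  simp only [add_div]
  exact hN.add hM

lemma radicandIntegral_add {N M : ℝ → ℝ → ℝ} (hN : Admissible N) (hM : Admissible M) :
    radicandIntegral (fun a b => N a b + M a b) = radicandIntegral N + radicandIntegral M := by
  unfold radicandIntegral
  rw [← intervalIntegral.integral_add
    (hN.continuous_integral.intervalIntegrable _ _)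
    (hM.continuous_integral.intervalIntegrable _ _)]
  congr 1; ext θ
  rw [← intervalIntegral.integral_add]
  · simp only [add_div]
  · exact (hN.continuous_left θ).intervalIntegrable _ _
  · exact (hM.continuous_left θ).intervalIntegrable _ _

lemma radicandIntegral_const_mul (c : ℝ) (N : ℝ → ℝ → ℝ) :
    radicandIntegral (fun a b => c * N a b) = c * radicandIntegral N := by
  unfold radicandIntegral
  simp only [mul_div_assoc, intervalIntegral.integral_const_mul]

lemma hasDerivAt_sqrt_radicand_left {ξ θ : ℝ} (h : 0 < radicand ξ θ) :
    HasDerivAt (fun ξ => √(radicand ξ θ))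
      (-(Real.sin ξ * Real.cos ξ * Real.cos θ ^ 2) / √(radicand ξ θ)) ξ := by
  have h1 : HasDerivAt (fun ξ => radicand ξ θ) (-(2 * Real.sin ξ * Real.cos ξ * Real.cos θ ^ 2)) ξ := by
    have := (((Real.hasDerivAt_sin ξ).pow 2).mul_const (Real.cos θ ^ 2)).const_sub 1
    unfold radicand
    refine this.congr_deriv ?_
    simp
  refine (h1.sqrt h.ne').congr_deriv ?_
  have := Real.sqrt_pos.2 h
  field_simp

lemma hasDerivAt_sqrt_radicand_right {ξ θ : ℝ} (h : 0 < radicand ξ θ) :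
    HasDerivAt (fun θ => √(radicand ξ θ))
      (Real.sin ξ ^ 2 * Real.sin θ * Real.cos θ / √(radicand ξ θ)) θ := by
  have h1 : HasDerivAt (fun θ => radicand ξ θ) (2 * Real.sin ξ ^ 2 * Real.sin θ * Real.cos θ) θ := by
    have := (((Real.hasDerivAt_cos θ).pow 2).const_mul (Real.sin ξ ^ 2)).const_sub 1
    unfold radicand
    refine this.congr_deriv ?_
    simp; ring
  refine (h1.sqrt h.ne').congr_deriv ?_
  have := Real.sqrt_pos.2 h
  field_simp

lemma integral_quarter_eq_zero {F f : ℝ → ℝ} (hF : Continuous F) (hf : Continuous f)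
    (h : ∀ x ∈ quarter, HasDerivAt F (f x) x) (h0 : F 0 = 0) (h1 : F (Real.pi / 2) = 0) :
    ∫ x in (0 : ℝ)..Real.pi / 2, f x = 0 := by
  rw [intervalIntegral.integral_eq_sub_of_hasDerivAt_of_le (by positivity) hF.continuousOn h
    (hf.intervalIntegrable _ _), h0, h1, sub_zero]

lemma admissible_of_eq {N P Q : ℝ → ℝ → ℝ}
    (hP : Continuous fun p : ℝ × ℝ => P p.1 p.2) (hQ : Continuous fun p : ℝ × ℝ => Q p.1 p.2)
    {C : ℝ} (hPC : ∀ a ∈ Icc (0 : ℝ) 1, ∀ b ∈ Icc (0 : ℝ) 1, |P a b| ≤ C)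
    (hQC : ∀ a ∈ Icc (0 : ℝ) 1, ∀ b ∈ Icc (0 : ℝ) 1, |Q a b| ≤ C)
    (h : ∀ a b, N a b = (1 - a) * P a b + (1 - b) * Q a b) : Admissible N := by
  unfold Admissible
  simp only [h]
  exact continuous_div_sqrt_radicand hP hQ hPC hQC

lemma admissible_sin_cos :
    Admissible fun a b => 1 - 2 * a - 2 * a * b + 3 * a ^ 2 * b :=
  admissible_of_eq (P := fun a _ => 1 - 3 * a) (Q := fun a _ => a * (2 - 3 * a)) (C := 2)
    (by fun_prop) (by fun_prop)
    (fun a ha b hb => by obtain ⟨h1, h2⟩ := ha; rw [abs_le]; constructor <;> nlinarith)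
    (fun a ha b hb => by obtain ⟨h1, h2⟩ := ha; rw [abs_le]; constructor <;> nlinarith)
    (fun a b => by ring)

lemma admissible_right :
    Admissible fun a b => -1 + 2 * b + 2 * a * b - 3 * a * b ^ 2 :=
  admissible_of_eq (P := fun _ b => b * (3 * b - 2)) (Q := fun _ b => -(1 - 3 * b)) (C := 2)
    (by fun_prop) (by fun_prop)
    (fun a ha b hb => by obtain ⟨h1, h2⟩ := hb; rw [abs_le]; constructor <;> nlinarith)
    (fun a ha b hb => by obtain ⟨h1, h2⟩ := hb; rw [abs_le]; constructor <;> nlinarith)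
    (fun a b => by ring)

lemma admissible_sin_cube_cos :
    Admissible fun a b => 3 * a - 4 * a ^ 2 - 4 * a ^ 2 * b + 5 * a ^ 3 * b :=
  admissible_of_eq (P := fun a _ => a * (3 - 5 * a)) (Q := fun a _ => a * (a * (4 - 5 * a))) (C := 2)
    (by fun_prop) (by fun_prop)
    (fun a ha b hb => by obtain ⟨h1, h2⟩ := ha; rw [abs_le]; constructor <;> nlinarith)
    (fun a ha b hb => by
      obtain ⟨h1, h2⟩ := ha
      have h3 : |a * (4 - 5 * a)| ≤ 2 := by rw [abs_le]; constructor <;> nlinarith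
      rw [abs_mul, abs_of_nonneg h1]
      nlinarith [abs_nonneg (a * (4 - 5 * a))])
    (fun a b => by ring)

lemma admissible_one_sub_pow (j : ℕ) : Admissible fun a _ => (1 - a) ^ (j + 1) :=
  admissible_of_eq (P := fun a _ => (1 - a) ^ j) (Q := fun _ _ => 0) (C := 1)
    (by fun_prop) (by fun_prop)
    (fun a ha b hb => by
      rw [abs_pow, abs_of_nonneg (sub_nonneg.2 ha.2)]
      exact pow_le_one₀ (sub_nonneg.2 ha.2) (by linarith [ha.1]))
    (fun a ha b hb => by simp)
    (fun a b => by ring)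

lemma continuous_sqrt_radicand_left (θ : ℝ) : Continuous fun ξ => √(radicand ξ θ) := by
  unfold radicand; fun_prop

lemma continuous_sqrt_radicand_right (ξ : ℝ) : Continuous fun θ => √(radicand ξ θ) := by
  unfold radicand; fun_prop

/-- The integrand is the `ξ`-derivative of `sin ξ cos ξ √(1 - sin² ξ cos² θ)`, which vanishes at
both ends. -/
lemma radicandIntegral_sin_cos : radicandIntegral
    (fun a b => 1 - 2 * a - 2 * a * b + 3 * a ^ 2 * b) = 0 := by
  unfold radicandIntegral
  have : ∀ θ, ∫ ξ in (0 : ℝ)..Real.pi / 2, (1 - 2 * Real.sin ξ ^ 2 - 2 * Real.sin ξ ^ 2 *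
      Real.cos θ ^ 2 + 3 * (Real.sin ξ ^ 2) ^ 2 * Real.cos θ ^ 2) / √(radicand ξ θ) = 0 := by
    intro θ
    have hc := continuous_sqrt_radicand_left θ
    refine integral_quarter_eq_zero (F := fun ξ => Real.sin ξ * Real.cos ξ * √(radicand ξ θ))
      (by fun_prop) (admissible_sin_cos.continuous_left θ) (fun ξ hξ => ?_) (by simp) (by simp)
    have hr := radicand_pos_left hξ θ
    refine (((Real.hasDerivAt_sin ξ).mul (Real.hasDerivAt_cos ξ)).mul
      (hasDerivAt_sqrt_radicand_left hr)).congr_deriv ?_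
    have hs := Real.sqrt_pos.2 hr
    rw [eq_div_iff hs.ne', add_mul, mul_assoc, Real.mul_self_sqrt hr.le, mul_assoc,
      div_mul_cancel₀ _ hs.ne']
    have := Real.cos_sq' ξ
    unfold radicand
    simp only [Pi.mul_apply]
    linear_combination (1 - 2 * Real.sin ξ ^ 2 * Real.cos θ ^ 2) * this
  simp only [this, intervalIntegral.integral_zero]

/-- Here the vanishing primitive in `ξ` is `sin³ ξ cos ξ √(1 - sin² ξ cos² θ)`; a factor depending
only on `θ` passes through the inner integral. -/
lemma radicandIntegral_sin_cube_cos {M : ℝ → ℝ} : radicandIntegral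
    (fun a b => M b * (3 * a - 4 * a ^ 2 - 4 * a ^ 2 * b + 5 * a ^ 3 * b)) = 0 := by
  unfold radicandIntegral
  have : ∀ θ, ∫ ξ in (0 : ℝ)..Real.pi / 2, (3 * Real.sin ξ ^ 2 - 4 * (Real.sin ξ ^ 2) ^ 2 -
      4 * (Real.sin ξ ^ 2) ^ 2 * Real.cos θ ^ 2 + 5 * (Real.sin ξ ^ 2) ^ 3 * Real.cos θ ^ 2) /
      √(radicand ξ θ) = 0 := by
    intro θ
    have hc := continuous_sqrt_radicand_left θ
    refine integral_quarter_eq_zero (F := fun ξ => Real.sin ξ ^ 3 * Real.cos ξ * √(radicand ξ θ))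
      (by fun_prop) (admissible_sin_cube_cos.continuous_left θ) (fun ξ hξ => ?_) (by simp) (by simp)
    have hr := radicand_pos_left hξ θ
    refine ((((Real.hasDerivAt_sin ξ).pow 3).mul (Real.hasDerivAt_cos ξ)).mul
      (hasDerivAt_sqrt_radicand_left hr)).congr_deriv ?_
    have hs := Real.sqrt_pos.2 hr
    rw [eq_div_iff hs.ne', add_mul, mul_assoc _ _ √(radicand ξ θ), Real.mul_self_sqrt hr.le,
      mul_assoc _ _ √(radicand ξ θ), div_mul_cancel₀ _ hs.ne']
    have := Real.cos_sq' ξ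
    unfold radicand
    simp only [Pi.mul_apply, Pi.pow_apply]
    norm_num
    linear_combination (3 * Real.sin ξ ^ 2 - 4 * Real.sin ξ ^ 4 * Real.cos θ ^ 2) * this
  simp only [mul_div_assoc, intervalIntegral.integral_const_mul, this, mul_zero,
    intervalIntegral.integral_zero]

/-- The same argument in the other angle, with primitive `sin θ cos θ √(1 - sin² ξ cos² θ)`; the
order of integration is exchanged so that the factor `M`, depending only on `ξ`, is constant. -/
lemma radicandIntegral_right {M : ℝ → ℝ} (hM : Continuous M) : radicandIntegral
    (fun a b => M a * (-1 + 2 * b + 2 * a * b - 3 * a * b ^ 2)) = 0 := by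
  unfold radicandIntegral
  have hadm := admissible_right.mul (M := fun a _ => M a) (by fun_prop)
  rw [intervalIntegral_swap (f := fun θ ξ => M (Real.sin ξ ^ 2) * (-1 + 2 * Real.cos θ ^ 2 +
    2 * Real.sin ξ ^ 2 * Real.cos θ ^ 2 - 3 * Real.sin ξ ^ 2 * (Real.cos θ ^ 2) ^ 2) /
    √(radicand ξ θ)) hadm (by positivity) (by positivity)]
  have : ∀ ξ, ∫ θ in (0 : ℝ)..Real.pi / 2, (-1 + 2 * Real.cos θ ^ 2 + 2 * Real.sin ξ ^ 2 *
      Real.cos θ ^ 2 - 3 * Real.sin ξ ^ 2 * (Real.cos θ ^ 2) ^ 2) / √(radicand ξ θ) = 0 := by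
    intro ξ
    have hc := continuous_sqrt_radicand_right ξ
    refine integral_quarter_eq_zero (F := fun θ => Real.sin θ * Real.cos θ * √(radicand ξ θ))
      (by fun_prop) (admissible_right.continuous_right ξ) (fun θ hθ => ?_) (by simp) (by simp)
    have hr := radicand_pos_right hθ ξ
    refine (((Real.hasDerivAt_sin θ).mul (Real.hasDerivAt_cos θ)).mul
      (hasDerivAt_sqrt_radicand_right hr)).congr_deriv ?_
    have hs := Real.sqrt_pos.2 hr
    rw [eq_div_iff hs.ne', add_mul, mul_assoc, Real.mul_self_sqrt hr.le, mul_assoc,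
      div_mul_cancel₀ _ hs.ne']
    have := Real.sin_sq θ
    unfold radicand
    simp only [Pi.mul_apply]
    linear_combination (2 * Real.sin ξ ^ 2 * Real.cos θ ^ 2 - 1) * this
  simp only [mul_div_assoc, intervalIntegral.integral_const_mul, this, mul_zero,
    intervalIntegral.integral_zero]

lemma angleIntegral_eq_radicandIntegral :
    angleIntegral = radicandIntegral fun a b => a * (1 - a * b) := by
  unfold angleIntegral radicandIntegral
  congr 1; ext θ; congr 1; ext ξ
  rw [mul_div_assoc]
  congr 1
  exact (Real.div_sqrt).symm

/-- Reduction of the double integral of the radical to double integrals of its inverse. -/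
theorem angleIntegral_eq : angleIntegral =
    5 * radicandIntegral (fun a _ => (1 - a) ^ 1) - 6 * radicandIntegral (fun a _ => (1 - a) ^ 2) := by
  have hA := admissible_one_sub_pow 0
  have hB := admissible_one_sub_pow 1
  have h1 := admissible_right.mul (M := fun a _ => -8 * a + 10 * a ^ 2) (by fun_prop)
  have h2 := admissible_sin_cube_cos.mul (M := fun _ b => -4 + 6 * b) (by fun_prop)
  rw [angleIntegral_eq_radicandIntegral]
  have hA' := hA.mul (M := fun _ _ => 5) (by fun_prop)
  have hB' := hB.mul (M := fun _ _ => -6) (by fun_prop)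
  -- The multipliers `-8a + 10a²` and `-4 + 6b` are chosen so that all monomials containing `b`
  -- cancel modulo exact terms, leaving a polynomial in `1 - a` without constant term.
  have e : (fun a b : ℝ => a * (1 - a * b)) = fun a b =>
      5 * (1 - a) ^ (0 + 1) + (-6 * (1 - a) ^ (1 + 1) +
      ((1 - 2 * a - 2 * a * b + 3 * a ^ 2 * b) +
      ((-8 * a + 10 * a ^ 2) * (-1 + 2 * b + 2 * a * b - 3 * a * b ^ 2) +
        (-4 + 6 * b) * (3 * a - 4 * a ^ 2 - 4 * a ^ 2 * b + 5 * a ^ 3 * b)))) := by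
    ext a b; ring
  have k1 := radicandIntegral_add h1 h2
  have a1 := h1.add h2
  have k2 := radicandIntegral_add admissible_sin_cos a1
  have a2 := admissible_sin_cos.add a1
  have k3 := radicandIntegral_add hB' a2
  have k4 := radicandIntegral_add hA' (hB'.add a2)
  rw [e, k4, k3, k2, k1, radicandIntegral_const_mul, radicandIntegral_const_mul,
    radicandIntegral_sin_cos, radicandIntegral_right (M := fun a => -8 * a + 10 * a ^ 2) (by fun_prop),
    radicandIntegral_sin_cube_cos (M := fun b => -4 + 6 * b)]
  ring

/-! ### Weighted integrals of the square of `K`. -/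

lemma ofReal_ellipticK_sq {m : ℝ} (hm : 0 ≤ m) : ENNReal.ofReal (ellipticK (-m) ^ 2) =
    ∫⁻ α in quarter, ∫⁻ θ in quarter,
      ENNReal.ofReal (1 / √(1 + 4 * m * (1 + m) * Real.cos α ^ 2 * Real.sin θ ^ 2)) := by
  rw [ellipticK_sq hm, ofReal_integral_quarter _ fun _ _ => ellipticK_nonneg _]
  · refine lintegral_congr fun α => ?_
    rw [ofReal_ellipticK (by positivity)]
  · unfold ellipticK
    refine continuous_integral_quarter (g := fun α θ =>
      1 / √(1 - -(4 * m * (1 + m) * Real.cos α ^ 2) * Real.sin θ ^ 2)) ?_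
    refine continuous_const.div (by fun_prop) fun p => (Real.sqrt_pos.2 ?_).ne'
    rw [neg_mul, sub_neg_eq_add]
    positivity

/-- The substitution `4 m (1 + m) c = y²`. -/
lemma lintegral_Ioi_quadratic {c : ℝ} (hc : 0 < c) (g : ℝ → ENNReal) :
    ∫⁻ m in Ioi (0 : ℝ), g m = ∫⁻ y in Ioi (0 : ℝ),
      ENNReal.ofReal (y / (2 * c * √(1 + y ^ 2 / c))) * g ((√(1 + y ^ 2 / c) - 1) / 2) := by
  have hb : BijOn (fun y : ℝ => (√(1 + y ^ 2 / c) - 1) / 2) (Ioi 0) (Ioi 0) := by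
    refine InvOn.bijOn (f' := fun m => √(4 * m * (1 + m) * c)) ⟨fun y hy => ?_, fun m hm => ?_⟩
      (fun y hy => ?_) (fun m hm => ?_)
    · have hs : √(1 + y ^ 2 / c) ^ 2 = 1 + y ^ 2 / c := Real.sq_sqrt (by positivity)
      have e : 4 * ((√(1 + y ^ 2 / c) - 1) / 2) * (1 + (√(1 + y ^ 2 / c) - 1) / 2) * c = y ^ 2 := by
        have : 4 * ((√(1 + y ^ 2 / c) - 1) / 2) * (1 + (√(1 + y ^ 2 / c) - 1) / 2) * c =
          (√(1 + y ^ 2 / c) ^ 2 - 1) * c := by ring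
        rw [this, hs]
        field_simp; ring
      simp only [e]
      exact Real.sqrt_sq (le_of_lt hy)
    · have hm' : 0 < m := hm
      have e : 1 + √(4 * m * (1 + m) * c) ^ 2 / c = (1 + 2 * m) ^ 2 := by
        rw [Real.sq_sqrt (by positivity)]
        field_simp; ring
      simp only [e]
      rw [Real.sqrt_sq (by positivity)]
      ring
    · have hy' : 0 < y := hy
      have : 1 < √(1 + y ^ 2 / c) := by
        rw [Real.lt_sqrt (by norm_num)]
        have : 0 < y ^ 2 / c := by positivity
        linarith
      simp only [mem_Ioi]
      linarith
    · have hm' : 0 < m := hm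
      exact Real.sqrt_pos.2 (by positivity)
  rw [setLIntegral_eq_of_bijOn (f' := fun y => y / (2 * c * √(1 + y ^ 2 / c)))
    measurableSet_Ioi _ hb]
  · refine setLIntegral_congr_fun measurableSet_Ioi fun y hy => ?_
    have hy' : 0 < y := hy
    rw [abs_of_pos (by positivity)]
  · intro y _
    have h1 : HasDerivAt (fun y : ℝ => 1 + y ^ 2 / c) (2 * y / c) y := by
      have := (((hasDerivAt_id y).pow 2).div_const c).const_add 1
      refine this.congr_deriv ?_
      simp
    have hp : 0 < 1 + y ^ 2 / c := by positivity
    refine (((h1.sqrt hp.ne').sub_const 1).div_const 2).congr_deriv ?_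
    have := Real.sqrt_pos.2 hp
    field_simp

/-- Under `y² = 4 m (1 + m) c` one has `(1 + 2m)² = 1 + y² / c`. The Jacobian contributes one more
power of `1 + 2m`, so an odd exponent in the weight becomes an even one, and the dependence on `c`
becomes rational. -/
lemma lintegral_Ioi_weighted_inv_sqrt {c b : ℝ} (hc : 0 < c) (hb : 0 ≤ b) (j : ℕ) :
    ∫⁻ m in Ioi (0 : ℝ), ENNReal.ofReal (1 / (1 + 2 * m) ^ (2 * j + 1)) *
      ENNReal.ofReal (1 / √(1 + 4 * m * (1 + m) * c * b)) =
    ∫⁻ y in Ioi (0 : ℝ), ENNReal.ofReal (y / 2 / √(1 + y ^ 2 * b)) *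
      ENNReal.ofReal (c ^ j / (c + y ^ 2) ^ (j + 1)) := by
  rw [lintegral_Ioi_quadratic hc]
  refine setLIntegral_congr_fun measurableSet_Ioi fun y hy => ?_
  have hy' : 0 < y := hy
  have hs : √(1 + y ^ 2 / c) ^ 2 = 1 + y ^ 2 / c := Real.sq_sqrt (by positivity)
  have hp := Real.sqrt_pos.2 (by positivity : 0 < 1 + y ^ 2 / c)
  set z := √(1 + y ^ 2 / c) with hz
  have e1 : 1 + 2 * ((z - 1) / 2) = z := by ring
  have e2 : 1 + 4 * ((z - 1) / 2) * (1 + (z - 1) / 2) * c * b = 1 + y ^ 2 * b := by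
    have : 1 + 4 * ((z - 1) / 2) * (1 + (z - 1) / 2) * c * b = 1 + (z ^ 2 - 1) * c * b := by ring
    rw [this, hs]
    field_simp; ring
  rw [e1, e2, ← ENNReal.ofReal_mul (by positivity), ← ENNReal.ofReal_mul (by positivity),
    ← ENNReal.ofReal_mul (by positivity)]
  congr 1
  have e3 : c + y ^ 2 = c * z ^ 2 := by rw [hs]; field_simp
  have hq := Real.sqrt_pos.2 (by positivity : 0 < 1 + y ^ 2 * b)
  rw [e3, mul_pow]
  field_simp
  ring

/-- The integral of `1 / (1 + s²) ^ (j + 1)` over the half-line. -/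
def wallis (j : ℕ) : ENNReal := ∫⁻ s in Ioi (0 : ℝ), ENNReal.ofReal (1 / (1 + s ^ 2) ^ (j + 1))

lemma wallis_eq (j : ℕ) :
    wallis j = ENNReal.ofReal (∫ α in (0 : ℝ)..Real.pi / 2, Real.cos α ^ (2 * j)) := by
  rw [ofReal_integral_quarter (by fun_prop) fun x _ => by rw [pow_mul]; positivity,
    lintegral_quarter_eq_arctan, wallis]
  refine lintegral_congr fun s => ?_
  rw [pow_mul, Real.cos_sq_arctan, ← ENNReal.ofReal_mul (by positivity), div_pow, one_pow,
    one_div_mul_one_div, pow_succ']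

lemma wallis_ne_top (j : ℕ) : wallis j ≠ ⊤ := by
  rw [wallis_eq]; exact ENNReal.ofReal_ne_top

lemma wallis_one : wallis 1 = ENNReal.ofReal (Real.pi / 4) := by
  rw [wallis_eq, mul_one, integral_cos_sq]
  simp; congr 1; ring

lemma wallis_two : wallis 2 = ENNReal.ofReal (3 * Real.pi / 16) := by
  rw [wallis_eq, show 2 * 2 = 2 + 2 by rfl, integral_cos_pow, integral_cos_sq]
  simp; congr 1; ring

/-- The substitution `tan α = (√(1 + y²) / y) s` makes `cos² α + y²` proportional to `(1 + s²) / (1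
+ tan² α)`, so the integral separates into a function of `y` and a Wallis integral. -/
lemma lintegral_quarter_rational {y : ℝ} (hy : 0 < y) (j : ℕ) :
    ∫⁻ α in quarter, ENNReal.ofReal
      ((Real.cos α ^ 2) ^ j / (Real.cos α ^ 2 + y ^ 2) ^ (j + 1)) =
      ENNReal.ofReal (√(1 + y ^ 2) / (y * (1 + y ^ 2) ^ (j + 1))) * wallis j := by
  have hp := Real.sqrt_pos.2 (by positivity : 0 < 1 + y ^ 2)
  have hs : √(1 + y ^ 2) ^ 2 = 1 + y ^ 2 := Real.sq_sqrt (by positivity)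
  rw [lintegral_quarter_eq_arctan, lintegral_Ioi_scale (div_pos hp hy), wallis,
    ← lintegral_const_mul' _ _ ENNReal.ofReal_ne_top]
  refine lintegral_congr fun s => ?_
  rw [Real.cos_sq_arctan, ← ENNReal.ofReal_mul (by positivity), ← ENNReal.ofReal_mul (by positivity),
    ← ENNReal.ofReal_mul (by positivity)]
  congr 1
  set w := √(1 + y ^ 2)
  set u := w / y * s with hu
  have e : 1 / (1 + u ^ 2) + y ^ 2 = (1 + y ^ 2) * (1 + s ^ 2) / (1 + u ^ 2) := by
    have h1 : y ^ 2 * u ^ 2 = (1 + y ^ 2) * s ^ 2 := by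
      rw [hu, ← hs]; field_simp
    have : 0 < 1 + u ^ 2 := by positivity
    field_simp
    linear_combination h1
  have : 0 < 1 + u ^ 2 := by positivity
  clear_value u
  rw [e, div_pow, div_pow, one_pow, mul_pow]
  field_simp
  exact pow_succ' _ _

/-- Expanding `K²` by `ellipticK_sq` gives a triple integral over `m`, `α`, `θ`. The variable `m` is
replaced by `y` with `y² = 4 m (1 + m) cos² α`, the `α`-integral is then elementary, and `y = tan ξ`
gives the integral over two angles. -/
lemma lintegral_ellipticK_sq_weighted (j : ℕ) :
    ∫⁻ m in Ioi (0 : ℝ), ENNReal.ofReal (ellipticK (-m) ^ 2 / (1 + 2 * m) ^ (2 * j + 1)) =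
      ENNReal.ofReal (1 / 2) * wallis j * ∫⁻ θ in quarter, ∫⁻ ξ in quarter,
        ENNReal.ofReal ((1 - Real.sin ξ ^ 2) ^ j / √(radicand ξ θ)) := by
  have step1 : ∫⁻ m in Ioi (0 : ℝ), ENNReal.ofReal (ellipticK (-m) ^ 2 / (1 + 2 * m) ^ (2 * j + 1)) =
      ∫⁻ m in Ioi (0 : ℝ), ∫⁻ α in quarter, ∫⁻ θ in quarter,
        ENNReal.ofReal (1 / (1 + 2 * m) ^ (2 * j + 1)) *
        ENNReal.ofReal (1 / √(1 + 4 * m * (1 + m) * Real.cos α ^ 2 * Real.sin θ ^ 2)) := by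
    refine setLIntegral_congr_fun measurableSet_Ioi fun m hm => ?_
    have hm' : 0 < m := hm
    rw [div_eq_mul_one_div, mul_comm, ENNReal.ofReal_mul (by positivity), ofReal_ellipticK_sq hm'.le,
      ← lintegral_const_mul' _ _ ENNReal.ofReal_ne_top]
    refine lintegral_congr fun α => ?_
    rw [lintegral_const_mul' _ _ ENNReal.ofReal_ne_top]
  rw [step1, setLIntegral_swap (measurable_setLIntegral (by fun_prop) _)]
  have step2 : ∀ α ∈ quarter, ∫⁻ m in Ioi (0 : ℝ), ∫⁻ θ in quarter,
        ENNReal.ofReal (1 / (1 + 2 * m) ^ (2 * j + 1)) *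
        ENNReal.ofReal (1 / √(1 + 4 * m * (1 + m) * Real.cos α ^ 2 * Real.sin θ ^ 2)) =
      ∫⁻ θ in quarter, ∫⁻ y in Ioi (0 : ℝ),
        ENNReal.ofReal (y / 2 / √(1 + y ^ 2 * Real.sin θ ^ 2)) *
        ENNReal.ofReal ((Real.cos α ^ 2) ^ j / (Real.cos α ^ 2 + y ^ 2) ^ (j + 1)) := by
    intro α hα
    rw [setLIntegral_swap (by fun_prop)]
    refine lintegral_congr fun θ => ?_
    exact lintegral_Ioi_weighted_inv_sqrt (pow_pos (cos_pos_quarter hα) 2) (sq_nonneg _) j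
  rw [setLIntegral_congr_fun measurableSet_Ioo step2,
    setLIntegral_swap (measurable_setLIntegral (by fun_prop) _),
    ← lintegral_const_mul' _ _ (ENNReal.mul_ne_top ENNReal.ofReal_ne_top ?_)]
  · refine lintegral_congr fun θ => ?_
    -- The angle `ξ` on the right is written as `arctan y`, to match the remaining variable on the
    -- left after `α` is integrated out.
    rw [setLIntegral_swap (by fun_prop), lintegral_quarter_eq_arctan,
      ← lintegral_const_mul' _ _ (ENNReal.mul_ne_top ENNReal.ofReal_ne_top ?_)]
    · refine setLIntegral_congr_fun measurableSet_Ioi fun y hy => ?_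
      have hy' : 0 < y := hy
      rw [lintegral_const_mul' _ _ ENNReal.ofReal_ne_top, lintegral_quarter_rational hy',
        mul_assoc (ENNReal.ofReal (1 / 2)), mul_left_comm (ENNReal.ofReal (1 / 2)),
        ← mul_assoc, mul_comm _ (wallis j)]
      congr 1
      rw [← ENNReal.ofReal_mul (by positivity), ← ENNReal.ofReal_mul (by positivity),
        ← ENNReal.ofReal_mul (by positivity)]
      congr 1
      have e1 : 1 - Real.sin (Real.arctan y) ^ 2 = 1 / (1 + y ^ 2) := by
        rw [← Real.cos_sq', Real.cos_sq_arctan]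
      have e2 : radicand (Real.arctan y) θ = (1 + y ^ 2 * Real.sin θ ^ 2) / (1 + y ^ 2) := by
        have h1 : Real.sin (Real.arctan y) ^ 2 = 1 - 1 / (1 + y ^ 2) := by linarith
        unfold radicand
        rw [h1, Real.cos_sq']
        field_simp
        ring
      rw [e1, e2, Real.sqrt_div (by positivity)]
      have hp := Real.sqrt_pos.2 (by positivity : 0 < 1 + y ^ 2)
      have hq := Real.sqrt_pos.2 (by positivity : 0 < 1 + y ^ 2 * Real.sin θ ^ 2)
      rw [div_pow, one_pow]
      field_simp
      exact (pow_succ' _ _).symm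
    · exact wallis_ne_top j
  · exact wallis_ne_top j

lemma radicandIntegral_one_sub_pow_nonneg (j : ℕ) :
    0 ≤ radicandIntegral fun a _ => (1 - a) ^ j :=
  integral_quarter_nonneg fun _ _ => integral_quarter_nonneg fun _ _ =>
    div_nonneg (pow_nonneg (sub_nonneg.2 (Real.sin_sq_le_one _)) _) (Real.sqrt_nonneg _)

lemma ofReal_radicandIntegral (j : ℕ) :
    ENNReal.ofReal (radicandIntegral fun a _ => (1 - a) ^ (j + 1)) =
      ∫⁻ θ in quarter, ∫⁻ ξ in quarter,
        ENNReal.ofReal ((1 - Real.sin ξ ^ 2) ^ (j + 1) / √(radicand ξ θ)) :=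
  ofReal_integral_quarter_two (admissible_one_sub_pow j) fun _ _ _ _ =>
    div_nonneg (pow_nonneg (sub_nonneg.2 (Real.sin_sq_le_one _)) _) (Real.sqrt_nonneg _)

lemma lintegral_ellipticK_sq_div_cube :
    ∫⁻ m in Ioi (0 : ℝ), ENNReal.ofReal (ellipticK (-m) ^ 2 / (1 + 2 * m) ^ 3) =
      ENNReal.ofReal (Real.pi / 8 * radicandIntegral fun a _ => (1 - a) ^ 1) := by
  have := lintegral_ellipticK_sq_weighted 1
  rw [this, ← ofReal_radicandIntegral 0, wallis_one, ← ENNReal.ofReal_mul (by positivity),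
    ← ENNReal.ofReal_mul (by positivity)]
  congr 1; ring

lemma lintegral_ellipticK_sq_div_fifth :
    ∫⁻ m in Ioi (0 : ℝ), ENNReal.ofReal (ellipticK (-m) ^ 2 / (1 + 2 * m) ^ 5) =
      ENNReal.ofReal (3 * Real.pi / 32 * radicandIntegral fun a _ => (1 - a) ^ 2) := by
  have := lintegral_ellipticK_sq_weighted 2
  rw [this, ← ofReal_radicandIntegral 1, wallis_two, ← ENNReal.ofReal_mul (by positivity),
    ← ENNReal.ofReal_mul (by positivity)]
  congr 1; ring

/-! ### Derivatives of `E` and `K`. -/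

lemma one_le_one_add_mul_sin_sq {m : ℝ} (hm : 0 ≤ m) (θ : ℝ) : 1 ≤ 1 + m * Real.sin θ ^ 2 := by
  have : 0 ≤ m * Real.sin θ ^ 2 := by positivity
  linarith

lemma continuous_sqrt_one_add_mul_sin_sq (m : ℝ) :
    Continuous fun θ => √(1 + m * Real.sin θ ^ 2) := by fun_prop

lemma continuous_inv_sqrt_one_add_mul_sin_sq {m : ℝ} (hm : 0 ≤ m) (k : ℕ) :
    Continuous fun θ => 1 / √(1 + m * Real.sin θ ^ 2) ^ k :=
  continuous_const.div (by fun_prop) fun θ =>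
    (pow_pos (Real.sqrt_pos.2 (by linarith [one_le_one_add_mul_sin_sq hm θ])) k).ne'

lemma ellipticE_neg (m : ℝ) :
    ellipticE (-m) = ∫ θ in (0 : ℝ)..Real.pi / 2, √(1 + m * Real.sin θ ^ 2) := by
  simp only [ellipticE, neg_mul, sub_neg_eq_add]

lemma ellipticK_neg (m : ℝ) :
    ellipticK (-m) = ∫ θ in (0 : ℝ)..Real.pi / 2, 1 / √(1 + m * Real.sin θ ^ 2) := by
  simp only [ellipticK, neg_mul, sub_neg_eq_add]

/-- With `D = √(1 + m sin² θ)`, the function `D - (1 + m) / D ^ 3` is the derivative of `-m sin θ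
cos θ / D`, which vanishes at both ends. -/
lemma integral_inv_sqrt_cube {m : ℝ} (hm : 0 ≤ m) :
    ∫ θ in (0 : ℝ)..Real.pi / 2, 1 / √(1 + m * Real.sin θ ^ 2) ^ 3 =
      ellipticE (-m) / (1 + m) := by
  have hc1 := continuous_sqrt_one_add_mul_sin_sq m
  have hc3 := continuous_inv_sqrt_one_add_mul_sin_sq hm 3
  have hc' := continuous_inv_sqrt_one_add_mul_sin_sq hm 1
  have hpos : ∀ θ, 0 < √(1 + m * Real.sin θ ^ 2) := fun θ =>
    Real.sqrt_pos.2 (by linarith [one_le_one_add_mul_sin_sq hm θ])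
  have key : ∫ θ in (0 : ℝ)..Real.pi / 2, (√(1 + m * Real.sin θ ^ 2) -
      (1 + m) * (1 / √(1 + m * Real.sin θ ^ 2) ^ 3)) = 0 := by
    refine integral_quarter_eq_zero
      (F := fun θ => -m * (Real.sin θ * Real.cos θ * (1 / √(1 + m * Real.sin θ ^ 2) ^ 1)))
      (by fun_prop) (by fun_prop) (fun θ _ => ?_) (by simp) (by simp)
    have hp := hpos θ
    have hr : 0 < 1 + m * Real.sin θ ^ 2 := by linarith [one_le_one_add_mul_sin_sq hm θ]
    have hs : √(1 + m * Real.sin θ ^ 2) ^ 2 = 1 + m * Real.sin θ ^ 2 := Real.sq_sqrt hr.le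
    have h1 : HasDerivAt (fun θ => 1 + m * Real.sin θ ^ 2) (2 * m * Real.sin θ * Real.cos θ) θ := by
      refine ((((Real.hasDerivAt_sin θ).pow 2).const_mul m).const_add 1).congr_deriv ?_
      simp; ring
    have h2 := (h1.sqrt hr.ne').inv hp.ne'
    have h3 := ((((Real.hasDerivAt_sin θ).mul (Real.hasDerivAt_cos θ)).mul h2).const_mul (-m))
    simp only [pow_one, one_div]
    refine h3.congr_deriv ?_
    simp only [Pi.mul_apply, Pi.inv_apply]
    set D := √(1 + m * Real.sin θ ^ 2)
    have hc := Real.cos_sq' θ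
    field_simp
    have e : D ^ 4 = (1 + m * Real.sin θ ^ 2) ^ 2 := by rw [← hs]; ring
    rw [e, hs]
    linear_combination (-m * (1 + m * Real.sin θ ^ 2) + m ^ 2 * Real.sin θ ^ 2) * hc
  rw [intervalIntegral.integral_sub (hc1.intervalIntegrable _ _)
    ((hc3.const_mul _).intervalIntegrable _ _), intervalIntegral.integral_const_mul,
    ← ellipticE_neg] at key
  have : 0 < 1 + m := by linarith
  field_simp
  linarith

lemma hasDerivAt_ellipticE {m : ℝ} (hm : 0 < m) :
    HasDerivAt (fun m => ellipticE (-m)) ((ellipticE (-m) - ellipticK (-m)) / (2 * m)) m := by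
  have hpos : ∀ x ∈ Ioi (0 : ℝ), ∀ θ, 0 < √(1 + x * Real.sin θ ^ 2) := fun x hx θ =>
    Real.sqrt_pos.2 (by linarith [one_le_one_add_mul_sin_sq (le_of_lt hx) θ])
  have hF : ∀ x ∈ Ioi (0 : ℝ), Continuous fun θ => Real.sin θ ^ 2 / (2 * √(1 + x * Real.sin θ ^ 2)) :=
    fun x hx => by
      refine Continuous.div (by fun_prop) (by fun_prop) fun θ => ?_
      have := hpos x hx θ
      positivity
  have h := (intervalIntegral.hasDerivAt_integral_of_dominated_loc_of_deriv_le
    (F := fun m θ => √(1 + m * Real.sin θ ^ 2)) (a := 0) (b := Real.pi / 2) (μ := volume)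
    (F' := fun m θ => Real.sin θ ^ 2 / (2 * √(1 + m * Real.sin θ ^ 2))) (s := Ioi 0)
    (bound := fun _ => 1 / 2) (x₀ := m) (Ioi_mem_nhds hm)
    (Filter.Eventually.of_forall fun x => (by fun_prop : Continuous _).aestronglyMeasurable)
    ((by fun_prop : Continuous _).intervalIntegrable _ _)
    (hF m hm).aestronglyMeasurable
    (Filter.Eventually.of_forall fun θ _ x hx => ?_) (by simp)
    (Filter.Eventually.of_forall fun θ _ x hx => ?_)).2
  · simp only [ellipticE_neg]
    refine h.congr_deriv ?_
    -- With `D = √(1 + m sin² θ)` one has `m sin² θ = D² - 1`, so the differentiated integrand `sin²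
    -- θ / (2D)` is `(D - 1 / D) / (2m)`.
    rw [ellipticK_neg, ← intervalIntegral.integral_sub, ← intervalIntegral.integral_div]
    · congr 1; ext θ
      have hp := hpos m hm θ
      have hs : √(1 + m * Real.sin θ ^ 2) ^ 2 = 1 + m * Real.sin θ ^ 2 := Real.sq_sqrt (by positivity)
      generalize √(1 + m * Real.sin θ ^ 2) = D at hp hs ⊢
      field_simp
      linarith
    · exact (by fun_prop : Continuous _).intervalIntegrable _ _
    · simpa using (continuous_inv_sqrt_one_add_mul_sin_sq hm.le 1).intervalIntegrable _ _
  · have h1 : 1 ≤ √(1 + x * Real.sin θ ^ 2) :=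
      Real.one_le_sqrt.2 (one_le_one_add_mul_sin_sq (le_of_lt hx) θ)
    rw [Real.norm_eq_abs, abs_of_nonneg (by positivity), div_le_iff₀ (by positivity)]
    linarith [Real.sin_sq_le_one θ]
  · have hx' : 0 < x := hx
    have h1 : HasDerivAt (fun x : ℝ => 1 + x * Real.sin θ ^ 2) (Real.sin θ ^ 2) x := by
      simpa using ((hasDerivAt_id x).mul_const (Real.sin θ ^ 2)).const_add 1
    exact h1.sqrt (by positivity)

/-- Differentiation under the integral produces `(D⁻³ - D⁻¹) / (2m)` with `D = √(1 + m sin² θ)`; the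
integral of `D⁻³` is then expressed through `E`. -/
lemma hasDerivAt_ellipticK {m : ℝ} (hm : 0 < m) :
    HasDerivAt (fun m => ellipticK (-m))
      ((ellipticE (-m) - (1 + m) * ellipticK (-m)) / (2 * m * (1 + m))) m := by
  have hpos : ∀ x ∈ Ioi (0 : ℝ), ∀ θ, 0 < √(1 + x * Real.sin θ ^ 2) := fun x hx θ =>
    Real.sqrt_pos.2 (by linarith [one_le_one_add_mul_sin_sq (le_of_lt hx) θ])
  have hK : ∀ x ∈ Ioi (0 : ℝ), Continuous fun θ => 1 / √(1 + x * Real.sin θ ^ 2) := fun x hx => by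
    simpa using continuous_inv_sqrt_one_add_mul_sin_sq (le_of_lt hx) 1
  have h3 := continuous_inv_sqrt_one_add_mul_sin_sq hm.le 3
  have h := (intervalIntegral.hasDerivAt_integral_of_dominated_loc_of_deriv_le
    (F := fun m θ => 1 / √(1 + m * Real.sin θ ^ 2)) (a := 0) (b := Real.pi / 2) (μ := volume)
    (F' := fun m θ => -(Real.sin θ ^ 2 / 2 * (1 / √(1 + m * Real.sin θ ^ 2) ^ 3))) (s := Ioi 0)
    (bound := fun _ => 1 / 2) (x₀ := m) (Ioi_mem_nhds hm)
    ?_ ((hK m hm).intervalIntegrable _ _)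
    (by fun_prop : Continuous _).aestronglyMeasurable
    (Filter.Eventually.of_forall fun θ _ x hx => ?_) (by simp)
    (Filter.Eventually.of_forall fun θ _ x hx => ?_)).2
  · have e : (fun m => ellipticK (-m)) =
      fun m => ∫ θ in (0 : ℝ)..Real.pi / 2, 1 / √(1 + m * Real.sin θ ^ 2) := funext ellipticK_neg
    rw [e]
    refine h.congr_deriv ?_
    have e2 : (ellipticE (-m) - (1 + m) * ellipticK (-m)) / (2 * m * (1 + m)) =
        (ellipticE (-m) / (1 + m) - ellipticK (-m)) / (2 * m) := by
      field_simp
    rw [e2, ← integral_inv_sqrt_cube hm.le, ellipticK_neg, ← intervalIntegral.integral_sub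
      (h3.intervalIntegrable _ _) ((hK m hm).intervalIntegrable _ _), ← intervalIntegral.integral_div]
    congr 1; ext θ
    have hp := hpos m hm θ
    have hs : √(1 + m * Real.sin θ ^ 2) ^ 2 = 1 + m * Real.sin θ ^ 2 := Real.sq_sqrt (by positivity)
    generalize √(1 + m * Real.sin θ ^ 2) = D at hp hs ⊢
    field_simp
    linarith
  · filter_upwards [Ioi_mem_nhds hm] with x hx using (hK x hx).aestronglyMeasurable
  · have h1 : 1 ≤ √(1 + x * Real.sin θ ^ 2) :=
      Real.one_le_sqrt.2 (one_le_one_add_mul_sin_sq (le_of_lt hx) θ)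
    have h2 : 1 / √(1 + x * Real.sin θ ^ 2) ^ 3 ≤ 1 :=
      (div_le_one (by positivity)).2 (one_le_pow₀ h1)
    rw [norm_neg, Real.norm_eq_abs, abs_of_nonneg (by positivity)]
    have := Real.sin_sq_le_one θ
    nlinarith [sq_nonneg (Real.sin θ)]
  · have hx' : 0 < x := hx
    have h1 : HasDerivAt (fun x : ℝ => 1 + x * Real.sin θ ^ 2) (Real.sin θ ^ 2) x := by
      simpa using ((hasDerivAt_id x).mul_const (Real.sin θ ^ 2)).const_add 1
    have hp := hpos x hx θ
    have := (h1.sqrt (by positivity)).inv hp.ne'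
    simp only [one_div]
    refine this.congr_deriv ?_
    field_simp

/-! ### Bounds for `E` and `K` and absolute convergence. -/

lemma ellipticE_nonneg (m : ℝ) : 0 ≤ ellipticE m :=
  integral_quarter_nonneg fun _ _ => by positivity

lemma integral_quarter_le {g : ℝ → ℝ} (hg : Continuous g) {C : ℝ} (h : ∀ x, g x ≤ C) :
    ∫ x in (0 : ℝ)..Real.pi / 2, g x ≤ Real.pi / 2 * C := by
  have := intervalIntegral.integral_mono_on (μ := volume) (a := 0) (b := Real.pi / 2) (by positivity)
    (hg.intervalIntegrable _ _) ((continuous_const (y := C)).intervalIntegrable _ _) fun x _ => h x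
  simpa using this

lemma ellipticE_le {m : ℝ} (hm : 0 ≤ m) : ellipticE (-m) ≤ Real.pi / 2 * √(1 + m) := by
  rw [ellipticE_neg]
  refine integral_quarter_le (by fun_prop) fun θ => Real.sqrt_le_sqrt ?_
  nlinarith [Real.sin_sq_le_one θ]

lemma ellipticK_le {m : ℝ} (hm : 0 ≤ m) : ellipticK (-m) ≤ Real.pi / 2 := by
  rw [ellipticK_neg]
  refine (integral_quarter_le (C := 1) ?_ fun θ => ?_).trans_eq (mul_one _)
  · simpa using continuous_inv_sqrt_one_add_mul_sin_sq hm 1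
  · have := Real.one_le_sqrt.2 (one_le_one_add_mul_sin_sq hm θ)
    exact (div_le_one (by linarith)).2 this

lemma ellipticE_zero : ellipticE 0 = Real.pi / 2 := by simp [ellipticE]

lemma ellipticK_zero : ellipticK 0 = Real.pi / 2 := by simp [ellipticK]

lemma continuous_ellipticE_sq : Continuous fun t : ℝ => ellipticE (-t ^ 2) := by
  simp only [ellipticE_neg]
  exact continuous_integral_quarter (g := fun t θ => √(1 + t ^ 2 * Real.sin θ ^ 2)) (by fun_prop)

lemma continuous_ellipticK_sq : Continuous fun t : ℝ => ellipticK (-t ^ 2) := by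
  simp only [ellipticK_neg]
  refine continuous_integral_quarter (g := fun t θ => 1 / √(1 + t ^ 2 * Real.sin θ ^ 2)) ?_
  exact continuous_const.div (by fun_prop) fun p => by positivity

lemma ellipticE_sq_le (t : ℝ) : ellipticE (-t ^ 2) ^ 2 ≤ (Real.pi / 2) ^ 2 * (2 * t ^ 2 + 1) := by
  have h := ellipticE_le (sq_nonneg t)
  have h0 := ellipticE_nonneg (-t ^ 2)
  have := pow_le_pow_left₀ h0 h 2
  rw [mul_pow, Real.sq_sqrt (by positivity)] at this
  exact this.trans (mul_le_mul_of_nonneg_left (by nlinarith [sq_nonneg t]) (sq_nonneg _))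

lemma ellipticK_sq_le (t : ℝ) : ellipticK (-t ^ 2) ^ 2 ≤ (Real.pi / 2) ^ 2 :=
  pow_le_pow_left₀ (ellipticK_nonneg _) (ellipticK_le (sq_nonneg t)) 2

lemma ellipticE_mul_ellipticK_le (t : ℝ) :
    ellipticE (-t ^ 2) * ellipticK (-t ^ 2) ≤ (Real.pi / 2) ^ 2 * (2 * t ^ 2 + 1) := by
  have h1 := ellipticE_sq_le t
  have h2 := ellipticK_sq_le t
  nlinarith [sq_nonneg (ellipticE (-t ^ 2) - ellipticK (-t ^ 2)), sq_nonneg (Real.pi / 2),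
    mul_nonneg (sq_nonneg (Real.pi / 2)) (sq_nonneg t)]

/-- A bound for quadratic forms in the two elliptic integrals. -/
lemma abs_quadratic_elliptic_le {a b c C : ℝ} (t : ℝ) (ha : |a| ≤ C) (hb : |b| ≤ C) (hc : |c| ≤ C) :
    |a * ellipticE (-t ^ 2) ^ 2 + b * (ellipticE (-t ^ 2) * ellipticK (-t ^ 2)) +
      c * ellipticK (-t ^ 2) ^ 2| ≤ 3 * C * ((Real.pi / 2) ^ 2 * (2 * t ^ 2 + 1)) := by
  have h1 := ellipticE_sq_le t
  have h2 := ellipticE_mul_ellipticK_le t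
  have h3 : ellipticK (-t ^ 2) ^ 2 ≤ (Real.pi / 2) ^ 2 * (2 * t ^ 2 + 1) :=
    (ellipticK_sq_le t).trans (le_mul_of_one_le_right (sq_nonneg _) (by nlinarith [sq_nonneg t]))
  have hE := ellipticE_nonneg (-t ^ 2)
  have hK := ellipticK_nonneg (-t ^ 2)
  have hC : 0 ≤ C := (abs_nonneg a).trans ha
  have k1 : |a * ellipticE (-t ^ 2) ^ 2| ≤ C * ((Real.pi / 2) ^ 2 * (2 * t ^ 2 + 1)) := by
    rw [abs_mul, abs_of_nonneg (sq_nonneg (ellipticE _))]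
    exact mul_le_mul ha h1 (by positivity) hC
  have k2 : |b * (ellipticE (-t ^ 2) * ellipticK (-t ^ 2))| ≤
      C * ((Real.pi / 2) ^ 2 * (2 * t ^ 2 + 1)) := by
    rw [abs_mul, abs_of_nonneg (mul_nonneg hE hK)]
    exact mul_le_mul hb h2 (by positivity) hC
  have k3 : |c * ellipticK (-t ^ 2) ^ 2| ≤ C * ((Real.pi / 2) ^ 2 * (2 * t ^ 2 + 1)) := by
    rw [abs_mul, abs_of_nonneg (sq_nonneg (ellipticK _))]
    exact mul_le_mul hc h3 (by positivity) hC
  refine (abs_add_three _ _ _).trans ?_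
  linarith

lemma integrableOn_Ioi_of_abs_le {f : ℝ → ℝ} (hf : Continuous f) {C : ℝ}
    (h : ∀ t ∈ Ioi (0 : ℝ), |f t| ≤ C * (1 + t ^ 2)⁻¹) : IntegrableOn f (Ioi 0) := by
  refine Integrable.mono' (integrable_inv_one_add_sq.integrableOn.const_mul C)
    hf.aestronglyMeasurable ?_
  filter_upwards [ae_restrict_mem measurableSet_Ioi] with t ht using h t ht

lemma div_sq_le {t : ℝ} (ht : 0 < t) : t / (2 * t ^ 2 + 1) ^ 2 ≤ (1 + t ^ 2)⁻¹ := by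
  rw [div_le_iff₀ (by positivity), ← div_eq_inv_mul, le_div_iff₀ (by positivity)]
  nlinarith [sq_nonneg (t - 1), sq_nonneg (t ^ 2), sq_nonneg t, mul_pos ht ht]

theorem integrableOn_zetaFourIntegrand : IntegrableOn zetaFourIntegrand (Ioi 0) := by
  have hE := continuous_ellipticE_sq
  have hK := continuous_ellipticK_sq
  refine integrableOn_Ioi_of_abs_le (C := 3 * 8 * (Real.pi / 2) ^ 2) ?_ fun t ht => ?_
  · unfold zetaFourIntegrand
    refine (Continuous.div (by fun_prop) (by fun_prop) fun t => by positivity).mul continuous_id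
  · have ht' : 0 < t := ht
    have hz : 0 < 2 * t ^ 2 + 1 := by positivity
    have h2 := sq_nonneg t
    have h4 := sq_nonneg (t ^ 2)
    have hq := abs_quadratic_elliptic_le (a := 8 * t ^ 4 + 8 * t ^ 2 - 1)
      (b := -2 * (4 * t ^ 4 + 3 * t ^ 2 - 1)) (c := 2 * t ^ 4 + t ^ 2 - 1)
      (C := 8 * (2 * t ^ 2 + 1) ^ 2) t
      (by rw [abs_le]; constructor <;> nlinarith) (by rw [abs_le]; constructor <;> nlinarith)
      (by rw [abs_le]; constructor <;> nlinarith)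
    have e : zetaFourIntegrand t = ((8 * t ^ 4 + 8 * t ^ 2 - 1) * ellipticE (-t ^ 2) ^ 2 +
        -2 * (4 * t ^ 4 + 3 * t ^ 2 - 1) * (ellipticE (-t ^ 2) * ellipticK (-t ^ 2)) +
        (2 * t ^ 4 + t ^ 2 - 1) * ellipticK (-t ^ 2) ^ 2) * (t / (2 * t ^ 2 + 1) ^ 5) := by
      unfold zetaFourIntegrand; ring
    rw [e, abs_mul, abs_of_pos (by positivity : 0 < t / (2 * t ^ 2 + 1) ^ 5)]
    refine (mul_le_mul_of_nonneg_right hq (by positivity)).trans ?_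
    -- The quadratic form grows at most like `(2t² + 1) ^ 3`, so against the fifth power in the
    -- denominator an integrable `t / (2t² + 1) ^ 2` remains.
    have e2 : 3 * (8 * (2 * t ^ 2 + 1) ^ 2) * ((Real.pi / 2) ^ 2 * (2 * t ^ 2 + 1)) *
        (t / (2 * t ^ 2 + 1) ^ 5) = 3 * 8 * (Real.pi / 2) ^ 2 * (t / (2 * t ^ 2 + 1) ^ 2) := by
      field_simp
    rw [e2]
    exact mul_le_mul_of_nonneg_left (div_sq_le ht') (by positivity)

lemma integrableOn_ellipticK_sq_div (k : ℕ) :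
    IntegrableOn (fun t => ellipticK (-t ^ 2) ^ 2 / (2 * t ^ 2 + 1) ^ (k + 2) * t) (Ioi 0) := by
  have hK := continuous_ellipticK_sq
  refine integrableOn_Ioi_of_abs_le (C := (Real.pi / 2) ^ 2) ?_ fun t ht => ?_
  · exact (Continuous.div (by fun_prop) (by fun_prop) fun t => by positivity).mul continuous_id
  · have ht' : 0 < t := ht
    rw [abs_of_nonneg (by positivity), div_mul_eq_mul_div, mul_div_assoc]
    refine mul_le_mul (ellipticK_sq_le t) (le_trans ?_ (div_sq_le ht')) (by positivity) (sq_nonneg _)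
    gcongr
    · nlinarith [sq_nonneg t]
    · omega

lemma bijOn_sq : BijOn (fun t : ℝ => t ^ 2) (Ioi 0) (Ioi 0) :=
  InvOn.bijOn (f' := Real.sqrt) ⟨fun _ ht => Real.sqrt_sq (le_of_lt ht),
    fun _ hm => Real.sq_sqrt (le_of_lt hm)⟩ (fun _ ht => pow_pos (mem_Ioi.1 ht) 2)
    (fun _ hm => Real.sqrt_pos.2 hm)

/-- The substitution `m = t²`, which explains the factor `t` in the integrand and the `1 / 2`. -/
lemma ofReal_integral_ellipticK_sq_div (k : ℕ) :
    ENNReal.ofReal (∫ t in Ioi (0 : ℝ), ellipticK (-t ^ 2) ^ 2 / (2 * t ^ 2 + 1) ^ (k + 2) * t) =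
      ENNReal.ofReal (1 / 2) *
        ∫⁻ m in Ioi (0 : ℝ), ENNReal.ofReal (ellipticK (-m) ^ 2 / (1 + 2 * m) ^ (k + 2)) := by
  rw [ofReal_integral_eq_lintegral_ofReal (integrableOn_ellipticK_sq_div k),
    setLIntegral_eq_of_bijOn (f' := fun t => 2 * t) measurableSet_Ioi
      (fun t _ => by simpa using hasDerivAt_pow 2 t) bijOn_sq
      (fun m => ENNReal.ofReal (ellipticK (-m) ^ 2 / (1 + 2 * m) ^ (k + 2))),
    ← lintegral_const_mul' _ _ ENNReal.ofReal_ne_top]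
  · refine setLIntegral_congr_fun measurableSet_Ioi fun t ht => ?_
    have ht' : 0 < t := ht
    rw [← ENNReal.ofReal_mul (by positivity), ← ENNReal.ofReal_mul (by positivity),
      abs_of_pos (by positivity), add_comm 1]
    congr 1
    field_simp
  · filter_upwards [ae_restrict_mem measurableSet_Ioi] with t ht
    have ht' : 0 < t := ht
    simp only [Pi.zero_apply]
    positivity

lemma integral_ellipticK_sq_div_nonneg (k : ℕ) :
    0 ≤ ∫ t in Ioi (0 : ℝ), ellipticK (-t ^ 2) ^ 2 / (2 * t ^ 2 + 1) ^ (k + 2) * t :=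
  setIntegral_nonneg measurableSet_Ioi fun t ht => by
    have ht' : 0 < t := ht
    positivity

lemma integral_ellipticK_sq_div_cube :
    ∫ t in Ioi (0 : ℝ), ellipticK (-t ^ 2) ^ 2 / (2 * t ^ 2 + 1) ^ 3 * t =
      Real.pi / 16 * radicandIntegral fun a _ => (1 - a) ^ 1 := by
  have h := ofReal_integral_ellipticK_sq_div 1
  have h0 := radicandIntegral_one_sub_pow_nonneg 1
  rw [lintegral_ellipticK_sq_div_cube, ← ENNReal.ofReal_mul (by positivity),
    ENNReal.ofReal_eq_ofReal_iff (integral_ellipticK_sq_div_nonneg 1) (by positivity)] at h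
  rw [h]; ring

lemma integral_ellipticK_sq_div_fifth :
    ∫ t in Ioi (0 : ℝ), ellipticK (-t ^ 2) ^ 2 / (2 * t ^ 2 + 1) ^ 5 * t =
      3 * Real.pi / 64 * radicandIntegral fun a _ => (1 - a) ^ 2 := by
  have h := ofReal_integral_ellipticK_sq_div 3
  have h0 := radicandIntegral_one_sub_pow_nonneg 2
  rw [lintegral_ellipticK_sq_div_fifth, ← ENNReal.ofReal_mul (by positivity),
    ENNReal.ofReal_eq_ofReal_iff (integral_ellipticK_sq_div_nonneg 3) (by positivity)] at h
  rw [h]; ring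

/-! ### Evaluation of the integral defining `zetaFour`. -/

/-- A primitive, up to multiples of the square of `ellipticK`, of `zetaFourIntegrand`. -/
def zetaFourPrimitive (t : ℝ) : ℝ :=
  ((3 / 16 * ((2 * t ^ 2 + 1)⁻¹) ^ 4 - 1 / 2 * ((2 * t ^ 2 + 1)⁻¹) ^ 2) * ellipticE (-t ^ 2) ^ 2 +
    (-3 / 16 * ((2 * t ^ 2 + 1)⁻¹) ^ 4 + 5 / 16 * ((2 * t ^ 2 + 1)⁻¹) ^ 3 +
      1 / 2 * ((2 * t ^ 2 + 1)⁻¹) ^ 2) * (ellipticE (-t ^ 2) * ellipticK (-t ^ 2))) +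
    (-1 / 2 * ((2 * t ^ 2 + 1)⁻¹) ^ 4 - 5 / 32 * ((2 * t ^ 2 + 1)⁻¹) ^ 3 +
      11 / 32 * ((2 * t ^ 2 + 1)⁻¹) ^ 2) * ellipticK (-t ^ 2) ^ 2

/-- The derivatives of `E` and `K` are again combinations of `E` and `K`, so differentiation
preserves quadratic forms in them. The coefficients of the primitive cancel the `E²` and `E K` terms
of the integrand, and the remainder in `K²` has only the two powers for which the integral has been
reduced to the angular ones. -/
lemma hasDerivAt_zetaFourPrimitive {t : ℝ} (ht : 0 < t) :
    HasDerivAt zetaFourPrimitive (zetaFourIntegrand t -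
      (45 / 8 * (ellipticK (-t ^ 2) ^ 2 / (2 * t ^ 2 + 1) ^ 3 * t) -
        9 * (ellipticK (-t ^ 2) ^ 2 / (2 * t ^ 2 + 1) ^ 5 * t))) t := by
  have h2 : HasDerivAt (fun t : ℝ => t ^ 2) (2 * t) t := by
    simpa using hasDerivAt_pow 2 t
  have hE : HasDerivAt (fun t : ℝ => ellipticE (-t ^ 2)) _ t :=
    HasDerivAt.comp (h₂ := fun m => ellipticE (-m)) (h := fun t => t ^ 2) t
      (hasDerivAt_ellipticE (pow_pos ht 2)) h2
  have hK : HasDerivAt (fun t : ℝ => ellipticK (-t ^ 2)) _ t :=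
    HasDerivAt.comp (h₂ := fun m => ellipticK (-m)) (h := fun t => t ^ 2) t
      (hasDerivAt_ellipticK (pow_pos ht 2)) h2
  have hw : HasDerivAt (fun t : ℝ => (2 * t ^ 2 + 1)⁻¹) _ t :=
    ((h2.const_mul 2).add_const 1).inv (by positivity)
  have := (((((hw.pow 4).const_mul (3 / 16)).sub ((hw.pow 2).const_mul (1 / 2))).mul (hE.pow 2)).add
    (((((hw.pow 4).const_mul (-3 / 16)).add ((hw.pow 3).const_mul (5 / 16))).add
      ((hw.pow 2).const_mul (1 / 2))).mul (hE.mul hK))).add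
    (((((hw.pow 4).const_mul (-1 / 2)).sub ((hw.pow 3).const_mul (5 / 32))).add
      ((hw.pow 2).const_mul (11 / 32))).mul (hK.pow 2))
  refine HasDerivAt.congr_deriv (f := zetaFourPrimitive) this ?_
  simp only [Pi.add_apply, Pi.sub_apply, Pi.mul_apply, Pi.pow_apply]
  unfold zetaFourIntegrand
  generalize ellipticE (-t ^ 2) = e
  generalize ellipticK (-t ^ 2) = k
  have hz : 0 < 2 * t ^ 2 + 1 := by positivity
  norm_num
  field_simp
  ring

lemma continuous_zetaFourPrimitive : Continuous zetaFourPrimitive := by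
  have hE := continuous_ellipticE_sq
  have hK := continuous_ellipticK_sq
  have hw : Continuous fun t : ℝ => (2 * t ^ 2 + 1)⁻¹ :=
    Continuous.inv₀ (by fun_prop) fun t => by positivity
  unfold zetaFourPrimitive
  fun_prop

lemma zetaFourPrimitive_zero : zetaFourPrimitive 0 = 0 := by
  unfold zetaFourPrimitive
  simp [ellipticE_zero, ellipticK_zero]
  ring

/-- Each coefficient is at most `2 w²` in absolute value for `w = (2t² + 1)⁻¹`, while the products
of `E` and `K` grow at most like `w⁻¹`. -/
lemma tendsto_zetaFourPrimitive : Filter.Tendsto zetaFourPrimitive Filter.atTop (nhds 0) := by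
  have hlim : Filter.Tendsto (fun t : ℝ => 6 * (Real.pi / 2) ^ 2 * (2 * t ^ 2 + 1)⁻¹)
      Filter.atTop (nhds 0) := by
    have h : Filter.Tendsto (fun t : ℝ => 2 * t ^ 2 + 1) Filter.atTop Filter.atTop :=
      Filter.tendsto_atTop_add_const_right _ _
        ((Filter.tendsto_pow_atTop (by norm_num)).const_mul_atTop (by norm_num))
    simpa using h.inv_tendsto_atTop.const_mul (6 * (Real.pi / 2) ^ 2)
  refine squeeze_zero_norm (fun t => ?_) hlim
  have hz : 1 ≤ 2 * t ^ 2 + 1 := by nlinarith [sq_nonneg t]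
  have hw1 : (2 * t ^ 2 + 1)⁻¹ ≤ 1 := inv_le_one_of_one_le₀ hz
  have hw0 : 0 < (2 * t ^ 2 + 1)⁻¹ := by positivity
  have e : 6 * (Real.pi / 2) ^ 2 * (2 * t ^ 2 + 1)⁻¹ =
      3 * (2 * ((2 * t ^ 2 + 1)⁻¹) ^ 2) * ((Real.pi / 2) ^ 2 * (2 * t ^ 2 + 1)) := by
    field_simp
    ring
  rw [e, Real.norm_eq_abs]
  unfold zetaFourPrimitive
  generalize (2 * t ^ 2 + 1)⁻¹ = w at hw0 hw1
  have h2 : 0 < w ^ 2 := by positivity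
  have h3 : 0 < w ^ 3 := by positivity
  have h4 : 0 < w ^ 4 := by positivity
  have h32 : w ^ 3 ≤ w ^ 2 := pow_le_pow_of_le_one hw0.le hw1 (by norm_num)
  have h42 : w ^ 4 ≤ w ^ 2 := pow_le_pow_of_le_one hw0.le hw1 (by norm_num)
  refine abs_quadratic_elliptic_le t ?_ ?_ ?_ <;> rw [abs_le] <;> constructor <;> linarith

theorem zetaFour_eq : zetaFour = 24 / Real.pi * angleIntegral := by
  have h3 := integrableOn_ellipticK_sq_div 1
  have h5 := integrableOn_ellipticK_sq_div 3
  have hr : IntegrableOn (fun t => 45 / 8 * (ellipticK (-t ^ 2) ^ 2 / (2 * t ^ 2 + 1) ^ 3 * t) -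
        9 * (ellipticK (-t ^ 2) ^ 2 / (2 * t ^ 2 + 1) ^ 5 * t)) (Ioi 0) :=
    (h3.const_mul _).sub (h5.const_mul _)
  have h := integral_Ioi_of_hasDerivAt_of_tendsto
    continuous_zetaFourPrimitive.continuousWithinAt
    (fun t ht => hasDerivAt_zetaFourPrimitive ht)
    (integrableOn_zetaFourIntegrand.sub hr) tendsto_zetaFourPrimitive
  rw [zetaFourPrimitive_zero, integral_sub integrableOn_zetaFourIntegrand hr,
    integral_sub (h3.const_mul _) (h5.const_mul _), integral_const_mul, integral_const_mul,
    integral_ellipticK_sq_div_cube, integral_ellipticK_sq_div_fifth] at h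
  -- The boundary terms vanish. The remainder contributes `45π/128` times the first angular integral
  -- minus `27π/64` times the second, which is `9π/128` times the combination `5, -6` of
  -- `angleIntegral_eq`.
  have h' : ∫ t in Ioi (0 : ℝ), zetaFourIntegrand t = 9 * Real.pi / 128 * angleIntegral := by
    rw [angleIntegral_eq]
    linarith
  rw [zetaFour, h']
  field_simp
  ring

theorem zeta_four_eq : zeta 4 (by norm_num) = zetaFour := by
  rw [zeta_eq, gaussTriple_eq, zetaFour_eq]; ring

/-! ### The four-dimensional cube: moments and extrema. -/

lemma sphereMean_four_ar : sphereMean 4 ar = 8 := by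
  rw [sphereMean_ar 4 (by norm_num)]
  have h1 := Real.Gamma_add_one (s := 1 / 2) (by norm_num)
  have h2 := Real.Gamma_add_one (s := 3 / 2) (by norm_num)
  rw [Real.Gamma_one_half_eq] at h1
  rw [show (3 / 2 : ℝ) = 1 / 2 + 1 by norm_num, h1] at h2
  have e1 : ((4 : ℕ) : ℝ) / 2 = 2 := by norm_num
  have e2 : (((4 : ℕ) : ℝ) + 1) / 2 = 1 / 2 + 1 + 1 := by norm_num
  rw [e1, e2, h2, Real.Gamma_two]
  have : 0 < √Real.pi := Real.sqrt_pos.2 Real.pi_pos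
  push_cast
  field_simp
  norm_num

lemma sphereMean_four_ar_sq :
    sphereMean 4 (fun u => ar u ^ 2) = 12 + 6 * zetaFour + 3 * Real.pi := by
  rw [sphereMean_ar_sq 4 (by norm_num), zeta_four_eq]
  push_cast
  ring

lemma sum_offDiag_sq_four {u : EuclideanSpace ℝ (Fin 4)} (hu : ‖u‖ = 1) :
    ∑ p ∈ (Finset.univ : Finset (Fin 4)).offDiag, (u p.1 ^ 2 + u p.2 ^ 2) = 6 := by
  have h := sum_sq_eq_one hu
  have e : (Finset.univ : Finset (Fin 4)).offDiag =
    {(0, 1), (0, 2), (0, 3), (1, 0), (1, 2), (1, 3), (2, 0), (2, 1), (2, 3), (3, 0), (3, 1), (3, 2)} := by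
    decide
  rw [e]
  simp [Fin.sum_univ_four] at h ⊢
  linarith

lemma sq_add_sq_le_one {n : ℕ} {u : EuclideanSpace ℝ (Fin n)} (hu : ‖u‖ = 1) {i j : Fin n}
    (hij : i ≠ j) : u i ^ 2 + u j ^ 2 ≤ 1 := by
  rw [← sum_sq_eq_one hu, ← Finset.sum_pair hij (f := fun k => u k ^ 2)]
  exact Finset.sum_le_sum_of_subset_of_nonneg (Finset.subset_univ _) fun k _ _ => sq_nonneg _

/-- Each radicand lies in `[0, 1]`, hence is at most its square root, and the radicands add up to
`6`. -/
lemma six_le_ar {u : EuclideanSpace ℝ (Fin 4)} (hu : ‖u‖ = 1) : 6 ≤ ar u := by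
  rw [ar_eq hu, ← sum_offDiag_sq_four hu]
  refine Finset.sum_le_sum fun p hp => ?_
  have h1 := sq_add_sq_le_one hu (Finset.mem_offDiag.1 hp).2.2
  refine Real.le_sqrt_of_sq_le ?_
  nlinarith [sq_nonneg (u p.1), sq_nonneg (u p.2)]

/-- Cauchy-Schwarz for the twelve ordered pairs: `ar u ^ 2 ≤ 12 * 6 = (6 √2) ^ 2`. -/
lemma ar_le {u : EuclideanSpace ℝ (Fin 4)} (hu : ‖u‖ = 1) : ar u ≤ 6 * √2 := by
  have h := sum_offDiag_sq_four hu
  have hcs := sq_sum_le_card_mul_sum_sq (s := (Finset.univ : Finset (Fin 4)).offDiag)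
    (f := fun p => √(u p.1 ^ 2 + u p.2 ^ 2))
  have e : ∀ p : Fin 4 × Fin 4, √(u p.1 ^ 2 + u p.2 ^ 2) ^ 2 = u p.1 ^ 2 + u p.2 ^ 2 :=
    fun p => Real.sq_sqrt (by positivity)
  simp only [e] at hcs
  rw [h, ← ar_eq hu, Finset.offDiag_card] at hcs
  have h72 : ar u ^ 2 ≤ 72 := by
    refine hcs.trans ?_
    norm_num
  refine abs_le_of_sq_le_sq' ?_ (by positivity) |>.2
  rw [mul_pow, Real.sq_sqrt (by norm_num)]
  linarith

lemma isGreatest_ar :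
    IsGreatest (ar '' Metric.sphere (0 : EuclideanSpace ℝ (Fin 4)) 1) (6 * √2) := by
  constructor
  -- Equality in Cauchy-Schwarz needs all summands equal, which the main diagonal direction
  -- provides.
  · set v : EuclideanSpace ℝ (Fin 4) := WithLp.toLp 2 fun _ => 1 / 2 with hv
    have hn : ‖v‖ = 1 := by
      rw [EuclideanSpace.norm_eq]
      simp [hv]
      norm_num
    refine ⟨v, by simpa using hn, ?_⟩
    rw [ar_eq hn]
    have e : ∀ p : Fin 4 × Fin 4, √(v p.1 ^ 2 + v p.2 ^ 2) = √2 / 2 := fun p => by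
      rw [show v p.1 ^ 2 + v p.2 ^ 2 = 2 / 2 ^ 2 by simp [hv]; norm_num, Real.sqrt_div (by norm_num),
        Real.sqrt_sq (by norm_num)]
    simp only [e, Finset.sum_const, Finset.offDiag_card]
    norm_num
    ring
  · rintro _ ⟨u, hu, rfl⟩
    exact ar_le (by simpa using hu)

lemma isLeast_ar : IsLeast (ar '' Metric.sphere (0 : EuclideanSpace ℝ (Fin 4)) 1) 6 := by
  constructor
  · have hn : ‖EuclideanSpace.single (0 : Fin 4) (1 : ℝ)‖ = 1 := by simp
    -- For a coordinate vector every radicand is `0` or `1`, the equality case of `s ≤ √s`.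
    refine ⟨EuclideanSpace.single 0 1, by simp, ?_⟩
    rw [ar_eq hn, ← sum_offDiag_sq_four hn]
    refine Finset.sum_congr rfl fun p hp => ?_
    have hne := (Finset.mem_offDiag.1 hp).2.2
    rcases eq_or_ne p.1 0 with h1 | h1 <;> rcases eq_or_ne p.2 0 with h2 | h2
    · exact absurd (h1.trans h2.symm) hne
    all_goals simp [h1, h2]
  · rintro _ ⟨u, hu, rfl⟩
    exact six_le_ar (by simpa using hu)

end CubeShadow

end

theorem mainTheorem2 :
    -- the surface area of the projected unit `n`-cube, for every unit vector `u`
    (∀ n : ℕ, 2 ≤ n → ∀ u : EuclideanSpace ℝ (Fin n), ‖u‖ = 1 →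
      CubeShadow.surfaceArea u =
        ENNReal.ofReal (2 * ∑ i : Fin n, ∑ j ∈ Finset.Ioi i, √(u i ^ 2 + u j ^ 2))) ∧
    -- the moments, the maximum and the minimum for the `4`-cube
    CubeShadow.sphereMean 4 CubeShadow.ar = 8 ∧
    CubeShadow.sphereMean 4 (fun u => CubeShadow.ar u ^ 2)
      = 12 + 6 * CubeShadow.zetaFour + 3 * Real.pi ∧
    IsGreatest (CubeShadow.ar '' Metric.sphere (0 : EuclideanSpace ℝ (Fin 4)) 1) (6 * √2) ∧
    IsLeast (CubeShadow.ar '' Metric.sphere (0 : EuclideanSpace ℝ (Fin 4)) 1) 6 ∧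
    -- the two triple integrals
    (∫ θ in (0 : ℝ)..Real.pi / 2, ∫ φ in (0 : ℝ)..Real.pi / 2, ∫ ψ in (0 : ℝ)..Real.pi / 2,
      Real.sin φ * Real.sin ψ * √(Real.cos φ ^ 2 * Real.sin ψ ^ 2 + Real.cos ψ ^ 2)
        * (1 / (2 * Real.pi ^ 2)) * Real.sin φ * Real.sin ψ ^ 2) = Real.pi / 128 ∧
    (∫ θ in (0 : ℝ)..Real.pi / 2, ∫ φ in (0 : ℝ)..Real.pi / 2, ∫ ψ in (0 : ℝ)..Real.pi / 2,
      Real.sin φ * Real.sin ψ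
        * √(Real.sin θ ^ 2 * Real.sin φ ^ 2 * Real.sin ψ ^ 2 + Real.cos ψ ^ 2)
        * (1 / (2 * Real.pi ^ 2)) * Real.sin φ * Real.sin ψ ^ 2) = CubeShadow.zetaFour / 256 ∧
    MeasureTheory.IntegrableOn CubeShadow.zetaFourIntegrand (Set.Ioi 0) ∧
    -- the moments for the `n`-cube
    (∀ n : ℕ, 2 ≤ n →
      CubeShadow.sphereMean n CubeShadow.ar
        = √Real.pi * ((n : ℝ) - 1) * n / 2 * (Real.Gamma ((n : ℝ) / 2)
            / Real.Gamma (((n : ℝ) + 1) / 2))) ∧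
    (∀ (n : ℕ) (hn : 3 ≤ n),
      CubeShadow.sphereMean n (fun u => CubeShadow.ar u ^ 2)
        = 4 * ((n : ℝ) - 1) + ((n : ℝ) - 2) * ((n : ℝ) - 1) * CubeShadow.zeta n hn
          + ((n : ℝ) - 3) * ((n : ℝ) - 2) * ((n : ℝ) - 1) / 2 * Real.pi) ∧
    CubeShadow.zeta 4 (by norm_num) = CubeShadow.zetaFour := by
  refine ⟨fun n hn u hu => CubeShadow.surfaceArea_eq hu, CubeShadow.sphereMean_four_ar,
    CubeShadow.sphereMean_four_ar_sq, CubeShadow.isGreatest_ar, CubeShadow.isLeast_ar,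
    CubeShadow.tripleIntegral_disjoint, ?_, CubeShadow.integrableOn_zetaFourIntegrand,
    CubeShadow.sphereMean_ar, CubeShadow.sphereMean_ar_sq, CubeShadow.zeta_four_eq⟩
  rw [CubeShadow.tripleIntegral_shared, CubeShadow.zetaFour_eq]
  ring
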